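/- **Theorem (Achievability).** Consider the linear system $$x(t+1)=Ax(t)+w(t),\qquad y(t)=Cx(t)+v(t)+\phi(t),\qquad t=0,1,2,\dots,$$ with state $x(t)\in\mathbb R^n$ and $p$ scalar sensors, where $w(t)\sim\mathcal N(0,\sigma_w^2I_n)$ and $v(t)\sim\mathcal N(0,\sigma_v^2I_p)$ with $\sigma_w,\sigma_v>0$ are i.i.d. over time and independent of each other, and $x(0)$ is a random vector with arbitrary law, independent of the noise. A $k$-adversary chooses a fixed unknown set $\kappa$ of $k$ sensors and a random attack $\phi(t)$ with $\phi_d(t)=0$ for $d\notin\kappa$; no bound, moment condition or other restriction is put on $\phi$ beyond the following causality. * (Prediction) For every $t$, the collection $x(0),\ (w(s),v(s),\phi(s))_{s\le t}$ is independent of $(w(t'),\,v_d(t'))_{t'>t,\ d\notin\kappa}$. * (Filtering) For every $t$, the collection $x(0),\ (w(s),v(s))_{s<t},\ (\phi(s),v_j(s))_{s\le t,\ j\in\kappa}$ is independent of $(w(t'),\,v_d(t'))_{t'\ge t,\ d\notin\kappa}$. For a set $i$ of sensors let $C_i$ be the corresponding rows of $C$. The pair $(A,C_i)$ is observable if for some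 $\mu\ge1$ the matrix with blocks $C_i,C_iA,\dots,C_iA^{\mu-1}$ has full column rank; let $\mu_i$ be the least such $\mu$, $O_i$ the resulting matrix and $O_i^\dagger$ its pseudo-inverse. Suppose the system is $\theta$-sparse observable, i.e. $\theta$ is the smallest positive integer such that $(A,C_i)$ is observable for every set $i$ of $\theta$ sensors, and that $\theta\le p-2k$. *Kalman filters.* For every set $s$ of $p-k$ sensors, the prediction error covariance of the Kalman filter on $s$, which follows the recursion $P\mapsto APA^T+\sigma_w^2I-APC_s^T(C_sPC_s^T+\sigma_v^2I)^{-1}C_sPA^T$, converges from every positive semidefinite initial value to one and the same matrix $P_s$. Put $K_s=P_sC_s^T(C_sP_sC_s^T+\sigma_v^2I)^{-1}$, $P_{opt,s}=\operatorname{tr}P_s$ and $F_{opt,s}=\operatorname{tr}(P_s-K_sC_sP_s)$. From any fixed $\xi\in\mathbb R^n$, the steady state predictor is $\hat x_s(0)=\xi$, $\hat x_s(t+1)=A\hat x_s(t)+AK_s(y_s(t)-C_s\hat x_s(t))$, and the steady state filter is $\hat x_s(t)=\hat x^{P}_s(t)+K_s(y_s(t)-C_s\hat x^{P}_s(t))$,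 $\hat x^{P}_s(0)=\xi$, $\hat x_s^{P}(t+1)=A\hat x_s(t)$. *Residue test.* Fix a window $G=\{t_1,\dots,t_1+N-1\}$ and a design parameter $\eta>0$. For a set $i$ of $\theta$ sensors let $r_i(t)$ be the stacked outputs $y_i(t),\dots,y_i(t+\mu_i-1)$ minus $O_i\hat x_s(t)$; let $J_i$ be the block matrix with block $(a,b)$ equal to $C_iA^{a-1-b}$ if $b<a$ and $0$ otherwise ($0\le a<\mu_i$, $0\le b<\mu_i-1$), and $M_i=\sigma_w^2J_iJ_i^T+\sigma_v^2I$. The algorithm returns a set $s$ of $p-k$ sensors (any one, if there are several), together with the estimate $\hat x=\hat x_s$, such that for every $i\subseteq s$ with $|i|=\theta$ and every $G_l=\{t\in G: (t-t_1)\bmod\mu_i=l\}$, $0\le l<\mu_i$, $$\frac1{|G_l|}\sum_{t\in G_l}\operatorname{tr}\big(O_i^\dagger r_i(t)r_i^T(t)O_i^{\dagger T}\big)\le P_{opt,s}+\operatorname{tr}\big(O_i^\dagger M_iO_i^{\dagger T}\big)+\eta .$$ For filtering, $\hat x_s$ is the filter and the right-hand side is $$F_{opt,s}+\operatorname{tr}\big(O_i^\dagger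 M_iO_i^{\dagger T}\big)-2\,\mathbb E\big(v_i^T(t)L_i^TO_i^\dagger v_{i,t:t+\mu_i-1}\big)+\eta,$$ where $L_i$ consists of the columns of $K_s$ that belong to $i$ and $v_{i,t:t+\mu_i-1}$ is the stacked noise $v_i(t),\dots,v_i(t+\mu_i-1)$. *Conclusion (prediction).* Let $e(t)=x(t)-\hat x(t)$. 1. For all $\epsilon,\delta>0$ and every design parameter $0<\eta<\epsilon$ there is $N_0$ such that for all $N\ge N_0$, all attacks by a $k$-adversary that are causal in the prediction sense, and all $t_1$, with probability at least $1-\delta$ some set passes the test and, whichever passing set is returned, $$\frac1N\sum_{t\in G}e^T(t)e(t)\le\max_{|s|=p-k}P_{opt,s}+\epsilon .$$ 2. There are design parameters $\eta_N>0$ with $\eta_N\to0$ such that for every such attack and every $t_1$, almost surely, some set passes the test for all large $N$ and, whichever passing sets are returned for the windows of size $N$ (each with its own estimate), $$\limsup_{N\to\infty}\frac1N\sum_{t\in G}e^T(t)e(t)\le\max_{|s|=p-k}P_{opt,s}.$$ *Conclusion (filtering).* The same two statements hold for the filtering algorithm and all attacks that are causal in the filtering sense, with $F_{opt,s}$ in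 place of $P_{opt,s}$. -/

import Mathlib

open Matrix Filter Topology MeasureTheory ProbabilityTheory

namespace SecureEstimation

/-! ### The plant -/

/-- Parameters of a linear system with `n`-dimensional state and `p` scalar sensors: the process
noise has covariance `σw² I` and the sensor noise has covariance `σv² I`. -/
structure LinearSystem (n p : ℕ) where
  A : Matrix (Fin n) (Fin n) ℝ
  C : Matrix (Fin p) (Fin n) ℝ
  σw : ℝ
  σv : ℝ

variable {n p : ℕ}

/-- The state trajectory `x(t+1) = A x(t) + w(t)`, `x(0) = x₀`. -/
def state (S : LinearSystem n p) (x₀ : Fin n → ℝ) (w : ℕ → Fin n → ℝ) : ℕ → Fin n → ℝ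
  | 0 => x₀
  | t + 1 => S.A *ᵥ state S x₀ w t + w t

/-- The output trajectory `y(t) = C x(t) + v(t) + φ(t)`. -/
def output (S : LinearSystem n p) (x₀ : Fin n → ℝ) (w : ℕ → Fin n → ℝ)
    (v φ : ℕ → Fin p → ℝ) (t : ℕ) : Fin p → ℝ :=
  S.C *ᵥ state S x₀ w t + v t + φ t

/-- `C_s`: the rows of `C` that belong to the sensors in `s`. -/
def subC (S : LinearSystem n p) (s : Finset (Fin p)) : Matrix s (Fin n) ℝ :=
  S.C.submatrix (fun d => (d : Fin p)) id

/-- The part of an output vector that comes from the sensors in `s`. -/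
def restrict (s : Finset (Fin p)) (y : Fin p → ℝ) : s → ℝ := fun d => y d

/-! ### Observability -/

/-- The observability matrix of `(A, C_i)` with `μ` blocks; row `(a, d)` is row `d` of
`C_i A ^ a`. -/
def obsMatrix (S : LinearSystem n p) (i : Finset (Fin p)) (μ : ℕ) :
    Matrix (Fin μ × i) (Fin n) ℝ :=
  Matrix.of fun a c => (subC S i * S.A ^ (a.1 : ℕ)) a.2 c

/-- `(A, C_i)` is observable: some observability matrix has full column rank. -/
def IsObservable (S : LinearSystem n p) (i : Finset (Fin p)) : Prop :=
  ∃ μ : ℕ, 0 < μ ∧ (obsMatrix S i μ).rank = n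

/-- The observability index `μ_i` of an observable pair `(A, C_i)`. -/
noncomputable def obsIndex (S : LinearSystem n p) (i : Finset (Fin p)) : ℕ :=
  sInf {μ : ℕ | 0 < μ ∧ (obsMatrix S i μ).rank = n}

/-- The system is `θ`-sparse observable: `θ` is the smallest positive integer such that
`(A, C_i)` is observable for every set `i` of `θ` sensors. -/
def IsSparseObservable (S : LinearSystem n p) (θ : ℕ) : Prop :=
  IsLeast {m : ℕ | 0 < m ∧ ∀ i : Finset (Fin p), i.card = m → IsObservable S i} θ

/-! ### Kalman filters in steady state -/

/-- `(C_s P C_sᵀ + σv² I)⁻¹`, the inverse of the innovation covariance. -/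
noncomputable def innovInv (S : LinearSystem n p) (s : Finset (Fin p))
    (P : Matrix (Fin n) (Fin n) ℝ) : Matrix s s ℝ :=
  (subC S s * P * (subC S s)ᵀ + S.σv ^ 2 • (1 : Matrix s s ℝ))⁻¹

/-- One step of the recursion for the one-step prediction error covariance of the Kalman filter
that uses the sensors in `s`. -/
noncomputable def riccatiStep (S : LinearSystem n p) (s : Finset (Fin p))
    (P : Matrix (Fin n) (Fin n) ℝ) : Matrix (Fin n) (Fin n) ℝ :=
  S.A * P * S.Aᵀ + S.σw ^ 2 • (1 : Matrix (Fin n) (Fin n) ℝ)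
    - S.A * P * (subC S s)ᵀ * innovInv S s P * subC S s * P * S.Aᵀ

/-- The prediction error covariance of the Kalman filter on `s` at time `t`, when the
covariance at time `0` is `P₀`. -/
noncomputable def kalmanCov (S : LinearSystem n p) (s : Finset (Fin p))
    (P₀ : Matrix (Fin n) (Fin n) ℝ) (t : ℕ) : Matrix (Fin n) (Fin n) ℝ :=
  (riccatiStep S s)^[t] P₀

/-- The steady state prediction error covariance of the Kalman filter on `s`. -/
noncomputable def steadyCov (S : LinearSystem n p) (s : Finset (Fin p)) :
    Matrix (Fin n) (Fin n) ℝ :=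
  limUnder atTop (kalmanCov S s 0)

/-- The steady state filtering gain `P C_sᵀ (C_s P C_sᵀ + σv² I)⁻¹`. -/
noncomputable def filterGain (S : LinearSystem n p) (s : Finset (Fin p)) : Matrix (Fin n) s ℝ :=
  steadyCov S s * (subC S s)ᵀ * innovInv S s (steadyCov S s)

/-- The steady state prediction gain `A P C_sᵀ (C_s P C_sᵀ + σv² I)⁻¹`. -/
noncomputable def predictorGain (S : LinearSystem n p) (s : Finset (Fin p)) :
    Matrix (Fin n) s ℝ :=
  S.A * steadyCov S s * (subC S s)ᵀ * innovInv S s (steadyCov S s)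

/-- The steady state filtering error covariance of the Kalman filter on `s`. -/
noncomputable def steadyFilterCov (S : LinearSystem n p) (s : Finset (Fin p)) :
    Matrix (Fin n) (Fin n) ℝ :=
  steadyCov S s
    - steadyCov S s * (subC S s)ᵀ * innovInv S s (steadyCov S s) * subC S s * steadyCov S s

/-- `P_{opt,s}`. -/
noncomputable def Popt (S : LinearSystem n p) (s : Finset (Fin p)) : ℝ := (steadyCov S s).trace

/-- `F_{opt,s}`. -/
noncomputable def Fopt (S : LinearSystem n p) (s : Finset (Fin p)) : ℝ :=
  (steadyFilterCov S s).trace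

/-- The prediction estimate of the Kalman filter on `s`, started at `ξ` and fed with `y`:
`x̂(t+1) = A x̂(t) + L (y_s(t) - C_s x̂(t))`. -/
noncomputable def predictor (S : LinearSystem n p) (s : Finset (Fin p)) (ξ : Fin n → ℝ)
    (y : ℕ → Fin p → ℝ) : ℕ → Fin n → ℝ
  | 0 => ξ
  | t + 1 => S.A *ᵥ predictor S s ξ y t
      + predictorGain S s *ᵥ (restrict s (y t) - subC S s *ᵥ predictor S s ξ y t)

/-- The measurement update `x̂ = x̂ᴾ + L (y_s - C_s x̂ᴾ)` of the filter on `s`. -/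
noncomputable def measUpdate (S : LinearSystem n p) (s : Finset (Fin p)) (xp : Fin n → ℝ)
    (y : Fin p → ℝ) : Fin n → ℝ :=
  xp + filterGain S s *ᵥ (restrict s y - subC S s *ᵥ xp)

/-- The intermediate estimate `x̂ᴾ` of the filter: `x̂ᴾ(0) = ξ`, `x̂ᴾ(t+1) = A x̂(t)`. -/
noncomputable def filterPrior (S : LinearSystem n p) (s : Finset (Fin p)) (ξ : Fin n → ℝ)
    (y : ℕ → Fin p → ℝ) : ℕ → Fin n → ℝ
  | 0 => ξ
  | t + 1 => S.A *ᵥ measUpdate S s (filterPrior S s ξ y t) (y t)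

/-- The filtering estimate `x̂(t) = x̂ᴾ(t) + L (y_s(t) - C_s x̂ᴾ(t))`. -/
noncomputable def filterEst (S : LinearSystem n p) (s : Finset (Fin p)) (ξ : Fin n → ℝ)
    (y : ℕ → Fin p → ℝ) (t : ℕ) : Fin n → ℝ :=
  measUpdate S s (filterPrior S s ξ y t) (y t)

/-! ### The block residue tests -/

/-- `O_i`, the observability matrix of `(A, C_i)` with `μ_i` blocks. -/
noncomputable def obsMat (S : LinearSystem n p) (i : Finset (Fin p)) :
    Matrix (Fin (obsIndex S i) × i) (Fin n) ℝ :=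
  obsMatrix S i (obsIndex S i)

/-- The pseudo-inverse of `O_i`, which is `(O_iᵀ O_i)⁻¹ O_iᵀ` as `O_i` has full column rank. -/
noncomputable def obsPinv (S : LinearSystem n p) (i : Finset (Fin p)) :
    Matrix (Fin n) (Fin (obsIndex S i) × i) ℝ :=
  ((obsMat S i)ᵀ * obsMat S i)⁻¹ * (obsMat S i)ᵀ

/-- `J_i`, which maps the stacked process noise `w(t), …, w(t+μ_i-2)` to its contribution to the
stacked output: block `(a, b)` is `C_i A ^ (a-1-b)` for `b < a` and `0` otherwise. -/
noncomputable def noiseToOutput (S : LinearSystem n p) (i : Finset (Fin p)) :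
    Matrix (Fin (obsIndex S i) × i) (Fin (obsIndex S i - 1) × Fin n) ℝ :=
  Matrix.of fun a b =>
    if (b.1 : ℕ) < (a.1 : ℕ) then
      (subC S i * S.A ^ ((a.1 : ℕ) - 1 - (b.1 : ℕ))) a.2 b.2
    else 0

/-- `M_i = σw² J_i J_iᵀ + σv² I`. -/
noncomputable def blockNoiseCov (S : LinearSystem n p) (i : Finset (Fin p)) :
    Matrix (Fin (obsIndex S i) × i) (Fin (obsIndex S i) × i) ℝ :=
  S.σw ^ 2 • (noiseToOutput S i * (noiseToOutput S i)ᵀ)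
    + S.σv ^ 2 • (1 : Matrix (Fin (obsIndex S i) × i) (Fin (obsIndex S i) × i) ℝ)

/-- The block residue `r_i(t)`: the outputs of `i` at times `t, …, t+μ_i-1`, stacked, minus
`O_i x̂(t)`. -/
noncomputable def blockResidue (S : LinearSystem n p) (i : Finset (Fin p))
    (y : ℕ → Fin p → ℝ) (xhat : ℕ → Fin n → ℝ) (t : ℕ) : Fin (obsIndex S i) × i → ℝ :=
  fun a => y (t + (a.1 : ℕ)) a.2 - (obsMat S i *ᵥ xhat t) a

/-- `G_l = {t ∈ G | (t - t₁) mod μ = l}` for the window `G = {t₁, …, t₁+N-1}`. -/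
def group (t₁ N μ l : ℕ) : Finset ℕ :=
  (Finset.Ico t₁ (t₁ + N)).filter fun t => (t - t₁) % μ = l

/-- The average over `G_l` of `tr (O_i† r_i(t) r_i(t)ᵀ O_i†ᵀ)`. -/
noncomputable def residueAvg (S : LinearSystem n p) (i : Finset (Fin p)) (y : ℕ → Fin p → ℝ)
    (xhat : ℕ → Fin n → ℝ) (t₁ N l : ℕ) : ℝ :=
  (1 / ((group t₁ N (obsIndex S i) l).card : ℝ)) *
    ∑ t ∈ group t₁ N (obsIndex S i) l,
      (obsPinv S i * vecMulVec (blockResidue S i y xhat t) (blockResidue S i y xhat t)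
        * (obsPinv S i)ᵀ).trace

/-- The law `N(0, σ² I)` on `ℝ^ι`. -/
noncomputable def gaussianVec (ι : Type*) [Fintype ι] (σ : ℝ) : Measure (ι → ℝ) :=
  Measure.pi fun _ => gaussianReal 0 (σ ^ 2).toNNReal

/-- The expectation of `v_iᵀ(t) L_iᵀ O_i† v_{i,t:t+μ_i-1}`, where `v_{i,t:t+μ_i-1} = u` is the
stacked sensor noise of the sensors in `i`, `v_i(t)` is its first block, and `L_i` consists of
the columns of the filtering gain of `s` that belong to `i`. -/
noncomputable def gainCorrection (S : LinearSystem n p) (s i : Finset (Fin p)) (hi : i ⊆ s) : ℝ :=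
  ∫ u : Fin (obsIndex S i) × i → ℝ,
    ((filterGain S s).submatrix id (fun d : i => (⟨d, hi d.2⟩ : s)) *ᵥ
        (fun d : i => ∑ a : Fin (obsIndex S i), if (a : ℕ) = 0 then u (a, d) else 0))
      ⬝ᵥ (obsPinv S i *ᵥ u)
    ∂ gaussianVec (Fin (obsIndex S i) × i) S.σv

/-- `s` is a set of `p - k` sensors that passes the block residue test of the secure prediction
algorithm with design parameter `η` on the window `{t₁, …, t₁+N-1}`, given the outputs `y`. These
are the sets that the algorithm may return; its estimate is then `predictor S s ξ y`. -/
def PredictionReturns (S : LinearSystem n p) (k θ : ℕ) (ξ : Fin n → ℝ) (t₁ N : ℕ) (η : ℝ)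
    (y : ℕ → Fin p → ℝ) (s : Finset (Fin p)) : Prop :=
  s.card = p - k ∧
  ∀ i : Finset (Fin p), i ⊆ s → i.card = θ → ∀ l < obsIndex S i,
    residueAvg S i y (predictor S s ξ y) t₁ N l ≤
      Popt S s + (obsPinv S i * blockNoiseCov S i * (obsPinv S i)ᵀ).trace + η

/-- The same for the secure filtering algorithm, whose estimate is `filterEst S s ξ y`. -/
def FilteringReturns (S : LinearSystem n p) (k θ : ℕ) (ξ : Fin n → ℝ) (t₁ N : ℕ) (η : ℝ)
    (y : ℕ → Fin p → ℝ) (s : Finset (Fin p)) : Prop :=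
  s.card = p - k ∧
  ∀ (i : Finset (Fin p)) (hi : i ⊆ s), i.card = θ → ∀ l < obsIndex S i,
    residueAvg S i y (filterEst S s ξ y) t₁ N l ≤
      Fopt S s + (obsPinv S i * blockNoiseCov S i * (obsPinv S i)ᵀ).trace
        - 2 * gainCorrection S s i hi + η

/-! ### Performance -/

/-- `(1/N) ∑_{t ∈ G} eᵀ(t) e(t)` with `e = x - x̂` and `G = {t₁, …, t₁+N-1}`. -/
noncomputable def avgSqError (x xhat : ℕ → Fin n → ℝ) (t₁ N : ℕ) : ℝ :=
  (1 / (N : ℝ)) * ∑ t ∈ Finset.Ico t₁ (t₁ + N), (x t - xhat t) ⬝ᵥ (x t - xhat t)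

theorem sensorSets_nonempty (p k : ℕ) :
    ((Finset.univ : Finset (Fin p)).powersetCard (p - k)).Nonempty :=
  Finset.powersetCard_nonempty.2 (by simp)

/-- The maximum of `f s` over the sets `s` of `p - k` sensors. -/
noncomputable def maxOverSets (k : ℕ) (f : Finset (Fin p) → ℝ) : ℝ :=
  ((Finset.univ : Finset (Fin p)).powersetCard (p - k)).sup' (sensorSets_nonempty p k) f

/-! ### Noise and adversary -/

variable {Ω : Type*} [MeasurableSpace Ω]

/-- `w(t) ∼ N(0, σw² I)` and `v(t) ∼ N(0, σv² I)` are i.i.d. over time and independent of each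
other, and the initial state is independent of the noise. -/
structure IsNoise (S : LinearSystem n p) (P : Measure Ω) (x₀ : Ω → Fin n → ℝ)
    (w : ℕ → Ω → Fin n → ℝ) (v : ℕ → Ω → Fin p → ℝ) : Prop where
  measurable_init : Measurable x₀
  measurable_w : ∀ t, Measurable (w t)
  measurable_v : ∀ t, Measurable (v t)
  law_w : ∀ t, P.map (w t) = gaussianVec (Fin n) S.σw
  law_v : ∀ t, P.map (v t) = gaussianVec (Fin p) S.σv
  indep_time : iIndepFun (fun t ω => (w t ω, v t ω)) P
  indep_wv : ∀ t, IndepFun (w t) (v t) P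
  indep_init : IndepFun x₀ (fun ω t => (w t ω, v t ω)) P

/-- `φ` is an attack on the sensors in `κ`, where `κ` has `k` elements. -/
structure IsAttack (k : ℕ) (κ : Finset (Fin p)) (φ : ℕ → Ω → Fin p → ℝ) : Prop where
  card_eq : κ.card = k
  measurable : ∀ t, Measurable (φ t)
  eq_zero : ∀ t ω, ∀ d ∉ κ, φ t ω d = 0

/-- Causal knowledge for prediction: at each time `t`, everything that has happened up to and
including time `t` (the attack included) is independent of the process noise and of the noise in
the good sensors after time `t`. -/
def IsCausalPred (P : Measure Ω) (x₀ : Ω → Fin n → ℝ) (w : ℕ → Ω → Fin n → ℝ)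
    (v : ℕ → Ω → Fin p → ℝ) (κ : Finset (Fin p)) (φ : ℕ → Ω → Fin p → ℝ) : Prop :=
  ∀ t : ℕ, IndepFun
    (fun ω => (x₀ ω, fun s : Set.Iic t => (w s ω, v s ω, φ s ω)))
    (fun ω => fun r : Set.Ioi t => (w r ω, fun d : {d : Fin p // d ∉ κ} => v r ω d)) P

/-- Causal knowledge for filtering: at each time `t`, the attack up to and including time `t`, the
noise before time `t` and the noise in the attacked sensors up to and including time `t` are
jointly independent of the process noise and of the noise in the good sensors from time `t` on. -/
def IsCausalFilt (P : Measure Ω) (x₀ : Ω → Fin n → ℝ) (w : ℕ → Ω → Fin n → ℝ)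
    (v : ℕ → Ω → Fin p → ℝ) (κ : Finset (Fin p)) (φ : ℕ → Ω → Fin p → ℝ) : Prop :=
  ∀ t : ℕ, IndepFun
    (fun ω => (x₀ ω, (fun s : Set.Iio t => (w s ω, v s ω)),
      (fun s : Set.Iic t => (φ s ω, fun j : κ => v s ω j))))
    (fun ω => fun r : Set.Ici t => (w r ω, fun d : {d : Fin p // d ∉ κ} => v r ω d)) P

/-- The random state trajectory, as a function of the outcome. -/
def statePath (S : LinearSystem n p) (x₀ : Ω → Fin n → ℝ) (w : ℕ → Ω → Fin n → ℝ) (ω : Ω) :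
    ℕ → Fin n → ℝ :=
  state S (x₀ ω) (fun t => w t ω)

/-- The random output trajectory, as a function of the outcome. -/
def outputPath (S : LinearSystem n p) (x₀ : Ω → Fin n → ℝ) (w : ℕ → Ω → Fin n → ℝ)
    (v φ : ℕ → Ω → Fin p → ℝ) (ω : Ω) : ℕ → Fin p → ℝ :=
  output S (x₀ ω) (fun t => w t ω) (fun t => v t ω) (fun t => φ t ω)

end SecureEstimation

open SecureEstimation

/-!
Secure state estimation against sensor attacks, by Kalman filters and block residue tests.

*Steady state.* By completion of the square the Riccati step is the least of the affine maps
`P ↦ (A - L C) P (A - L C)ᵀ + σw² I + σv² L Lᵀ`, attained at the Kalman gain, so it is monotone.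
From `0` the covariances increase, and observability bounds them, because some gains cancel every
error in finitely many steps. The limit solves a Lyapunov equation whose right hand side is at least
`σw² I`, hence the closed loop is stable, and a sandwich gives convergence from every initial value
(`exists_isSteady`).

*Test passed implies small error.* Take `θ` sensors `i` of the returned set that are not attacked.
As `O_i† O_i = I`, the normalized residue is `e + U ζ`, where `e` is the estimation error and `ζ` is
the noise of the process and of the good sensors over one block (`trace_residue_eq`). By causality
`e = b + B ζ` with `b` independent of `ζ`; `B = 0` for prediction, and for filtering `B` carries the
measurement noise of the current time. Hence
`|e + U ζ|² = |e|² + 2 bᵀ U ζ + ζᵀ (Uᵀ U + 2 Bᵀ U) ζ`. Within one group of the window the blocks are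
disjoint, so the middle terms form a martingale; the mean of the last term is what the threshold
allows for besides the optimal error. The adversary can make `b` as large as it likes, without
moments. Therefore the martingale is bounded by exponential supermartingales, which need no moments
(`IsInnovation.lintegral_prod_le_one`), in the self-normalized form
`|∑ bᵀ U ζ| ≤ c √N log N (1 + ∑ |b|² / N)` up to probability `O(1 / N²)` (`exists_linear_bound`);
for large `N` the right hand side is absorbed by `∑ |e|²` (`exists_residue_sound`).

*Some set passes.* The set of all good sensors does. Its prediction error obeys a stable linear
recursion driven by the noise, and telescoping `eᵀ X e`, where `X` solves the Lyapunov equation dual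
to that of the covariance, turns the sum of squared residues into its stationary mean plus
martingale terms and a contribution of the initial error of the group (`exists_residue_complete`).
That error may have no moments, as the law of `x(0)` is arbitrary, but it is tight uniformly in time
(`exists_predError_tight`).

*Conclusion.* All constants are uniform in the attack and in `t₁`. The exceptional probabilities
`O(1 / N²)` give the statement for a finite window directly, and the asymptotic one by
Borel–Cantelli, with design parameters that vanish more slowly than `log N / √N`. Prediction
and filtering are instances of one notion, `IsEstimator`, to which `IsEstimator.guarantees` applies.
-/

namespace SecureEstimation

/-! ### The Riccati recursion -/

section Riccati

open scoped MatrixOrder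

variable {n p : ℕ} (S : LinearSystem n p) (s : Finset (Fin p))

theorem posSemidef_conj {ι κ : Type*} [Fintype ι] [Fintype κ] {P : Matrix ι ι ℝ}
    (hP : P.PosSemidef) (M : Matrix κ ι ℝ) : (M * P * Mᵀ).PosSemidef := by
  simpa using hP.mul_mul_conjTranspose_same M

theorem posSemidef_mul_transpose {ι κ : Type*} [Fintype ι] [Fintype κ] (M : Matrix κ ι ℝ) :
    (M * Mᵀ).PosSemidef := by
  simpa using Matrix.posSemidef_self_mul_conjTranspose M

theorem transpose_eq_of_posSemidef {ι : Type*} {P : Matrix ι ι ℝ}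
    (hP : P.PosSemidef) : Pᵀ = P := by
  have h : P.IsSymm := by simpa using hP.isHermitian
  exact h

/-- The covariance `C_s P C_sᵀ + σv² I` of the innovation. -/
noncomputable def innovCov (P : Matrix (Fin n) (Fin n) ℝ) : Matrix s s ℝ :=
  subC S s * P * (subC S s)ᵀ + S.σv ^ 2 • (1 : Matrix s s ℝ)

variable {S}

theorem posDef_innovCov (hσv : 0 < S.σv) {P : Matrix (Fin n) (Fin n) ℝ} (hP : P.PosSemidef) :
    (innovCov S s P).PosDef :=
  Matrix.PosDef.posSemidef_add (posSemidef_conj hP _) (Matrix.PosDef.one.smul (by positivity))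

theorem innovCov_mul_innovInv (hσv : 0 < S.σv) {P : Matrix (Fin n) (Fin n) ℝ}
    (hP : P.PosSemidef) : innovCov S s P * innovInv S s P = 1 :=
  Matrix.mul_nonsing_inv _ ((Matrix.isUnit_iff_isUnit_det _).1 (posDef_innovCov s hσv hP).isUnit)

theorem innovInv_mul_innovCov (hσv : 0 < S.σv) {P : Matrix (Fin n) (Fin n) ℝ}
    (hP : P.PosSemidef) : innovInv S s P * innovCov S s P = 1 :=
  Matrix.nonsing_inv_mul _ ((Matrix.isUnit_iff_isUnit_det _).1 (posDef_innovCov s hσv hP).isUnit)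

theorem transpose_innovInv {P : Matrix (Fin n) (Fin n) ℝ} (hP : P.PosSemidef) :
    (innovInv S s P)ᵀ = innovInv S s P := by
  rw [innovInv, Matrix.transpose_nonsing_inv]
  simp [Matrix.transpose_mul, transpose_eq_of_posSemidef hP, Matrix.mul_assoc]

variable (S)

/-- The error dynamics `A - L C_s` of an observer with gain `L`. -/
noncomputable def closedLoop (L : Matrix (Fin n) s ℝ) : Matrix (Fin n) (Fin n) ℝ :=
  S.A - L * subC S s

/-- The covariance `σw² I + σv² L Lᵀ` of the noise that drives the error of an observer with
gain `L`. -/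
noncomputable def gainNoiseCov (L : Matrix (Fin n) s ℝ) : Matrix (Fin n) (Fin n) ℝ :=
  S.σw ^ 2 • (1 : Matrix (Fin n) (Fin n) ℝ) + S.σv ^ 2 • (L * Lᵀ)

/-- One step of the error covariance of an observer with gain `L`. -/
noncomputable def gainStep (L : Matrix (Fin n) s ℝ) (P : Matrix (Fin n) (Fin n) ℝ) :
    Matrix (Fin n) (Fin n) ℝ :=
  closedLoop S s L * P * (closedLoop S s L)ᵀ + gainNoiseCov S s L

/-- The Kalman gain `A P C_sᵀ (C_s P C_sᵀ + σv² I)⁻¹`. -/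
noncomputable def kalmanGain (P : Matrix (Fin n) (Fin n) ℝ) : Matrix (Fin n) s ℝ :=
  S.A * P * (subC S s)ᵀ * innovInv S s P

variable {S}

/-- Completion of the square: the Kalman gain minimizes the error covariance. -/
theorem gainStep_eq (hσv : 0 < S.σv) {P : Matrix (Fin n) (Fin n) ℝ} (hP : P.PosSemidef)
    (L : Matrix (Fin n) s ℝ) :
    gainStep S s L P = riccatiStep S s P
      + (L - kalmanGain S s P) * innovCov S s P * (L - kalmanGain S s P)ᵀ := by
  have h1 : kalmanGain S s P * innovCov S s P = S.A * P * (subC S s)ᵀ := by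
    rw [kalmanGain, Matrix.mul_assoc, innovInv_mul_innovCov s hσv hP, Matrix.mul_one]
  have h2 : innovCov S s P * (kalmanGain S s P)ᵀ = subC S s * P * S.Aᵀ := by
    rw [kalmanGain, Matrix.transpose_mul, transpose_innovInv s hP, ← Matrix.mul_assoc,
      innovCov_mul_innovInv s hσv hP, Matrix.one_mul]
    simp [Matrix.transpose_mul, transpose_eq_of_posSemidef hP, Matrix.mul_assoc]
  have h3 : riccatiStep S s P = S.A * P * S.Aᵀ + S.σw ^ 2 • (1 : Matrix (Fin n) (Fin n) ℝ)
      - kalmanGain S s P * (subC S s * P * S.Aᵀ) := by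
    simp only [riccatiStep, kalmanGain, Matrix.mul_assoc]
  have h4 : L * innovCov S s P * Lᵀ
      = L * subC S s * P * (subC S s)ᵀ * Lᵀ + S.σv ^ 2 • (L * Lᵀ) := by
    simp [innovCov, Matrix.mul_add, Matrix.add_mul, Matrix.mul_assoc]
  have h5 : (L - kalmanGain S s P) * innovCov S s P * (L - kalmanGain S s P)ᵀ
      = L * innovCov S s P * Lᵀ - L * (subC S s * P * S.Aᵀ) - S.A * P * (subC S s)ᵀ * Lᵀ
        + kalmanGain S s P * (subC S s * P * S.Aᵀ) := by
    rw [Matrix.sub_mul, h1, ← h2, Matrix.transpose_sub, ← h1]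
    simp only [Matrix.sub_mul, Matrix.mul_sub, Matrix.mul_assoc]
    abel
  rw [h5, h4, h3, gainStep, gainNoiseCov, closedLoop]
  simp only [Matrix.transpose_sub, Matrix.transpose_mul, Matrix.sub_mul, Matrix.mul_sub,
    Matrix.mul_assoc]
  abel

theorem gainStep_kalmanGain (hσv : 0 < S.σv) {P : Matrix (Fin n) (Fin n) ℝ}
    (hP : P.PosSemidef) : gainStep S s (kalmanGain S s P) P = riccatiStep S s P := by
  simp [gainStep_eq s hσv hP]

theorem riccatiStep_le_gainStep (hσv : 0 < S.σv) {P : Matrix (Fin n) (Fin n) ℝ}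
    (hP : P.PosSemidef) (L : Matrix (Fin n) s ℝ) : riccatiStep S s P ≤ gainStep S s L P := by
  rw [Matrix.le_iff, gainStep_eq s hσv hP, add_sub_cancel_left]
  exact posSemidef_conj (posDef_innovCov s hσv hP).posSemidef _

theorem posSemidef_gainNoiseCov (L : Matrix (Fin n) s ℝ) : (gainNoiseCov S s L).PosSemidef :=
  (Matrix.PosSemidef.one.smul (by positivity)).add
    ((posSemidef_mul_transpose L).smul (by positivity))

theorem gainStep_mono (L : Matrix (Fin n) s ℝ) {P P' : Matrix (Fin n) (Fin n) ℝ} (h : P ≤ P') :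
    gainStep S s L P ≤ gainStep S s L P' := by
  rw [Matrix.le_iff] at h ⊢
  have : gainStep S s L P' - gainStep S s L P
      = closedLoop S s L * (P' - P) * (closedLoop S s L)ᵀ := by
    simp [gainStep, Matrix.mul_sub, Matrix.sub_mul]
  rw [this]
  exact posSemidef_conj h _

theorem posSemidef_gainStep {L : Matrix (Fin n) s ℝ} {P : Matrix (Fin n) (Fin n) ℝ}
    (hP : P.PosSemidef) : (gainStep S s L P).PosSemidef :=
  (posSemidef_conj hP _).add (posSemidef_gainNoiseCov s L)

theorem posSemidef_riccatiStep (hσv : 0 < S.σv) {P : Matrix (Fin n) (Fin n) ℝ}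
    (hP : P.PosSemidef) : (riccatiStep S s P).PosSemidef := by
  rw [← gainStep_kalmanGain s hσv hP]
  exact posSemidef_gainStep s hP

theorem riccatiStep_mono (hσv : 0 < S.σv) {P P' : Matrix (Fin n) (Fin n) ℝ}
    (hP : P.PosSemidef) (hP' : P'.PosSemidef) (h : P ≤ P') :
    riccatiStep S s P ≤ riccatiStep S s P' := by
  rw [← gainStep_kalmanGain s hσv hP']
  exact (riccatiStep_le_gainStep s hσv hP _).trans (gainStep_mono s _ h)

theorem kalmanCov_succ (P₀ : Matrix (Fin n) (Fin n) ℝ) (t : ℕ) :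
    kalmanCov S s P₀ (t + 1) = riccatiStep S s (kalmanCov S s P₀ t) := by
  simp [kalmanCov, Function.iterate_succ_apply']

theorem kalmanCov_add (P₀ : Matrix (Fin n) (Fin n) ℝ) (t r : ℕ) :
    kalmanCov S s P₀ (r + t) = kalmanCov S s (kalmanCov S s P₀ t) r := by
  simp [kalmanCov, Function.iterate_add_apply]

theorem posSemidef_kalmanCov (hσv : 0 < S.σv) {P₀ : Matrix (Fin n) (Fin n) ℝ}
    (hP₀ : P₀.PosSemidef) (t : ℕ) : (kalmanCov S s P₀ t).PosSemidef := by
  induction t with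
  | zero => exact hP₀
  | succ t ih => rw [kalmanCov_succ]; exact posSemidef_riccatiStep s hσv ih

theorem kalmanCov_mono (hσv : 0 < S.σv) {P P' : Matrix (Fin n) (Fin n) ℝ}
    (hP : P.PosSemidef) (hP' : P'.PosSemidef) (h : P ≤ P') (t : ℕ) :
    kalmanCov S s P t ≤ kalmanCov S s P' t := by
  induction t with
  | zero => exact h
  | succ t ih =>
    rw [kalmanCov_succ, kalmanCov_succ]
    exact riccatiStep_mono s hσv (posSemidef_kalmanCov s hσv hP t)
      (posSemidef_kalmanCov s hσv hP' t) ih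

theorem kalmanCov_zero_monotone (hσv : 0 < S.σv) : Monotone (kalmanCov S s 0) := by
  refine monotone_nat_of_le_succ fun t => ?_
  rw [kalmanCov_add]
  refine kalmanCov_mono s hσv .zero (posSemidef_kalmanCov s hσv .zero 1) ?_ t
  rw [Matrix.le_iff, sub_zero]
  exact posSemidef_kalmanCov s hσv .zero 1

/-! ### Boundedness of the error covariance -/

variable (S)

/-- The error transition matrix `(A - L_{r-1} C_s) ⋯ (A - L_0 C_s)` of an observer with
time-varying gains. -/
noncomputable def transition (L : ℕ → Matrix (Fin n) s ℝ) : ℕ → Matrix (Fin n) (Fin n) ℝ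
  | 0 => 1
  | r + 1 => closedLoop S s (L r) * transition L r

/-- The error covariance after `r` steps of an observer with time-varying gains, from initial
covariance `P`. -/
noncomputable def gainCov (L : ℕ → Matrix (Fin n) s ℝ) (P : Matrix (Fin n) (Fin n) ℝ) :
    ℕ → Matrix (Fin n) (Fin n) ℝ
  | 0 => P
  | r + 1 => gainStep S s (L r) (gainCov L P r)

variable {S}

theorem gainCov_eq (L : ℕ → Matrix (Fin n) s ℝ) (P : Matrix (Fin n) (Fin n) ℝ) (r : ℕ) :
    gainCov S s L P r
      = transition S s L r * P * (transition S s L r)ᵀ + gainCov S s L 0 r := by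
  induction r with
  | zero => simp [gainCov, transition]
  | succ r ih =>
    rw [gainCov, ih, gainCov, transition]
    simp [gainStep, Matrix.mul_add, Matrix.add_mul, Matrix.mul_assoc, add_assoc]

theorem kalmanCov_le_gainCov (hσv : 0 < S.σv) (L : ℕ → Matrix (Fin n) s ℝ)
    {P : Matrix (Fin n) (Fin n) ℝ} (hP : P.PosSemidef) (r : ℕ) :
    kalmanCov S s P r ≤ gainCov S s L P r := by
  induction r with
  | zero => exact le_rfl
  | succ r ih =>
    rw [kalmanCov_succ, gainCov]
    exact (riccatiStep_le_gainStep s hσv (posSemidef_kalmanCov s hσv hP r) (L r)).trans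
      (gainStep_mono s _ ih)

/-- A gain `K` for which `x ↦ x - K C x` maps a given subspace into its intersection with the
kernel of `C`. -/
theorem exists_correction {q : Type*} [Fintype q] (C : Matrix q (Fin n) ℝ)
    (V : Submodule ℝ (Fin n → ℝ)) :
    ∃ K : Matrix (Fin n) q ℝ, ∀ x ∈ V, x - K *ᵥ (C *ᵥ x) ∈ V ∧ C *ᵥ (x - K *ᵥ (C *ᵥ x)) = 0 := by
  classical
  let f : V →ₗ[ℝ] (q → ℝ) := C.mulVecLin.comp V.subtype
  obtain ⟨g, hg⟩ := f.rangeRestrict.exists_rightInverse_of_surjective f.range_rangeRestrict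
  obtain ⟨h, hh⟩ := LinearMap.exists_extend g
  refine ⟨LinearMap.toMatrix' (V.subtype.comp h), fun x hx => ?_⟩
  have e1 : LinearMap.toMatrix' (V.subtype.comp h) *ᵥ (C *ᵥ x)
      = (g (f.rangeRestrict ⟨x, hx⟩) : Fin n → ℝ) := by
    rw [LinearMap.toMatrix'_mulVec]
    have := LinearMap.congr_fun hh (f.rangeRestrict ⟨x, hx⟩)
    simp only [LinearMap.comp_apply, Submodule.subtype_apply] at this ⊢
    rw [← this]
    rfl
  have e2 : C *ᵥ (g (f.rangeRestrict ⟨x, hx⟩) : Fin n → ℝ) = C *ᵥ x := by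
    have := congrArg Subtype.val (LinearMap.congr_fun hg (f.rangeRestrict ⟨x, hx⟩))
    simpa [f] using this
  rw [e1, Matrix.mulVec_sub, e2, sub_self]
  exact ⟨V.sub_mem hx (Subtype.coe_prop _), rfl⟩

/-- With suitable gains, every error reached after `r` steps comes from an initial error that the
outputs of the first `r` steps do not reveal. -/
theorem exists_gains_transition (r : ℕ) : ∃ L : ℕ → Matrix (Fin n) s ℝ, ∀ x : Fin n → ℝ,
    ∃ z, transition S s L r *ᵥ x = S.A ^ r *ᵥ z ∧ ∀ a < r, subC S s *ᵥ (S.A ^ a *ᵥ z) = 0 := by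
  -- The invariant: the errors after `r` steps lie in `A ^ r` applied to
  -- `W r = {z | C A ^ a z = 0 for a < r}`. The gain `A * K r` corrects such an error, inside this
  -- subspace, to one that `C` does not see, and then applies `A`.
  let W : ℕ → Submodule ℝ (Fin n → ℝ) := fun r =>
    ⨅ a : Fin r, LinearMap.ker (subC S s * S.A ^ (a : ℕ)).mulVecLin
  have hW : ∀ r z, z ∈ W r ↔ ∀ a < r, subC S s *ᵥ (S.A ^ a *ᵥ z) = 0 := by
    intro r z
    simp [W, Submodule.mem_iInf, Fin.forall_iff]
  choose K hK using fun r => exists_correction (subC S s) ((W r).map (S.A ^ r).mulVecLin)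
  refine ⟨fun r => S.A * K r, fun x => ?_⟩
  suffices h : transition S s (fun r => S.A * K r) r *ᵥ x ∈ (W r).map (S.A ^ r).mulVecLin by
    obtain ⟨z, hz, hz'⟩ := h
    exact ⟨z, hz'.symm, (hW r z).1 hz⟩
  induction r with
  | zero => exact ⟨x, (hW 0 x).2 (by simp), by simp [transition]⟩
  | succ r ih =>
    obtain ⟨⟨z, hz, hz'⟩, h2⟩ := hK r _ ih
    refine ⟨z, (hW _ _).2 fun a ha => ?_, ?_⟩
    · rcases Nat.lt_succ_iff_lt_or_eq.1 ha with ha | rfl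
      · exact (hW _ _).1 hz a ha
      · rw [← h2, ← hz', Matrix.mulVecLin_apply]
    · simp only [Matrix.mulVecLin_apply] at hz' ⊢
      rw [pow_succ', ← Matrix.mulVec_mulVec, hz', transition, ← Matrix.mulVec_mulVec, closedLoop,
        Matrix.sub_mulVec, Matrix.mulVec_sub]
      simp [Matrix.mulVec_mulVec, Matrix.mul_assoc]

theorem obsMatrix_mulVec (i : Finset (Fin p)) (μ : ℕ) (x : Fin n → ℝ) (a : Fin μ × i) :
    (obsMatrix S i μ *ᵥ x) a = (subC S i *ᵥ (S.A ^ (a.1 : ℕ) *ᵥ x)) a.2 := by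
  rw [Matrix.mulVec_mulVec]
  rfl

theorem eq_zero_of_rank_eq {ι : Type*} [Fintype ι] {M : Matrix ι (Fin n) ℝ} (h : M.rank = n)
    {x : Fin n → ℝ} (hx : M *ᵥ x = 0) : x = 0 := by
  have h1 := LinearMap.finrank_range_add_finrank_ker M.mulVecLin
  rw [Matrix.rank] at h
  have h2 : LinearMap.ker M.mulVecLin = ⊥ := by
    apply Submodule.finrank_eq_zero.1
    simp at h1
    omega
  have : x ∈ LinearMap.ker M.mulVecLin := hx
  rwa [h2, Submodule.mem_bot] at this

/-- Observability provides gains that cancel every initial error within `μ` steps. The error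
covariance with these gains after `μ` steps does not depend on the covariance before them, so it
bounds the optimal covariance at all times. -/
theorem kalmanCov_zero_bounded (hσv : 0 < S.σv) (hobs : IsObservable S s) :
    ∃ B : Matrix (Fin n) (Fin n) ℝ, ∀ t, kalmanCov S s 0 t ≤ B := by
  obtain ⟨μ, -, hμ⟩ := hobs
  obtain ⟨L, hL⟩ := exists_gains_transition (S := S) s μ
  have h0 : transition S s L μ = 0 := by
    ext1 i j
    obtain ⟨z, hz, hz'⟩ := hL (Pi.single j 1)
    have : z = 0 := eq_zero_of_rank_eq hμ (by
      ext a
      rw [obsMatrix_mulVec, hz' _ a.1.2]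
      rfl)
    rw [this, Matrix.mulVec_zero, Matrix.mulVec_single_one] at hz
    exact congrFun hz i
  refine ⟨gainCov S s L 0 μ, fun t => ?_⟩
  refine (kalmanCov_zero_monotone s hσv (Nat.le_add_left t μ)).trans ?_
  rw [kalmanCov_add]
  refine (kalmanCov_le_gainCov s hσv L (posSemidef_kalmanCov s hσv .zero t) μ).trans_eq ?_
  rw [gainCov_eq, h0]
  simp

end Riccati

/-! ### Convergence of the error covariance -/

section Steady

open scoped MatrixOrder

/-- Polarization: a symmetric matrix is determined by its quadratic form. -/
theorem apply_eq_quadratic {ι : Type*} [Fintype ι] [DecidableEq ι] {M : Matrix ι ι ℝ}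
    (hM : Mᵀ = M) (i j : ι) :
    M i j = ((Pi.single i 1 + Pi.single j 1) ⬝ᵥ (M *ᵥ (Pi.single i 1 + Pi.single j 1))
      - Pi.single i 1 ⬝ᵥ (M *ᵥ Pi.single i 1) - Pi.single j 1 ⬝ᵥ (M *ᵥ Pi.single j 1)) / 2 := by
  have : M j i = M i j := congrFun (congrFun hM i) j
  simp [Matrix.mulVec_add, this]
  ring

theorem quadratic_le_of_le {ι : Type*} [Fintype ι] {M N : Matrix ι ι ℝ} (h : M ≤ N) (x : ι → ℝ) :
    x ⬝ᵥ (M *ᵥ x) ≤ x ⬝ᵥ (N *ᵥ x) := by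
  have := (Matrix.le_iff.1 h).dotProduct_mulVec_nonneg x
  simpa [Matrix.sub_mulVec] using this

theorem tendsto_quadratic {ι : Type*} [Fintype ι] {M : ℕ → Matrix ι ι ℝ} {Q : Matrix ι ι ℝ}
    (h : Tendsto M atTop (𝓝 Q)) (x : ι → ℝ) :
    Tendsto (fun t => x ⬝ᵥ (M t *ᵥ x)) atTop (𝓝 (x ⬝ᵥ (Q *ᵥ x))) := by
  have : Continuous fun M : Matrix ι ι ℝ => x ⬝ᵥ (M *ᵥ x) := by fun_prop
  exact (this.tendsto Q).comp h

/-- Monotone convergence in the Loewner order, entry by entry through the quadratic forms. -/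
theorem exists_tendsto_of_monotone {ι : Type*} [Fintype ι] {M : ℕ → Matrix ι ι ℝ}
    (hM : ∀ t, (M t)ᵀ = M t) (hmono : Monotone M) {B : Matrix ι ι ℝ} (hB : ∀ t, M t ≤ B) :
    ∃ Q, Tendsto M atTop (𝓝 Q) := by
  classical
  have h : ∀ x : ι → ℝ, ∃ l, Tendsto (fun t => x ⬝ᵥ (M t *ᵥ x)) atTop (𝓝 l) := fun x =>
    ⟨_, tendsto_atTop_ciSup (fun a b hab => quadratic_le_of_le (hmono hab) x)
      ⟨x ⬝ᵥ (B *ᵥ x), by rintro _ ⟨t, rfl⟩; exact quadratic_le_of_le (hB t) x⟩⟩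
  choose l hl using h
  refine ⟨Matrix.of fun i j => (l (Pi.single i 1 + Pi.single j 1) - l (Pi.single i 1)
    - l (Pi.single j 1)) / 2, ?_⟩
  refine tendsto_pi_nhds.2 fun i => tendsto_pi_nhds.2 fun j => ?_
  simp only [apply_eq_quadratic (hM _) i j]
  exact (((hl _).sub (hl _)).sub (hl _)).div_const 2

theorem tendsto_of_le_of_le {ι : Type*} [Fintype ι] {L M U : ℕ → Matrix ι ι ℝ} {Q : Matrix ι ι ℝ}
    (hM : ∀ t, (M t)ᵀ = M t) (hQ : Qᵀ = Q) (hL : Tendsto L atTop (𝓝 Q))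
    (hU : Tendsto U atTop (𝓝 Q)) (hLM : ∀ t, L t ≤ M t) (hMU : ∀ t, M t ≤ U t) :
    Tendsto M atTop (𝓝 Q) := by
  classical
  have h : ∀ x : ι → ℝ, Tendsto (fun t => x ⬝ᵥ (M t *ᵥ x)) atTop (𝓝 (x ⬝ᵥ (Q *ᵥ x))) := fun x =>
    tendsto_of_tendsto_of_tendsto_of_le_of_le (tendsto_quadratic hL x) (tendsto_quadratic hU x)
      (fun t => quadratic_le_of_le (hLM t) x) (fun t => quadratic_le_of_le (hMU t) x)
  refine tendsto_pi_nhds.2 fun i => tendsto_pi_nhds.2 fun j => ?_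
  simp only [apply_eq_quadratic (hM _) i j, apply_eq_quadratic hQ i j]
  exact (((h _).sub (h _)).sub (h _)).div_const 2

/-- A discrete Lyapunov equation with a positive definite right hand side forces stability: the
partial sums of `∑ tr (F ^ j (F ^ j)ᵀ)` are at most `tr P / c`. -/
theorem tendsto_pow_of_lyapunov {ι : Type*} [Fintype ι] [DecidableEq ι] {F P W : Matrix ι ι ℝ}
    (hP : P.PosSemidef) {c : ℝ} (hc : 0 < c) (hW : c • (1 : Matrix ι ι ℝ) ≤ W)
    (h : P = F * P * Fᵀ + W) : Tendsto (fun t => F ^ t) atTop (𝓝 0) := by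
  have h1 : ∀ t, P = F ^ t * P * (F ^ t)ᵀ
      + ∑ j ∈ Finset.range t, F ^ j * W * (F ^ j)ᵀ := by
    intro t
    induction t with
    | zero => simp
    | succ t ih =>
      rw [Finset.sum_range_succ]
      nth_rw 1 [ih]
      nth_rw 1 [h]
      rw [pow_succ]
      simp only [Matrix.transpose_mul, Matrix.mul_add, Matrix.add_mul, Matrix.mul_assoc]
      abel
  have h2 : ∀ j, c * (F ^ j * (F ^ j)ᵀ).trace ≤ (F ^ j * W * (F ^ j)ᵀ).trace := by
    intro j
    have := (posSemidef_conj (Matrix.le_iff.1 hW) (F ^ j)).trace_nonneg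
    simp only [Matrix.mul_sub, Matrix.sub_mul, Matrix.trace_sub, Matrix.mul_smul, Matrix.mul_one,
      Matrix.smul_mul, Matrix.trace_smul, smul_eq_mul] at this
    linarith
  have h3 : ∀ j, 0 ≤ (F ^ j * (F ^ j)ᵀ).trace := fun j =>
    (posSemidef_mul_transpose (F ^ j)).trace_nonneg
  have h4 : Summable fun j => (F ^ j * (F ^ j)ᵀ).trace := by
    refine summable_of_sum_range_le (c := P.trace / c) h3 fun t => ?_
    rw [le_div_iff₀ hc, mul_comm, Finset.mul_sum]
    refine (Finset.sum_le_sum fun j _ => h2 j).trans ?_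
    have := congrArg Matrix.trace (h1 t)
    rw [Matrix.trace_add, Matrix.trace_sum] at this
    have := (posSemidef_conj hP (F ^ t)).trace_nonneg
    linarith
  have h5 := h4.tendsto_atTop_zero
  refine tendsto_pi_nhds.2 fun i => tendsto_pi_nhds.2 fun j => ?_
  have h6 : ∀ t, (F ^ t) i j ^ 2 ≤ (F ^ t * (F ^ t)ᵀ).trace := by
    intro t
    simp only [Matrix.trace, Matrix.diag_apply, Matrix.mul_apply, Matrix.transpose_apply]
    calc (F ^ t) i j ^ 2 = (F ^ t) i j * (F ^ t) i j := sq _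
      _ ≤ ∑ j, (F ^ t) i j * (F ^ t) i j :=
        Finset.single_le_sum (f := fun j => (F ^ t) i j * (F ^ t) i j)
          (fun j _ => mul_self_nonneg _) (Finset.mem_univ j)
      _ ≤ _ := Finset.single_le_sum (f := fun i => ∑ j, (F ^ t) i j * (F ^ t) i j)
          (fun i _ => Finset.sum_nonneg fun j _ => mul_self_nonneg _) (Finset.mem_univ i)
  have h7 : Tendsto (fun t => (F ^ t) i j ^ 2) atTop (𝓝 0) :=
    squeeze_zero (fun t => sq_nonneg _) h6 h5
  have h8 := h7.sqrt
  simp only [Real.sqrt_sq_eq_abs, Real.sqrt_zero] at h8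
  exact (tendsto_zero_iff_abs_tendsto_zero _).2 h8

variable {n p : ℕ} {S : LinearSystem n p} (s : Finset (Fin p))

theorem tendsto_riccatiStep (hσv : 0 < S.σv) {M : ℕ → Matrix (Fin n) (Fin n) ℝ}
    {Q : Matrix (Fin n) (Fin n) ℝ} (hQ : Q.PosSemidef) (h : Tendsto M atTop (𝓝 Q)) :
    Tendsto (fun t => riccatiStep S s (M t)) atTop (𝓝 (riccatiStep S s Q)) := by
  have h1 : Tendsto (fun t => innovCov S s (M t)) atTop (𝓝 (innovCov S s Q)) := by
    have : Continuous (innovCov S s) := by unfold innovCov; fun_prop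
    exact (this.tendsto Q).comp h
  have h2 : Tendsto (fun t => innovInv S s (M t)) atTop (𝓝 (innovInv S s Q)) := by
    change Tendsto (fun t => (innovCov S s (M t))⁻¹) atTop (𝓝 (innovCov S s Q)⁻¹)
    simp only [Matrix.inv_def, Ring.inverse_eq_inv']
    have hdet : (innovCov S s Q).det ≠ 0 :=
      (posDef_innovCov s hσv hQ).det_pos.ne'
    refine Tendsto.smul (Tendsto.inv₀ ?_ hdet) ?_
    · exact ((continuous_id.matrix_det).tendsto _).comp h1
    · exact ((continuous_id.matrix_adjugate).tendsto _).comp h1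
  have hc : Continuous fun q : Matrix (Fin n) (Fin n) ℝ × Matrix s s ℝ =>
      S.A * q.1 * S.Aᵀ + S.σw ^ 2 • (1 : Matrix (Fin n) (Fin n) ℝ)
        - S.A * q.1 * (subC S s)ᵀ * q.2 * subC S s * q.1 * S.Aᵀ := by fun_prop
  have h3 := (hc.tendsto (Q, innovInv S s Q)).comp (h.prodMk_nhds h2)
  unfold riccatiStep
  exact h3

theorem posSemidef_of_tendsto {ι : Type*} [Fintype ι] {M : ℕ → Matrix ι ι ℝ} {Q : Matrix ι ι ℝ}
    (hM : ∀ t, (M t).PosSemidef) (h : Tendsto M atTop (𝓝 Q)) : Q.PosSemidef := by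
  refine Matrix.PosSemidef.of_dotProduct_mulVec_nonneg ?_ fun x => ?_
  · have h1 : Tendsto (fun t => (M t)ᵀ) atTop (𝓝 Qᵀ) :=
      ((continuous_id.matrix_transpose).tendsto Q).comp h
    simp only [transpose_eq_of_posSemidef (hM _)] at h1
    simpa [Matrix.IsHermitian] using tendsto_nhds_unique h1 h
  · simpa using ge_of_tendsto' (tendsto_quadratic h x) fun t => by
      simpa using (hM t).dotProduct_mulVec_nonneg x

/-- What is needed about the Kalman filter in steady state: the Riccati equation in the form of a
Lyapunov equation for the closed loop, and the stability of the closed loop. -/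
structure IsSteady (S : LinearSystem n p) (s : Finset (Fin p))
    (P : Matrix (Fin n) (Fin n) ℝ) : Prop where
  posSemidef : P.PosSemidef
  lyapunov : P = gainStep S s (kalmanGain S s P) P
  stable : Tendsto (fun t => closedLoop S s (kalmanGain S s P) ^ t) atTop (𝓝 0)

/-- From the initial value `0` the covariances increase to a fixed point `P` of the Riccati
recursion. From any other initial value they lie between those from `0` and those of the
suboptimal observer that always uses the gain of `P`, which also converge to `P`. -/
theorem exists_isSteady (hσw : 0 < S.σw) (hσv : 0 < S.σv) (hobs : IsObservable S s) :
    ∃ P, IsSteady S s P ∧ ∀ P₀ : Matrix (Fin n) (Fin n) ℝ, P₀.PosSemidef →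
      Tendsto (kalmanCov S s P₀) atTop (𝓝 P) := by
  obtain ⟨B, hB⟩ := kalmanCov_zero_bounded s hσv hobs
  have hpsd := fun P₀ (h : Matrix.PosSemidef P₀) => posSemidef_kalmanCov s hσv h
  obtain ⟨P, hP⟩ := exists_tendsto_of_monotone
    (fun t => transpose_eq_of_posSemidef (hpsd 0 .zero t)) (kalmanCov_zero_monotone s hσv) hB
  have hPpsd : P.PosSemidef := posSemidef_of_tendsto (hpsd 0 .zero) hP
  have hfix : riccatiStep S s P = P := by
    refine tendsto_nhds_unique (tendsto_riccatiStep s hσv hPpsd hP) ?_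
    simpa only [kalmanCov_succ] using (tendsto_add_atTop_iff_nat 1).2 hP
  have hlyap : P = gainStep S s (kalmanGain S s P) P := by
    rw [gainStep_kalmanGain s hσv hPpsd, hfix]
  have hstab : Tendsto (fun t => closedLoop S s (kalmanGain S s P) ^ t) atTop (𝓝 0) := by
    refine tendsto_pow_of_lyapunov (c := S.σw ^ 2) hPpsd (by positivity) ?_ hlyap
    rw [Matrix.le_iff, gainNoiseCov, add_sub_cancel_left]
    exact (posSemidef_mul_transpose _).smul (by positivity)
  refine ⟨P, ⟨hPpsd, hlyap, hstab⟩, fun P₀ hP₀ => ?_⟩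
  set F := closedLoop S s (kalmanGain S s P)
  have hU : ∀ t, (gainStep S s (kalmanGain S s P))^[t] P₀ = F ^ t * (P₀ - P) * (F ^ t)ᵀ + P := by
    intro t
    induction t with
    | zero => simp
    | succ t ih =>
      rw [Function.iterate_succ_apply', ih]
      calc gainStep S s (kalmanGain S s P) (F ^ t * (P₀ - P) * (F ^ t)ᵀ + P)
          = F * (F ^ t * (P₀ - P) * (F ^ t)ᵀ) * Fᵀ + gainStep S s (kalmanGain S s P) P := by
            simp only [gainStep, Matrix.mul_add, Matrix.add_mul, add_assoc, F]
        _ = _ := by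
            rw [← hlyap, pow_succ']
            simp only [Matrix.transpose_mul, Matrix.mul_assoc]
  refine tendsto_of_le_of_le (L := kalmanCov S s 0)
    (U := fun t => (gainStep S s (kalmanGain S s P))^[t] P₀)
    (fun t => transpose_eq_of_posSemidef (hpsd P₀ hP₀ t)) (transpose_eq_of_posSemidef hPpsd)
    hP ?_ (fun t => ?_) (fun t => ?_)
  · simp only [hU]
    have hc : Continuous fun M : Matrix (Fin n) (Fin n) ℝ => M * (P₀ - P) * Mᵀ + P := by fun_prop
    have h := (hc.tendsto 0).comp hstab
    simp only [Matrix.zero_mul, zero_add] at h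
    exact h
  · exact kalmanCov_mono s hσv .zero hP₀ (by rw [Matrix.le_iff, sub_zero]; exact hP₀) t
  · induction t with
    | zero => exact le_rfl
    | succ t ih =>
      rw [kalmanCov_succ]
      simp only [Function.iterate_succ_apply']
      exact (riccatiStep_le_gainStep s hσv (hpsd P₀ hP₀ t) _).trans (gainStep_mono s _ ih)

theorem tendsto_kalmanCov (hσw : 0 < S.σw) (hσv : 0 < S.σv) (hobs : IsObservable S s)
    {P₀ : Matrix (Fin n) (Fin n) ℝ} (hP₀ : P₀.PosSemidef) :
    Tendsto (kalmanCov S s P₀) atTop (𝓝 (steadyCov S s)) := by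
  obtain ⟨P, -, hP⟩ := exists_isSteady s hσw hσv hobs
  rw [steadyCov, (hP 0 .zero).limUnder_eq]
  exact hP P₀ hP₀

theorem isSteady_steadyCov (hσw : 0 < S.σw) (hσv : 0 < S.σv) (hobs : IsObservable S s) :
    IsSteady S s (steadyCov S s) := by
  obtain ⟨P, hP, hP'⟩ := exists_isSteady s hσw hσv hobs
  rwa [steadyCov, (hP' 0 .zero).limUnder_eq]

theorem A_mul_filterGain : S.A * filterGain S s = predictorGain S s := by
  simp only [filterGain, predictorGain, Matrix.mul_assoc]

/-- The steady state filtering covariance as the covariance of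
`(I - K C_s) e - K v_s`, where `e` is the prediction error and `K` the filtering gain. -/
theorem steadyFilterCov_eq (hσv : 0 < S.σv) (hP : (steadyCov S s).PosSemidef) :
    steadyFilterCov S s = (1 - filterGain S s * subC S s) * steadyCov S s
        * (1 - filterGain S s * subC S s)ᵀ
      + S.σv ^ 2 • (filterGain S s * (filterGain S s)ᵀ) := by
  set P := steadyCov S s with hPdef
  set K := filterGain S s with hK
  have h1 : K * innovCov S s P = P * (subC S s)ᵀ := by
    rw [hK, filterGain, Matrix.mul_assoc, innovInv_mul_innovCov s hσv hP, Matrix.mul_one]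
  have h2 : K * (subC S s * P * (subC S s)ᵀ) * Kᵀ + S.σv ^ 2 • (K * Kᵀ)
      = P * (subC S s)ᵀ * Kᵀ := by
    rw [← h1, innovCov]
    simp [Matrix.mul_add, Matrix.add_mul]
  have h3 : steadyFilterCov S s = P - K * subC S s * P := rfl
  rw [h3]
  simp only [Matrix.transpose_sub, Matrix.transpose_mul, Matrix.transpose_one, Matrix.sub_mul,
    Matrix.mul_sub, Matrix.one_mul, Matrix.mul_one]
  simp only [Matrix.mul_assoc] at h2 ⊢
  have h4 : ∀ a b c d e : Matrix (Fin n) (Fin n) ℝ, d + e = c →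
      a - b = a - b - (c - d) + e := by
    intro a b c d e h
    rw [← h]
    abel
  refine (h4 P (K * (subC S s * P)) _ _ _ h2).trans ?_
  abel

end Steady

/-! ### Gaussian vectors with independent coordinates -/

section Gaussian

variable {ι : Type*} [Fintype ι]

/-- The law of a vector of independent centered Gaussian variables with standard
deviations `σ`. -/
noncomputable def gaussianNoise (σ : ι → ℝ) : Measure (ι → ℝ) :=
  Measure.pi fun i => gaussianReal 0 (σ i ^ 2).toNNReal

variable (σ : ι → ℝ)

instance : IsProbabilityMeasure (gaussianNoise σ) := by unfold gaussianNoise; infer_instance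

theorem gaussianNoise_map_eval (i : ι) :
    (gaussianNoise σ).map (fun z => z i) = gaussianReal 0 (σ i ^ 2).toNNReal :=
  (measurePreserving_eval (fun i => gaussianReal 0 (σ i ^ 2).toNNReal) i).map_eq

instance : IsGaussian (gaussianNoise σ) := by
  have h1 : iIndepFun (fun (i : ι) (z : ι → ℝ) => z i) (gaussianNoise σ) :=
    iIndepFun_pi (X := fun _ => id) (μ := fun i => gaussianReal 0 (σ i ^ 2).toNNReal)
      fun i => aemeasurable_id
  have h2 : ∀ i, HasGaussianLaw (fun z : ι → ℝ => z i) (gaussianNoise σ) := fun i =>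
    ⟨by rw [gaussianNoise_map_eval]; infer_instance⟩
  have h3 := (h1.hasGaussianLaw h2).isGaussian_map
  simpa using h3

theorem memLp_two_eval (i : ι) : MemLp (fun z : ι → ℝ => z i) 2 (gaussianNoise σ) :=
  (memLp_id_gaussianReal' (μ := 0) (v := (σ i ^ 2).toNNReal) 2 (by simp)).comp_measurePreserving
    (measurePreserving_eval (fun i => gaussianReal 0 (σ i ^ 2).toNNReal) i)

theorem integral_eval (i : ι) : ∫ z, z i ∂gaussianNoise σ = 0 := by
  have h := integral_map (μ := gaussianNoise σ) (φ := fun z : ι → ℝ => z i)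
    (measurable_pi_apply i).aemeasurable (f := fun x : ℝ => x)
    measurable_id.aestronglyMeasurable
  rw [← h, gaussianNoise_map_eval, integral_id_gaussianReal]

theorem integral_eval_mul_eval [DecidableEq ι] (i j : ι) :
    ∫ z, z i * z j ∂gaussianNoise σ = if i = j then σ i ^ 2 else 0 := by
  split_ifs with hij
  · subst hij
    have h := integral_map (μ := gaussianNoise σ) (φ := fun z : ι → ℝ => z i)
      (measurable_pi_apply i).aemeasurable (f := fun x : ℝ => x * x)
      (by fun_prop : Measurable fun x : ℝ => x * x).aestronglyMeasurable
    rw [← h, gaussianNoise_map_eval]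
    have hv := variance_fun_id_gaussianReal (μ := 0) (v := (σ i ^ 2).toNNReal)
    rw [variance_of_integral_eq_zero (by fun_prop) integral_id_gaussianReal] at hv
    simp only [← sq, hv]
    exact Real.coe_toNNReal _ (sq_nonneg _)
  · have h1 : iIndepFun (fun (i : ι) (z : ι → ℝ) => z i) (gaussianNoise σ) :=
      iIndepFun_pi (X := fun _ => id) (μ := fun i => gaussianReal 0 (σ i ^ 2).toNNReal)
        fun i => aemeasurable_id
    have h2 := (h1.indepFun hij).integral_mul_eq_mul_integral
      (measurable_pi_apply i).aestronglyMeasurable (measurable_pi_apply j).aestronglyMeasurable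
    simpa [integral_eval] using h2

theorem integrable_eval_mul_eval (i j : ι) :
    Integrable (fun z : ι → ℝ => z i * z j) (gaussianNoise σ) :=
  (memLp_two_eval σ i).integrable_mul (memLp_two_eval σ j)

theorem quadratic_eq_sum (Y : Matrix ι ι ℝ) (z : ι → ℝ) :
    z ⬝ᵥ (Y *ᵥ z) = ∑ i, ∑ j, Y i j * (z i * z j) := by
  simp only [dotProduct, Matrix.mulVec, Finset.mul_sum]
  exact Finset.sum_congr rfl fun i _ => Finset.sum_congr rfl fun j _ => by ring

/-- The mean of `zᵀ Y z` for Gaussian noise `z` with standard deviations `σ`. -/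
noncomputable def quadraticMean (Y : Matrix ι ι ℝ) : ℝ := ∑ i, σ i ^ 2 * Y i i

theorem integrable_quadratic (Y : Matrix ι ι ℝ) :
    Integrable (fun z => z ⬝ᵥ (Y *ᵥ z)) (gaussianNoise σ) := by
  simp only [quadratic_eq_sum]
  exact integrable_finsetSum _ fun i _ => integrable_finsetSum _ fun j _ =>
    (integrable_eval_mul_eval σ i j).const_mul _

theorem integral_quadratic (Y : Matrix ι ι ℝ) :
    ∫ z, z ⬝ᵥ (Y *ᵥ z) ∂gaussianNoise σ = quadraticMean σ Y := by
  classical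
  simp only [quadratic_eq_sum]
  have hint : ∀ i j, Integrable (fun z : ι → ℝ => Y i j * (z i * z j)) (gaussianNoise σ) :=
    fun i j => (integrable_eval_mul_eval σ i j).const_mul _
  refine (integral_finsetSum _ fun i _ => integrable_finsetSum _ fun j _ => hint i j).trans
    (Finset.sum_congr rfl fun i _ => ?_)
  refine (integral_finsetSum _ fun j _ => hint i j).trans ?_
  simp [integral_const_mul, integral_eval_mul_eval, mul_comm]

/-- The moment generating function of `bᵀ z`, as a compensated exponential of mean at most one. -/
theorem lintegral_exp_linear_le_one (b : ι → ℝ) (l : ℝ) :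
    ∫⁻ z, ENNReal.ofReal (Real.exp (l * (b ⬝ᵥ z) - l ^ 2 * ((∑ i, σ i ^ 2) / 2 * (b ⬝ᵥ b))))
      ∂gaussianNoise σ ≤ 1 := by
  have hint : ∀ i, Integrable (fun x : ℝ => Real.exp (l * b i * x))
      (gaussianReal 0 (σ i ^ 2).toNNReal) := fun i => integrable_exp_mul_gaussianReal _
  have h1 : ∀ z : ι → ℝ, Real.exp (l * (b ⬝ᵥ z)) = ∏ i, Real.exp (l * b i * z i) := by
    intro z
    rw [← Real.exp_sum, dotProduct, Finset.mul_sum]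
    simp only [mul_assoc]
  have h2 : Integrable (fun z : ι → ℝ => Real.exp (l * (b ⬝ᵥ z))) (gaussianNoise σ) := by
    simp only [h1]
    exact Integrable.fintype_prod hint
  have h3 : ∫ z, Real.exp (l * (b ⬝ᵥ z)) ∂gaussianNoise σ
      = Real.exp (∑ i, σ i ^ 2 * (l * b i) ^ 2 / 2) := by
    simp only [h1]
    rw [gaussianNoise, integral_fintype_prod_eq_prod (f := fun i x => Real.exp (l * b i * x)),
      Real.exp_sum]
    refine Finset.prod_congr rfl fun i _ => ?_
    have := congrFun (mgf_fun_id_gaussianReal (μ := 0) (v := (σ i ^ 2).toNNReal)) (l * b i)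
    simp only [mgf, zero_mul, zero_add, Real.coe_toNNReal _ (sq_nonneg (σ i))] at this
    exact this
  have h4 : ∑ i, σ i ^ 2 * (l * b i) ^ 2 / 2 ≤ l ^ 2 * ((∑ i, σ i ^ 2) / 2 * (b ⬝ᵥ b)) := by
    have : ∀ i, σ i ^ 2 * (b i * b i) ≤ (∑ i, σ i ^ 2) * (b i * b i) := fun i =>
      mul_le_mul_of_nonneg_right
        (Finset.single_le_sum (f := fun i => σ i ^ 2) (fun i _ => sq_nonneg _)
          (Finset.mem_univ i)) (mul_self_nonneg _)
    have := Finset.sum_le_sum fun i (_ : i ∈ Finset.univ) => this i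
    rw [← Finset.mul_sum] at this
    calc ∑ i, σ i ^ 2 * (l * b i) ^ 2 / 2 = l ^ 2 / 2 * ∑ i, σ i ^ 2 * (b i * b i) := by
          rw [Finset.mul_sum]
          exact Finset.sum_congr rfl fun i _ => by ring
      _ ≤ l ^ 2 / 2 * ((∑ i, σ i ^ 2) * ∑ i, b i * b i) := by gcongr
      _ = _ := by rw [dotProduct]; ring
  simp only [Real.exp_sub]
  rw [← ofReal_integral_eq_lintegral_ofReal (h2.div_const _)
    (ae_of_all _ fun z => by positivity), integral_div, h3, ← Real.exp_sub]
  rw [ENNReal.ofReal_le_one, Real.exp_le_one_iff]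
  linarith

theorem exp_le_one_add_add_sq_mul (x : ℝ) :
    Real.exp x ≤ 1 + x + x ^ 2 * Real.exp |x| := by
  have h0 := Real.one_le_exp (abs_nonneg x)
  rcases le_or_gt |x| 1 with h | h
  · have := (abs_le.1 (Real.abs_exp_sub_one_sub_id_le h)).2
    nlinarith [sq_nonneg x]
  · rcases lt_abs.1 h with h | h
    · rw [abs_of_pos (by linarith)]
      have := le_mul_of_one_le_left (Real.exp_pos x).le (by nlinarith : 1 ≤ x ^ 2)
      linarith
    · have : Real.exp x ≤ 1 := Real.exp_le_one_iff.2 (by linarith)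
      nlinarith

/-- A centered variable with an exponential moment is sub-Gaussian for small parameters. -/
theorem exists_lintegral_exp_le_one {Z : Type*} [MeasurableSpace Z] {γ : Measure Z}
    [IsProbabilityMeasure γ] {q : Z → ℝ} (hq : Integrable q γ) (h0 : ∫ z, q z ∂γ = 0) {r : ℝ}
    (hr : 0 < r) (hexp : Integrable (fun z => Real.exp (r * |q z|)) γ) :
    ∃ C, 0 ≤ C ∧ ∀ l : ℝ, |l| ≤ r / 2 →
      ∫⁻ z, ENNReal.ofReal (Real.exp (l * q z - l ^ 2 * C)) ∂γ ≤ 1 := by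
  refine ⟨8 / r ^ 2 * ∫ z, Real.exp (r * |q z|) ∂γ,
    mul_nonneg (by positivity) (integral_nonneg fun z => by positivity), fun l hl => ?_⟩
  set C := 8 / r ^ 2 * ∫ z, Real.exp (r * |q z|) ∂γ with hC
  -- `exp x ≤ 1 + x + x² exp |x|` at `x = l q`; half of the exponent `r |q|` absorbs `q²`
  have h1 : ∀ z, Real.exp (l * q z)
      ≤ 1 + l * q z + l ^ 2 * (8 / r ^ 2 * Real.exp (r * |q z|)) := by
    intro z
    refine (exp_le_one_add_add_sq_mul _).trans ?_
    have hu : 0 ≤ r / 2 * |q z| := by positivity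
    have e1 : Real.exp |l * q z| ≤ Real.exp (r / 2 * |q z|) := by
      rw [abs_mul]
      gcongr
    have e2 : q z ^ 2 ≤ 8 / r ^ 2 * Real.exp (r / 2 * |q z|) := by
      have := Real.quadratic_le_exp_of_nonneg hu
      rw [div_mul_eq_mul_div, le_div_iff₀ (by positivity), ← sq_abs (q z)]
      nlinarith
    have e3 : Real.exp (r * |q z|) = Real.exp (r / 2 * |q z|) * Real.exp (r / 2 * |q z|) := by
      rw [← Real.exp_add]
      ring_nf
    rw [e3, mul_pow, mul_assoc]
    have : q z ^ 2 * Real.exp |l * q z|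
        ≤ 8 / r ^ 2 * Real.exp (r / 2 * |q z|) * Real.exp (r / 2 * |q z|) := by gcongr
    have := mul_le_mul_of_nonneg_left this (sq_nonneg l)
    linarith
  have hint : Integrable (fun z => 1 + l * q z + l ^ 2 * (8 / r ^ 2 * Real.exp (r * |q z|))) γ :=
    ((integrable_const _).add (hq.const_mul l)).add ((hexp.const_mul _).const_mul _)
  have h2 : Integrable (fun z => Real.exp (l * q z)) γ := by
    refine hint.mono' ?_ (ae_of_all _ fun z => ?_)
    · exact (Real.continuous_exp.comp_aestronglyMeasurable (hq.aestronglyMeasurable.const_mul l))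
    · rw [Real.norm_eq_abs, Real.abs_exp]
      exact h1 z
  have h3 : ∫ z, Real.exp (l * q z) ∂γ ≤ Real.exp (l ^ 2 * C) := by
    refine (integral_mono h2 hint h1).trans ?_
    rw [integral_add (f := fun z => 1 + l * q z) ((integrable_const _).add (hq.const_mul l))
      ((hexp.const_mul _).const_mul _),
      integral_add (f := fun _ => (1 : ℝ)) (integrable_const _) (hq.const_mul l),
      integral_const_mul, integral_const_mul, integral_const_mul, h0]
    have := Real.add_one_le_exp (l ^ 2 * C)
    simp only [integral_const, probReal_univ, smul_eq_mul, mul_one, mul_zero, add_zero]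
    linarith
  simp only [Real.exp_sub]
  rw [← ofReal_integral_eq_lintegral_ofReal (h2.div_const _)
    (ae_of_all _ fun z => by positivity), integral_div]
  rw [ENNReal.ofReal_le_one, div_le_one (Real.exp_pos _)]
  exact h3

theorem abs_quadratic_le (Y : Matrix ι ι ℝ) (z : ι → ℝ) :
    |z ⬝ᵥ (Y *ᵥ z)| ≤ (∑ i, ∑ j, |Y i j|) * ‖z‖ ^ 2 := by
  rw [quadratic_eq_sum, Finset.sum_mul]
  refine (Finset.abs_sum_le_sum_abs _ _).trans (Finset.sum_le_sum fun i _ => ?_)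
  rw [Finset.sum_mul]
  refine (Finset.abs_sum_le_sum_abs _ _).trans (Finset.sum_le_sum fun j _ => ?_)
  rw [abs_mul, abs_mul, sq]
  have hi : |z i| ≤ ‖z‖ := norm_le_pi_norm z i
  have hj : |z j| ≤ ‖z‖ := norm_le_pi_norm z j
  gcongr

/-- Quadratic forms in Gaussian noise have exponential moments by Fernique's theorem. -/
theorem exists_lintegral_exp_quadratic_le_one (Y : Matrix ι ι ℝ) :
    ∃ C r : ℝ, 0 ≤ C ∧ 0 < r ∧ ∀ l : ℝ, |l| ≤ r →
      ∫⁻ z, ENNReal.ofReal (Real.exp (l * (z ⬝ᵥ (Y *ᵥ z) - quadraticMean σ Y) - l ^ 2 * C))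
        ∂gaussianNoise σ ≤ 1 := by
  obtain ⟨c, hc, hF⟩ := IsGaussian.exists_integrable_exp_sq (gaussianNoise σ)
  set K := ∑ i, ∑ j, |Y i j| with hK
  have hK0 : 0 ≤ K := Finset.sum_nonneg fun i _ => Finset.sum_nonneg fun j _ => abs_nonneg _
  set r := c / (K + 1) with hr
  have hr0 : 0 < r := by positivity
  have hrK : r * K ≤ c := by
    rw [hr, div_mul_eq_mul_div, div_le_iff₀ (by positivity)]
    nlinarith
  have hq : Integrable (fun z => z ⬝ᵥ (Y *ᵥ z) - quadraticMean σ Y) (gaussianNoise σ) :=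
    (integrable_quadratic σ Y).sub (integrable_const _)
  have h0 : ∫ z, (z ⬝ᵥ (Y *ᵥ z) - quadraticMean σ Y) ∂gaussianNoise σ = 0 := by
    rw [integral_sub (integrable_quadratic σ Y) (integrable_const _), integral_quadratic]
    simp
  obtain ⟨C, hC, h⟩ := exists_lintegral_exp_le_one hq h0 hr0 (by
    refine (hF.const_mul (Real.exp (r * |quadraticMean σ Y|))).mono' ?_ (ae_of_all _ fun z => ?_)
    · exact Real.continuous_exp.comp_aestronglyMeasurable
        ((hq.aestronglyMeasurable.norm).const_mul r)
    · rw [Real.norm_eq_abs, Real.abs_exp, ← Real.exp_add]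
      apply Real.exp_le_exp.2
      have h1 := abs_sub (z ⬝ᵥ (Y *ᵥ z)) (quadraticMean σ Y)
      have h2 := abs_quadratic_le Y z
      have h3 : r * (K * ‖z‖ ^ 2) ≤ c * ‖z‖ ^ 2 := by
        rw [← mul_assoc]
        gcongr
      nlinarith)
  exact ⟨C, r / 2, hC, by positivity, h⟩

end Gaussian

/-! ### Concentration for sums along a filtration -/

section Concentration

variable {Ω ι : Type*} [mΩ : MeasurableSpace Ω] [Fintype ι]

/-- `ζ j` is Gaussian noise that is independent of the past `ℱ j`, and belongs to the past of
every later index. -/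
structure IsInnovation (P : Measure Ω) (ℱ : ℕ → MeasurableSpace Ω) (ζ : ℕ → Ω → ι → ℝ)
    (σ : ι → ℝ) : Prop where
  le : ∀ j, ℱ j ≤ mΩ
  mono : Monotone ℱ
  measurable : ∀ i j, i < j → Measurable[ℱ j] (ζ i)
  indep : ∀ j, Indep (ℱ j) (MeasurableSpace.comap (ζ j) inferInstance) P
  law : ∀ j, P.map (ζ j) = gaussianNoise σ

variable {P : Measure Ω} {ℱ : ℕ → MeasurableSpace Ω}
  {ζ : ℕ → Ω → ι → ℝ} {σ : ι → ℝ}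

theorem IsInnovation.measurable_noise (h : IsInnovation P ℱ ζ σ) (j : ℕ) : Measurable (ζ j) :=
  (h.measurable j (j + 1) j.lt_succ_self).mono (h.le _) le_rfl

theorem measure_union_le_two_div {N : ℕ} {s t : Set Ω}
    (hs : P s ≤ ENNReal.ofReal (1 / (N : ℝ) ^ 2)) (ht : P t ≤ ENNReal.ofReal (1 / (N : ℝ) ^ 2)) :
    P (s ∪ t) ≤ ENNReal.ofReal (2 / (N : ℝ) ^ 2) := by
  refine (measure_union_le s t).trans ((add_le_add hs ht).trans_eq ?_)
  rw [← ENNReal.ofReal_add (by positivity) (by positivity)]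
  congr 1
  ring

variable [IsProbabilityMeasure P]

/-- A product of nonnegative factors, each of conditional expectation at most one given the past,
has expectation at most one. No integrability of the predictable arguments `b j` is needed. -/
theorem IsInnovation.lintegral_prod_le_one (h : IsInnovation P ℱ ζ σ) {β : Type*}
    [MeasurableSpace β] {b : ℕ → Ω → β} (hb : ∀ j, Measurable[ℱ j] (b j))
    {g : β → (ι → ℝ) → ENNReal} (hg : Measurable (Function.uncurry g))
    (hg1 : ∀ x, ∫⁻ z, g x z ∂gaussianNoise σ ≤ 1) (m : ℕ) :
    ∫⁻ ω, ∏ j ∈ Finset.range m, g (b j ω) (ζ j ω) ∂P ≤ 1 := by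
  induction m with
  | zero => simp
  | succ m ih =>
    set H : Ω → ENNReal := fun ω => ∏ j ∈ Finset.range m, g (b j ω) (ζ j ω) with hH
    have hHm : Measurable[ℱ m] H := by
      refine Finset.measurable_prod _ fun j hj => ?_
      have hj := Finset.mem_range.1 hj
      exact hg.comp (((hb j).mono (h.mono hj.le) le_rfl).prodMk (h.measurable j m hj))
    have hY : Measurable[ℱ m] fun ω => (H ω, b m ω) := hHm.prodMk (hb m)
    have hY' : Measurable fun ω => (H ω, b m ω) := hY.mono (h.le m) le_rfl
    have hind : IndepFun (fun ω => (H ω, b m ω)) (ζ m) P :=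
      (IndepFun_iff_Indep _ _ _).2 (indep_of_indep_of_le_left (h.indep m) hY.comap_le)
    rw [indepFun_iff_map_prod_eq_prod_map_map hY'.aemeasurable (h.measurable_noise m).aemeasurable,
      h.law m] at hind
    have hF : Measurable fun q : (ENNReal × β) × (ι → ℝ) => q.1.1 * g q.1.2 q.2 :=
      (measurable_fst.comp measurable_fst).mul
        (hg.comp ((measurable_snd.comp measurable_fst).prodMk measurable_snd))
    calc ∫⁻ ω, ∏ j ∈ Finset.range (m + 1), g (b j ω) (ζ j ω) ∂P
        = ∫⁻ ω, H ω * g (b m ω) (ζ m ω) ∂P := by simp only [Finset.prod_range_succ, hH]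
      _ = ∫⁻ q, q.1.1 * g q.1.2 q.2 ∂(P.map fun ω => ((H ω, b m ω), ζ m ω)) :=
          (lintegral_map hF (hY'.prodMk (h.measurable_noise m))).symm
      _ = ∫⁻ y, ∫⁻ z, y.1 * g y.2 z ∂gaussianNoise σ ∂(P.map fun ω => (H ω, b m ω)) := by
          rw [hind, lintegral_prod _ hF.aemeasurable]
      _ ≤ ∫⁻ y, y.1 ∂(P.map fun ω => (H ω, b m ω)) := by
          refine lintegral_mono fun y => ?_
          dsimp only
          have hgy : Measurable (g y.2) := hg.comp measurable_prodMk_left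
          rw [lintegral_const_mul _ hgy]
          exact (mul_le_mul_right (hg1 y.2) y.1).trans_eq (mul_one _)
      _ = ∫⁻ ω, H ω ∂P := lintegral_map measurable_fst hY'
      _ ≤ 1 := ih

/-- Chernoff bound for sums of terms whose exponentials have conditional expectation at most one. -/
theorem IsInnovation.measure_lt_sum_le (h : IsInnovation P ℱ ζ σ) {β : Type*}
    [MeasurableSpace β] {b : ℕ → Ω → β} (hb : ∀ j, Measurable[ℱ j] (b j))
    {f : β → (ι → ℝ) → ℝ} (hf : Measurable (Function.uncurry f))
    (hf1 : ∀ x, ∫⁻ z, ENNReal.ofReal (Real.exp (f x z)) ∂gaussianNoise σ ≤ 1) (m : ℕ) (a : ℝ) :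
    P {ω | a < ∑ j ∈ Finset.range m, f (b j ω) (ζ j ω)} ≤ ENNReal.ofReal (Real.exp (-a)) := by
  have h1 := h.lintegral_prod_le_one hb (g := fun x z => ENNReal.ofReal (Real.exp (f x z)))
    (by exact ENNReal.measurable_ofReal.comp (Real.measurable_exp.comp hf)) hf1 m
  have hm : Measurable fun ω => ∑ j ∈ Finset.range m, f (b j ω) (ζ j ω) :=
    Finset.measurable_sum _ fun j _ =>
      hf.comp (((hb j).mono (h.le j) le_rfl).prodMk (h.measurable_noise j))
  simp only [← ENNReal.ofReal_prod_of_nonneg fun _ _ => (Real.exp_pos _).le, ← Real.exp_sum] at h1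
  have h2 := meas_ge_le_lintegral_div (μ := P)
    (f := fun ω => ENNReal.ofReal (Real.exp (∑ j ∈ Finset.range m, f (b j ω) (ζ j ω))))
    (ENNReal.measurable_ofReal.comp (Real.measurable_exp.comp hm)).aemeasurable
    (ε := ENNReal.ofReal (Real.exp a)) (by simp [Real.exp_pos]) ENNReal.ofReal_ne_top
  refine (measure_mono fun ω hω => ?_).trans
    (h2.trans ((ENNReal.div_le_div_right h1 _).trans_eq ?_))
  · exact ENNReal.ofReal_le_ofReal (Real.exp_le_exp.2 (le_of_lt hω))
  · rw [one_div, ← ENNReal.ofReal_inv_of_pos (Real.exp_pos _), Real.exp_neg]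

/-- The order `√N log N` of the fluctuations of sums of `N` terms, outside an event of
probability of order `1 / N²`. -/
noncomputable def fluct (N : ℕ) : ℝ := √N * (2 * Real.log N + 1)

theorem sqrt_le_fluct {N : ℕ} (hN : 1 ≤ N) : √N ≤ fluct N := by
  have : 0 ≤ Real.log N := Real.log_nonneg (by exact_mod_cast hN)
  rw [fluct]
  nlinarith [Real.sqrt_nonneg (N : ℝ)]

theorem one_le_fluct {N : ℕ} (hN : 1 ≤ N) : 1 ≤ fluct N := by
  refine le_trans ?_ (sqrt_le_fluct hN)
  rw [Real.one_le_sqrt]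
  exact_mod_cast hN

theorem sqrt_mul_log_le_fluct {N : ℕ} : √N * (2 * Real.log N) ≤ fluct N := by
  rw [fluct]
  nlinarith [Real.sqrt_nonneg (N : ℝ)]

theorem exp_neg_two_mul_log {N : ℕ} (hN : 1 ≤ N) :
    Real.exp (-(2 * Real.log N)) = 1 / (N : ℝ) ^ 2 := by
  have : (0 : ℝ) < N := by exact_mod_cast hN
  rw [Real.exp_neg, ← Real.log_rpow this, Real.exp_log (by positivity)]
  simp

theorem dotProduct_self_nonneg_real {κ : Type*} [Fintype κ] (x : κ → ℝ) : 0 ≤ x ⬝ᵥ x :=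
  Finset.sum_nonneg fun _ _ => mul_self_nonneg _

theorem dotProduct_mulVec_self_le {κ : Type*} [Fintype κ] (M : Matrix κ ι ℝ) (x : ι → ℝ) :
    (M *ᵥ x) ⬝ᵥ (M *ᵥ x) ≤ (∑ i, ∑ j, M i j ^ 2) * (x ⬝ᵥ x) := by
  rw [dotProduct, Finset.sum_mul]
  refine Finset.sum_le_sum fun i _ => ?_
  have := Finset.sum_mul_sq_le_sq_mul_sq Finset.univ (M i) x
  simpa only [Matrix.mulVec, dotProduct, ← sq] using this

/-- Self-normalized bound for the martingale `∑ b_jᵀ M ζ_j`, with arbitrary predictable `b`. -/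
theorem exists_linear_bound {κ : Type*} [Fintype κ] (σ : ι → ℝ) (M : Matrix κ ι ℝ) :
    ∃ c : ℝ, 0 ≤ c ∧ ∀ {ℱ : ℕ → MeasurableSpace Ω} {ζ : ℕ → Ω → ι → ℝ},
      IsInnovation P ℱ ζ σ → ∀ b : ℕ → Ω → κ → ℝ, (∀ j, Measurable[ℱ j] (b j)) →
      ∀ N : ℕ, 1 ≤ N → ∀ m : ℕ,
      P {ω | c * fluct N * (1 + (∑ j ∈ Finset.range m, b j ω ⬝ᵥ b j ω) / N)
          < |∑ j ∈ Finset.range m, b j ω ⬝ᵥ (M *ᵥ ζ j ω)|} ≤ ENNReal.ofReal (2 / (N : ℝ) ^ 2) := by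
  set K := ∑ i, ∑ j, Mᵀ i j ^ 2 with hK
  set s := (∑ i, σ i ^ 2) / 2 with hs
  have hK0 : 0 ≤ K := Finset.sum_nonneg fun i _ => Finset.sum_nonneg fun j _ => sq_nonneg _
  have hs0 : 0 ≤ s := div_nonneg (Finset.sum_nonneg fun i _ => sq_nonneg _) (by norm_num)
  refine ⟨1 + s * K, by positivity, ?_⟩
  intro ℱ ζ h b hb N hN m
  have hN0 : (0 : ℝ) < N := by exact_mod_cast hN
  have hq : (0 : ℝ) < √N := Real.sqrt_pos.2 hN0
  have hq2 : √(N : ℝ) ^ 2 = N := Real.sq_sqrt hN0.le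
  -- The level `2 log N` gives probability `1 / N²`. With `l = ± 1 / √N` the compensator is of the
  -- order of the mean of `|b_j|²`.
  have tail : ∀ l : ℝ, P {ω | 2 * Real.log N < ∑ j ∈ Finset.range m,
      (l * ((Mᵀ *ᵥ b j ω) ⬝ᵥ ζ j ω) - l ^ 2 * (s * ((Mᵀ *ᵥ b j ω) ⬝ᵥ (Mᵀ *ᵥ b j ω))))}
      ≤ ENNReal.ofReal (1 / (N : ℝ) ^ 2) := by
    intro l
    rw [← exp_neg_two_mul_log hN]
    refine h.measure_lt_sum_le hb (f := fun x z =>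
      l * ((Mᵀ *ᵥ x) ⬝ᵥ z) - l ^ 2 * (s * ((Mᵀ *ᵥ x) ⬝ᵥ (Mᵀ *ᵥ x)))) ?_ ?_ m _
    · have : Continuous fun q : (κ → ℝ) × (ι → ℝ) =>
          l * ((Mᵀ *ᵥ q.1) ⬝ᵥ q.2) - l ^ 2 * (s * ((Mᵀ *ᵥ q.1) ⬝ᵥ (Mᵀ *ᵥ q.1))) := by fun_prop
      exact this.measurable
    · exact fun x => lintegral_exp_linear_le_one σ (Mᵀ *ᵥ x) l
  refine (measure_mono fun ω hω => ?_).trans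
    (measure_union_le_two_div (tail (1 / √N)) (tail (-(1 / √N))))
  simp only [Set.mem_ofPred_eq, Set.mem_union, Finset.sum_sub_distrib, ← Finset.mul_sum] at hω ⊢
  have e1 : ∑ j ∈ Finset.range m, b j ω ⬝ᵥ (M *ᵥ ζ j ω)
      = ∑ j ∈ Finset.range m, (Mᵀ *ᵥ b j ω) ⬝ᵥ ζ j ω :=
    Finset.sum_congr rfl fun j _ => by
      rw [Matrix.dotProduct_mulVec, Matrix.mulVec_transpose]
  rw [e1] at hω
  set X := ∑ j ∈ Finset.range m, (Mᵀ *ᵥ b j ω) ⬝ᵥ ζ j ω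
  set D := ∑ j ∈ Finset.range m, b j ω ⬝ᵥ b j ω
  have e2 : ∑ j ∈ Finset.range m, (Mᵀ *ᵥ b j ω) ⬝ᵥ (Mᵀ *ᵥ b j ω) ≤ K * D := by
    rw [Finset.mul_sum]
    exact Finset.sum_le_sum fun j _ => dotProduct_mulVec_self_le Mᵀ (b j ω)
  have hD : 0 ≤ D := Finset.sum_nonneg fun j _ => dotProduct_self_nonneg_real _
  have e3 : s * ∑ j ∈ Finset.range m, (Mᵀ *ᵥ b j ω) ⬝ᵥ (Mᵀ *ᵥ b j ω) ≤ s * (K * D) := by gcongr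
  have e4 : 2 * Real.log N + (1 / √N) ^ 2 * (s * (K * D)) < 1 / √N * |X| := by
    have f1 := sqrt_le_fluct hN
    have f2 := sqrt_mul_log_le_fluct (N := N)
    have f3 := one_le_fluct hN
    have g1 : √N * (2 * Real.log N) + s * K * (√N * (D / N)) < |X| := by
      refine lt_of_le_of_lt ?_ hω
      have : √N * (D / N) ≤ fluct N * (D / N) := by gcongr
      have : s * K * (√N * (D / N)) ≤ s * K * (fluct N * (D / N)) := by gcongr
      have : 0 ≤ fluct N * (D / N) := by positivity
      have : 0 ≤ s * K * fluct N := by positivity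
      nlinarith
    have g2 : √N * (D / N) = 1 / √N * D := by
      field_simp
      rw [hq2, mul_comm]
    rw [g2] at g1
    have := mul_lt_mul_of_pos_left g1 (by positivity : 0 < 1 / √(N : ℝ))
    refine lt_of_eq_of_lt ?_ this
    field_simp
  have e5 : (1 / √(N : ℝ)) ^ 2 * (s * ∑ j ∈ Finset.range m, (Mᵀ *ᵥ b j ω) ⬝ᵥ (Mᵀ *ᵥ b j ω))
      ≤ (1 / √(N : ℝ)) ^ 2 * (s * (K * D)) := by gcongr
  rcases abs_cases X with ⟨hX, -⟩ | ⟨hX, -⟩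
  · left
    rw [hX] at e4
    linarith
  · right
    rw [hX] at e4
    have : (-(1 / √(N : ℝ))) ^ 2 = (1 / √(N : ℝ)) ^ 2 := by ring
    rw [this]
    linarith

/-- Concentration of `∑ ζ_jᵀ Y ζ_j` around its mean. -/
theorem exists_quadratic_bound (σ : ι → ℝ) (Y : Matrix ι ι ℝ) :
    ∃ c : ℝ, 0 ≤ c ∧ ∃ N₁ : ℕ, ∀ {ℱ : ℕ → MeasurableSpace Ω} {ζ : ℕ → Ω → ι → ℝ},
      IsInnovation P ℱ ζ σ → ∀ N : ℕ, N₁ ≤ N → ∀ m ≤ N,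
      P {ω | c * fluct N
          < |∑ j ∈ Finset.range m, ζ j ω ⬝ᵥ (Y *ᵥ ζ j ω) - m * quadraticMean σ Y|}
        ≤ ENNReal.ofReal (2 / (N : ℝ) ^ 2) := by
  obtain ⟨C, r, hC, hr, hexp⟩ := exists_lintegral_exp_quadratic_le_one σ Y
  have hev : ∀ᶠ N : ℕ in atTop, 1 ≤ N ∧ 1 / √(N : ℝ) ≤ r := by
    refine (eventually_ge_atTop 1).and ?_
    have : Tendsto (fun N : ℕ => 1 / √(N : ℝ)) atTop (𝓝 0) :=
      tendsto_const_nhds.div_atTop (Real.tendsto_sqrt_atTop.comp tendsto_natCast_atTop_atTop)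
    exact this.eventually_le_const hr
  obtain ⟨N₁, hN₁⟩ := eventually_atTop.1 hev
  refine ⟨1 + C, by positivity, N₁, ?_⟩
  intro ℱ ζ h N hN m hm
  obtain ⟨hN, hNr⟩ := hN₁ N hN
  have hN0 : (0 : ℝ) < N := by exact_mod_cast hN
  have hq : (0 : ℝ) < √N := Real.sqrt_pos.2 hN0
  have hq2 : √(N : ℝ) ^ 2 = N := Real.sq_sqrt hN0.le
  -- As above with `l = ± 1 / √N`, which is at most `r` once `N` is large.
  have tail : ∀ l : ℝ, |l| ≤ r → P {ω | 2 * Real.log N < ∑ j ∈ Finset.range m,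
      (l * (ζ j ω ⬝ᵥ (Y *ᵥ ζ j ω) - quadraticMean σ Y) - l ^ 2 * C)}
      ≤ ENNReal.ofReal (1 / (N : ℝ) ^ 2) := by
    intro l hl
    rw [← exp_neg_two_mul_log hN]
    refine h.measure_lt_sum_le (β := Unit) (b := fun _ _ => ()) (fun j => measurable_const)
      (f := fun _ z => l * (z ⬝ᵥ (Y *ᵥ z) - quadraticMean σ Y) - l ^ 2 * C) ?_ ?_ m _
    · have : Continuous fun q : Unit × (ι → ℝ) =>
          l * (q.2 ⬝ᵥ (Y *ᵥ q.2) - quadraticMean σ Y) - l ^ 2 * C := by fun_prop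
      exact this.measurable
    · exact fun _ => hexp l hl
  have hl1 : |1 / √(N : ℝ)| ≤ r := by rwa [abs_of_pos (by positivity)]
  have hl2 : |-(1 / √(N : ℝ))| ≤ r := by rwa [abs_neg]
  refine (measure_mono fun ω hω => ?_).trans
    (measure_union_le_two_div (tail _ hl1) (tail _ hl2))
  simp only [Set.mem_ofPred_eq, Set.mem_union, Finset.sum_sub_distrib, ← Finset.mul_sum,
    Finset.sum_const, Finset.card_range, nsmul_eq_mul] at hω ⊢
  set X := ∑ j ∈ Finset.range m, ζ j ω ⬝ᵥ (Y *ᵥ ζ j ω) - m * quadraticMean σ Y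
  have e4 : 2 * Real.log N + m * ((1 / √N) ^ 2 * C) < 1 / √N * |X| := by
    have f1 := sqrt_le_fluct hN
    have f2 := sqrt_mul_log_le_fluct (N := N)
    have g1 : √N * (2 * Real.log N) + C * √N < |X| := by
      refine lt_of_le_of_lt ?_ hω
      have : C * √N ≤ C * fluct N := by gcongr
      linarith
    have g3 := mul_lt_mul_of_pos_left g1 (by positivity : 0 < 1 / √(N : ℝ))
    refine lt_of_le_of_lt ?_ g3
    have g4 : (m : ℝ) ≤ N := by exact_mod_cast hm
    have g5 : (m : ℝ) * ((1 / √N) ^ 2 * C) ≤ N * ((1 / √N) ^ 2 * C) := by gcongr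
    refine (add_le_add_right g5 _).trans_eq ?_
    have g6 : (N : ℝ) * ((1 / √N) ^ 2 * C) = C := by
      rw [div_pow, hq2, one_pow]
      field_simp
    rw [g6]
    field_simp
  rcases abs_cases X with ⟨hX, -⟩ | ⟨hX, -⟩
  · left
    rw [hX] at e4
    linarith
  · right
    rw [hX] at e4
    have : (-(1 / √(N : ℝ))) ^ 2 = (1 / √(N : ℝ)) ^ 2 := by ring
    rw [this]
    linarith

end Concentration

/-! ### The noise in the good sensors over a block of time steps -/

section Noise

variable {n p : ℕ} {S : LinearSystem n p} {Ω : Type*} [MeasurableSpace Ω] {P : Measure Ω}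
  {x₀ : Ω → Fin n → ℝ} {w : ℕ → Ω → Fin n → ℝ} {v : ℕ → Ω → Fin p → ℝ}

/-- The process noise and the sensor noise at time `t` as one family of scalar variables. -/
def scalarNoise (w : ℕ → Ω → Fin n → ℝ) (v : ℕ → Ω → Fin p → ℝ) (t : ℕ) (x : Fin n ⊕ Fin p)
    (ω : Ω) : ℝ :=
  Sum.elim (w t ω) (v t ω) x

/-- The standard deviation of the scalar noise variables. -/
def scalarStd (S : LinearSystem n p) {α β : Type*} (x : α ⊕ β) : ℝ :=
  Sum.elim (fun _ => S.σw) (fun _ => S.σv) x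

theorem measurable_scalarNoise (h : IsNoise S P x₀ w v) (t : ℕ) (x : Fin n ⊕ Fin p) :
    Measurable (scalarNoise w v t x) := by
  rcases x with a | d
  · exact (measurable_pi_apply a).comp (h.measurable_w t)
  · exact (measurable_pi_apply d).comp (h.measurable_v t)

theorem map_scalarNoise (h : IsNoise S P x₀ w v) (t : ℕ) (x : Fin n ⊕ Fin p) :
    P.map (scalarNoise w v t x) = gaussianReal 0 (scalarStd S x ^ 2).toNNReal := by
  rcases x with a | d
  · have := congrArg (Measure.map fun z => z a) (h.law_w t)
    rw [Measure.map_map (measurable_pi_apply a) (h.measurable_w t)] at this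
    exact this.trans (gaussianNoise_map_eval (fun _ => S.σw) a)
  · have := congrArg (Measure.map fun z => z d) (h.law_v t)
    rw [Measure.map_map (measurable_pi_apply d) (h.measurable_v t)] at this
    exact this.trans (gaussianNoise_map_eval (fun _ => S.σv) d)

theorem iIndepFun_scalarNoise_apply [IsProbabilityMeasure P] (h : IsNoise S P x₀ w v) (t : ℕ) :
    iIndepFun (scalarNoise w v t) P := by
  rw [iIndepFun_iff_map_fun_eq_pi_map fun x => (measurable_scalarNoise h t x).aemeasurable]
  simp only [map_scalarNoise h]
  have h1 := (indepFun_iff_map_prod_eq_prod_map_map (h.measurable_w t).aemeasurable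
    (h.measurable_v t).aemeasurable).1 (h.indep_wv t)
  rw [h.law_w, h.law_v] at h1
  have h2 := (measurePreserving_sumPiEquivProdPi_symm
    (fun x : Fin n ⊕ Fin p => gaussianReal 0 (scalarStd S x ^ 2).toNNReal)).map_eq
  rw [← h2]
  have h3 : (fun ω x => scalarNoise w v t x ω)
      = (MeasurableEquiv.sumPiEquivProdPi fun _ : Fin n ⊕ Fin p => ℝ).symm
        ∘ fun ω => (w t ω, v t ω) := by
    ext ω x
    rcases x with a | d <;> rfl
  rw [h3, ← Measure.map_map (MeasurableEquiv.measurable _)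
    ((h.measurable_w t).prodMk (h.measurable_v t)), h1]
  rfl

theorem iIndepFun_scalarNoise [IsProbabilityMeasure P] (h : IsNoise S P x₀ w v) :
    iIndepFun (fun (q : ℕ × (Fin n ⊕ Fin p)) => scalarNoise w v q.1 q.2) P := by
  refine iIndepFun_uncurry' (X := scalarNoise w v) (measurable_scalarNoise h) ?_
    (iIndepFun_scalarNoise_apply h)
  have := h.indep_time.comp (fun _ (q : (Fin n → ℝ) × (Fin p → ℝ)) x => Sum.elim q.1 q.2 x)
    (fun _ => measurable_pi_lambda _ fun x => by
      rcases x with a | d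
      · exact (measurable_pi_apply a).comp measurable_fst
      · exact (measurable_pi_apply d).comp measurable_snd)
  exact this

/-- Index set of the process noise and of the noise in the sensors outside `κ` over `μ` time
steps. -/
abbrev BlockIndex (n : ℕ) {p : ℕ} (κ : Finset (Fin p)) (μ : ℕ) : Type :=
  Fin μ × (Fin n ⊕ {d : Fin p // d ∉ κ})

/-- The process noise and the noise in the sensors outside `κ` at times `t, …, t + μ - 1`. -/
def blockNoise (w : ℕ → Ω → Fin n → ℝ) (v : ℕ → Ω → Fin p → ℝ) (κ : Finset (Fin p)) (μ t : ℕ)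
    (ω : Ω) : BlockIndex n κ μ → ℝ :=
  fun q => Sum.elim (w (t + q.1) ω) (fun d => v (t + q.1) ω d) q.2

/-- The standard deviations of the block noise. -/
def blockStd (S : LinearSystem n p) (κ : Finset (Fin p)) (μ : ℕ) (q : BlockIndex n κ μ) : ℝ :=
  scalarStd S q.2

theorem map_blockNoise [IsProbabilityMeasure P] (h : IsNoise S P x₀ w v) (κ : Finset (Fin p))
    (μ t : ℕ) : P.map (blockNoise w v κ μ t) = gaussianNoise (blockStd S κ μ) := by
  let g : BlockIndex n κ μ → ℕ × (Fin n ⊕ Fin p) :=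
    fun q => (t + q.1, Sum.map id Subtype.val q.2)
  have hg : Function.Injective g := by
    rintro ⟨r, x⟩ ⟨r', x'⟩ hq
    simp only [g, Prod.mk.injEq, add_right_inj] at hq
    obtain ⟨h1, h2⟩ := hq
    rw [Fin.ext h1, (Sum.map_injective.2 ⟨Function.injective_id, Subtype.val_injective⟩) h2]
  have h1 := (iIndepFun_scalarNoise h).precomp hg
  have h2 := (iIndepFun_iff_map_fun_eq_pi_map
    fun q => (measurable_scalarNoise h (g q).1 (g q).2).aemeasurable).1 h1
  have h3 : (fun ω q => scalarNoise w v (g q).1 (g q).2 ω) = blockNoise w v κ μ t := by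
    ext ω ⟨r, x⟩
    rcases x with a | d <;> rfl
  rw [← h3, gaussianNoise]
  refine h2.trans ?_
  congr 1
  ext1 q
  rw [map_scalarNoise h]
  rcases q with ⟨r, a | d⟩ <;> rfl

/-- The noise in the process and in the sensors outside `κ` from time `t` on. -/
def futureNoise (w : ℕ → Ω → Fin n → ℝ) (v : ℕ → Ω → Fin p → ℝ) (κ : Finset (Fin p)) (t : ℕ)
    (ω : Ω) : Set.Ici t → (Fin n → ℝ) × ({d : Fin p // d ∉ κ} → ℝ) :=
  fun r => (w r ω, fun d => v r ω d)

/-- `ℱ t` is a σ-algebra of past events: it contains the initial state and everything before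
time `t`, and is independent of the process noise and of the noise in the good sensors from
time `t` on. -/
structure IsPast (P : Measure Ω) (x₀ : Ω → Fin n → ℝ) (w : ℕ → Ω → Fin n → ℝ)
    (v φ : ℕ → Ω → Fin p → ℝ) (κ : Finset (Fin p)) (ℱ : ℕ → MeasurableSpace Ω) : Prop where
  le : ∀ t, ℱ t ≤ ‹MeasurableSpace Ω›
  mono : Monotone ℱ
  measurable_init : ∀ t, Measurable[ℱ t] x₀
  measurable_w : ∀ s t, s < t → Measurable[ℱ t] (w s)
  measurable_v : ∀ s t, s < t → Measurable[ℱ t] (v s)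
  measurable_attack : ∀ s t, s < t → Measurable[ℱ t] (φ s)
  indep : ∀ t, Indep (ℱ t) (MeasurableSpace.comap (futureNoise w v κ t) inferInstance) P

variable {φ : ℕ → Ω → Fin p → ℝ} {κ : Finset (Fin p)}

theorem measurable_pi_of {Ω : Type*} {m : MeasurableSpace Ω} {α : Type*} {X : α → Type*}
    [∀ a, MeasurableSpace (X a)] {f : Ω → ∀ a, X a} (hf : ∀ a, Measurable[m] fun ω => f ω a) :
    Measurable[m] f :=
  @measurable_pi_lambda _ _ _ m _ _ hf

/-- For prediction, the past of time `t` is everything strictly before `t`. -/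
theorem exists_isPast_of_isCausalPred (hn : IsNoise S P x₀ w v) (hφ : ∀ t, Measurable (φ t))
    (h : IsCausalPred P x₀ w v κ φ) : ∃ ℱ, IsPast P x₀ w v φ κ ℱ := by
  let f : ∀ t, Ω → (Fin n → ℝ) × (Set.Iio t → (Fin n → ℝ) × (Fin p → ℝ) × (Fin p → ℝ)) :=
    fun _ ω => (x₀ ω, fun s => (w s.1 ω, v s.1 ω, φ s.1 ω))
  have key : ∀ s t (hst : s < t),
      Measurable[MeasurableSpace.comap (f t) inferInstance] fun ω => (w s ω, v s ω, φ s ω) :=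
    fun s t hst => ((measurable_pi_apply (⟨s, hst⟩ : Set.Iio t)).comp measurable_snd).comp
      (comap_measurable (f t))
  have key0 : ∀ t, Measurable[MeasurableSpace.comap (f t) inferInstance] x₀ :=
    fun t => measurable_fst.comp (comap_measurable (f t))
  refine ⟨fun t => MeasurableSpace.comap (f t) inferInstance,
    ⟨fun t => ?_, fun t t' htt' => ?_, key0, fun s t hst => measurable_fst.comp (key s t hst),
      fun s t hst => (measurable_fst.comp measurable_snd).comp (key s t hst),
      fun s t hst => (measurable_snd.comp measurable_snd).comp (key s t hst), fun t => ?_⟩⟩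
  · refine Measurable.comap_le ?_
    exact hn.measurable_init.prodMk (measurable_pi_lambda _ fun s : Set.Iio t =>
      (hn.measurable_w s).prodMk ((hn.measurable_v s).prodMk (hφ (s : ℕ))))
  · refine Measurable.comap_le ?_
    exact (key0 t').prodMk (measurable_pi_of fun s : Set.Iio t => key s t' (s.2.trans_le htt'))
  · rw [← IndepFun_iff_Indep]
    rcases t with _ | t
    -- Causality for prediction starts after time `0`; at time `0` the past is the initial state.
    · have h1 := hn.indep_init.comp
        (φ := fun x => (x, fun s : Set.Iio 0 =>
          (absurd s.2 (Nat.not_lt_zero s) : (Fin n → ℝ) × (Fin p → ℝ) × (Fin p → ℝ))))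
        (ψ := fun (z : ℕ → (Fin n → ℝ) × (Fin p → ℝ)) (r : Set.Ici 0) =>
          ((z r).1, fun d : {d : Fin p // d ∉ κ} => (z r).2 d))
        (measurable_id.prodMk (measurable_pi_of fun s => absurd s.2 (Nat.not_lt_zero s)))
        (measurable_pi_lambda _ fun r =>
          (measurable_fst.comp (measurable_pi_apply _)).prodMk (measurable_pi_lambda _ fun d =>
            (measurable_pi_apply _).comp (measurable_snd.comp (measurable_pi_apply _))))
      convert h1 using 1
      · ext1 ω
        exact Prod.ext rfl (funext fun s => absurd s.2 (Nat.not_lt_zero s))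
      · rfl
    · exact (h t).comp
        (φ := fun q => (q.1, fun s : Set.Iio (t + 1) => q.2 ⟨s, Nat.lt_succ_iff.1 s.2⟩))
        (ψ := fun z (r : Set.Ici (t + 1)) => z ⟨r, r.2⟩)
        (measurable_fst.prodMk (measurable_pi_of fun s : Set.Iio (t + 1) =>
          (measurable_pi_apply (⟨s, Nat.lt_succ_iff.1 s.2⟩ : Set.Iic t)).comp measurable_snd))
        (measurable_pi_lambda _ fun r => measurable_pi_apply _)

/-- For filtering, the past of time `t` also contains the attack and the noise in the attacked
sensors at time `t`. -/
theorem exists_isPast_of_isCausalFilt (hn : IsNoise S P x₀ w v) (hφ : ∀ t, Measurable (φ t))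
    (h : IsCausalFilt P x₀ w v κ φ) : ∃ ℱ, IsPast P x₀ w v φ κ ℱ ∧
      (∀ t, Measurable[ℱ t] (φ t)) ∧ ∀ t, ∀ j ∈ κ, Measurable[ℱ t] fun ω => v t ω j := by
  let f : ∀ t, Ω → (Fin n → ℝ) × (Set.Iio t → (Fin n → ℝ) × (Fin p → ℝ))
      × (Set.Iic t → (Fin p → ℝ) × (κ → ℝ)) :=
    fun _ ω => (x₀ ω, fun s => (w s.1 ω, v s.1 ω), fun s => (φ s.1 ω, fun j => v s.1 ω j))
  have key0 : ∀ t, Measurable[MeasurableSpace.comap (f t) inferInstance] x₀ :=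
    fun t => measurable_fst.comp (comap_measurable (f t))
  have key1 : ∀ s t (hst : s < t),
      Measurable[MeasurableSpace.comap (f t) inferInstance] fun ω => (w s ω, v s ω) :=
    fun s t hst => ((measurable_pi_apply (⟨s, hst⟩ : Set.Iio t)).comp
      (measurable_fst.comp measurable_snd)).comp (comap_measurable (f t))
  have key2 : ∀ s t (hst : s ≤ t), Measurable[MeasurableSpace.comap (f t) inferInstance]
      fun ω => (φ s ω, fun j : κ => v s ω j) :=
    fun s t hst => ((measurable_pi_apply (⟨s, hst⟩ : Set.Iic t)).comp
      (measurable_snd.comp measurable_snd)).comp (comap_measurable (f t))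
  refine ⟨fun t => MeasurableSpace.comap (f t) inferInstance,
    ⟨fun t => ?_, fun t t' htt' => ?_, key0, fun s t hst => measurable_fst.comp (key1 s t hst),
      fun s t hst => measurable_snd.comp (key1 s t hst),
      fun s t hst => measurable_fst.comp (key2 s t hst.le), fun t => ?_⟩,
    fun t => measurable_fst.comp (key2 t t le_rfl),
    fun t j hj => (measurable_pi_apply (⟨j, hj⟩ : κ)).comp
      (measurable_snd.comp (key2 t t le_rfl))⟩
  · refine Measurable.comap_le ?_
    exact hn.measurable_init.prodMk ((measurable_pi_of fun s : Set.Iio t =>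
      (hn.measurable_w s).prodMk (hn.measurable_v s)).prodMk
      (measurable_pi_of fun s : Set.Iic t => (hφ s).prodMk (measurable_pi_of fun j : κ =>
        (measurable_pi_apply (j : Fin p)).comp (hn.measurable_v s))))
  · refine Measurable.comap_le ?_
    exact (key0 t').prodMk
      ((measurable_pi_of fun s : Set.Iio t => key1 s t' (s.2.trans_le htt')).prodMk
        (measurable_pi_of fun s : Set.Iic t => key2 s t' (s.2.trans htt')))
  · exact (IndepFun_iff_Indep _ _ _).1 (h t)

/-- Sampled every `μ` time steps, the noise of `μ` steps is an innovation: successive blocks do not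
overlap. -/
theorem IsPast.isInnovation [IsProbabilityMeasure P] {ℱ : ℕ → MeasurableSpace Ω}
    (h : IsPast P x₀ w v φ κ ℱ) (hn : IsNoise S P x₀ w v) (μ t : ℕ) :
    IsInnovation P (fun j => ℱ (t + j * μ)) (fun j => blockNoise w v κ μ (t + j * μ))
      (blockStd S κ μ) := by
  refine ⟨fun j => h.le _, fun i j hij => h.mono (by gcongr), fun i j hij => ?_, fun j => ?_,
    fun j => map_blockNoise hn κ μ _⟩
  · refine measurable_pi_of fun q => ?_
    have hlt : t + i * μ + q.1 < t + j * μ := by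
      have := q.1.2
      have : (i + 1) * μ ≤ j * μ := Nat.mul_le_mul_right μ hij
      rw [add_mul] at this
      omega
    rcases q with ⟨r, a | d⟩
    · exact (measurable_pi_apply a).comp (h.measurable_w _ _ hlt)
    · exact (measurable_pi_apply (d : Fin p)).comp (h.measurable_v _ _ hlt)
  · refine indep_of_indep_of_le_right (h.indep _) (Measurable.comap_le ?_)
    refine measurable_pi_of fun q => ?_
    have hm : Measurable[MeasurableSpace.comap (futureNoise w v κ (t + j * μ)) inferInstance]
        (futureNoise w v κ (t + j * μ)) := comap_measurable _
    have h1 := (measurable_pi_apply (⟨t + j * μ + q.1, Nat.le_add_right _ _⟩ :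
      Set.Ici (t + j * μ))).comp hm
    rcases q with ⟨r, a | d⟩
    · exact (measurable_pi_apply a).comp (measurable_fst.comp h1)
    · exact (measurable_pi_apply d).comp (measurable_snd.comp h1)

end Noise

/-! ### Measurability of trajectories and estimates -/

section Measurability

variable {n p : ℕ} {S : LinearSystem n p} {Ω : Type*} [MeasurableSpace Ω]
  {x₀ : Ω → Fin n → ℝ} {w : ℕ → Ω → Fin n → ℝ} {v φ : ℕ → Ω → Fin p → ℝ}

theorem measurable_mulVec {ι κ : Type*} [Fintype ι] [Fintype κ] (M : Matrix κ ι ℝ)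
    {f : Ω → ι → ℝ} (hf : Measurable f) : Measurable fun ω => M *ᵥ f ω :=
  (by fun_prop : Continuous fun x : ι → ℝ => M *ᵥ x).measurable.comp hf

theorem measurable_statePath {t : ℕ} (h0 : Measurable x₀) (hw : ∀ s < t, Measurable (w s)) :
    Measurable fun ω => statePath S x₀ w ω t := by
  induction t with
  | zero => exact h0
  | succ t ih =>
    exact (measurable_mulVec S.A (ih fun s hs => hw s (hs.trans t.lt_succ_self))).add
      (hw t t.lt_succ_self)

theorem measurable_outputPath {t : ℕ} (h0 : Measurable x₀) (hw : ∀ s < t, Measurable (w s))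
    (hv : Measurable (v t)) (hφ : Measurable (φ t)) :
    Measurable fun ω => outputPath S x₀ w v φ ω t :=
  ((measurable_mulVec S.C (measurable_statePath h0 hw)).add hv).add hφ

theorem measurable_predictor (s : Finset (Fin p)) (ξ : Fin n → ℝ) {y : Ω → ℕ → Fin p → ℝ} {t : ℕ}
    (hy : ∀ r < t, Measurable fun ω => y ω r) :
    Measurable fun ω => predictor S s ξ (y ω) t := by
  induction t with
  | zero => exact measurable_const
  | succ t ih =>
    have h1 := ih fun r hr => hy r (hr.trans t.lt_succ_self)
    refine (measurable_mulVec S.A h1).add (measurable_mulVec _ (Measurable.sub ?_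
      (measurable_mulVec _ h1)))
    exact measurable_pi_lambda _ fun d => (measurable_pi_apply _).comp (hy t t.lt_succ_self)

end Measurability

/-! ### Lyapunov functions of stable matrices -/

section Lyapunov

variable {κ ι : Type*} [Fintype κ] [Fintype ι]

theorem dotProduct_mulVec_conj {ν ν' : Type*} [Fintype ν] [Fintype ν'] (X : Matrix ν ν' ℝ)
    (M : Matrix ν κ ℝ) (M' : Matrix ν' ι ℝ) (x : κ → ℝ) (y : ι → ℝ) :
    (M *ᵥ x) ⬝ᵥ (X *ᵥ (M' *ᵥ y)) = x ⬝ᵥ ((Mᵀ * X * M') *ᵥ y) := by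
  rw [← Matrix.mulVec_mulVec, ← Matrix.mulVec_mulVec, Matrix.dotProduct_mulVec x,
    Matrix.vecMul_transpose]

theorem mulVec_dotProduct_mulVec {ν : Type*} [Fintype ν]
    (M : Matrix ν κ ℝ) (M' : Matrix ν ι ℝ) (x : κ → ℝ) (y : ι → ℝ) :
    (M *ᵥ x) ⬝ᵥ (M' *ᵥ y) = x ⬝ᵥ ((Mᵀ * M') *ᵥ y) := by
  rw [← Matrix.mulVec_mulVec, Matrix.dotProduct_mulVec x, Matrix.vecMul_transpose]

theorem dotProduct_transpose_mulVec (M : Matrix ι ι ℝ) (x y : ι → ℝ) :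
    x ⬝ᵥ (Mᵀ *ᵥ y) = y ⬝ᵥ (M *ᵥ x) := by
  rw [Matrix.dotProduct_mulVec, Matrix.vecMul_transpose, dotProduct_comm]

/-- `X` solves the Lyapunov equation `X = Fᵀ X F + Eᵀ E` and defines a nonnegative form. -/
structure IsLyapunov (F : Matrix ι ι ℝ) (E : Matrix κ ι ℝ) (X : Matrix ι ι ℝ) : Prop where
  eq : X = Fᵀ * X * F + Eᵀ * E
  nonneg : ∀ x, 0 ≤ x ⬝ᵥ (X *ᵥ x)

theorem IsLyapunov.apply {F : Matrix ι ι ℝ} {E : Matrix κ ι ℝ} {X : Matrix ι ι ℝ}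
    (h : IsLyapunov F E X) (x : ι → ℝ) :
    x ⬝ᵥ (X *ᵥ x) = (F *ᵥ x) ⬝ᵥ (X *ᵥ (F *ᵥ x)) + (E *ᵥ x) ⬝ᵥ (E *ᵥ x) := by
  rw [dotProduct_mulVec_conj, mulVec_dotProduct_mulVec, ← dotProduct_add, ← Matrix.add_mulVec,
    ← h.eq]

/-- If `F ^ t → 0` then `X ↦ X - Fᵀ X F` is injective, hence surjective. -/
theorem exists_isLyapunov [DecidableEq ι] {F : Matrix ι ι ℝ}
    (hF : Tendsto (fun t => F ^ t) atTop (𝓝 0)) (E : Matrix κ ι ℝ) : ∃ X, IsLyapunov F E X := by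
  have lim : ∀ X : Matrix ι ι ℝ, Tendsto (fun t => (F ^ t)ᵀ * X * F ^ t) atTop (𝓝 0) := by
    intro X
    have hc : Continuous fun M : Matrix ι ι ℝ => Mᵀ * X * M := by fun_prop
    have h := (hc.tendsto 0).comp hF
    simp only [Matrix.mul_zero] at h
    exact h
  let T : Matrix ι ι ℝ →ₗ[ℝ] Matrix ι ι ℝ :=
    { toFun := fun X => X - Fᵀ * X * F
      map_add' := fun X Y => by simp only [Matrix.mul_add, Matrix.add_mul]; abel
      map_smul' := fun c X => by simp [smul_sub] }
  have hinj : Function.Injective T := by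
    refine (injective_iff_map_eq_zero T).2 fun X hX => ?_
    have h1 : X = Fᵀ * X * F := sub_eq_zero.1 hX
    have h2 : ∀ t : ℕ, (F ^ t)ᵀ * X * F ^ t = X := by
      intro t
      induction t with
      | zero => simp
      | succ t ih =>
        nth_rw 2 [← ih]
        nth_rw 2 [h1]
        rw [pow_succ']
        simp only [Matrix.transpose_mul, Matrix.mul_assoc]
    have h3 := lim X
    simp only [h2] at h3
    exact tendsto_nhds_unique tendsto_const_nhds h3
  obtain ⟨X, hX⟩ := (LinearMap.injective_iff_surjective.1 hinj) (Eᵀ * E)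
  have hX' : X - Fᵀ * X * F = Eᵀ * E := hX
  have heq : X = Fᵀ * X * F + Eᵀ * E := by rw [← hX']; abel
  refine ⟨X, heq, fun x => ?_⟩
  have h4 : ∀ t : ℕ, x ⬝ᵥ (((F ^ t)ᵀ * X * F ^ t) *ᵥ x) ≤ x ⬝ᵥ (X *ᵥ x) := by
    intro t
    induction t with
    | zero => simp
    | succ t ih =>
      refine le_trans ?_ ih
      have h5 : (F ^ t)ᵀ * X * F ^ t
          = (F ^ (t + 1))ᵀ * X * F ^ (t + 1) + (E * F ^ t)ᵀ * (E * F ^ t) := by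
        nth_rw 1 [heq]
        rw [pow_succ']
        simp only [Matrix.transpose_mul, Matrix.mul_add, Matrix.add_mul, Matrix.mul_assoc]
      rw [h5, Matrix.add_mulVec, dotProduct_add, ← mulVec_dotProduct_mulVec]
      linarith [dotProduct_self_nonneg_real ((E * F ^ t) *ᵥ x)]
  have hc : Continuous fun M : Matrix ι ι ℝ => x ⬝ᵥ (M *ᵥ x) := by fun_prop
  have h6 := (hc.tendsto 0).comp (lim X)
  simp only [Matrix.zero_mulVec, dotProduct_zero] at h6
  exact le_of_tendsto' h6 h4

/-- `xᵀ X x ≤ |x|² + |X x|²`, bounded by the Frobenius norm. -/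
theorem dotProduct_mulVec_le (X : Matrix ι ι ℝ) :
    ∃ K, 0 ≤ K ∧ ∀ x, x ⬝ᵥ (X *ᵥ x) ≤ K * (x ⬝ᵥ x) := by
  set s := ∑ i, ∑ j, X i j ^ 2
  have hs : 0 ≤ s := Finset.sum_nonneg fun i _ => Finset.sum_nonneg fun j _ => sq_nonneg _
  refine ⟨1 + s, by positivity, fun x => ?_⟩
  have h1 := dotProduct_mulVec_self_le X x
  have h2 := dotProduct_self_nonneg_real (x - X *ᵥ x)
  have h3 := dotProduct_self_nonneg_real x
  simp only [sub_dotProduct, dotProduct_sub] at h2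
  rw [dotProduct_comm (X *ᵥ x) x] at h2
  have h4 := dotProduct_self_nonneg_real (X *ᵥ x)
  nlinarith

theorem trace_mul_diagonal_mul_transpose [DecidableEq ι] (σ : ι → ℝ) (M N : Matrix κ ι ℝ) :
    (M * Matrix.diagonal (fun i => σ i ^ 2) * Nᵀ).trace = quadraticMean σ (Mᵀ * N) := by
  have h : ∀ c, (M * Matrix.diagonal (fun i => σ i ^ 2) * Nᵀ) c c
      = ∑ i, M c i * σ i ^ 2 * N c i := fun c => by
    rw [Matrix.mul_apply]
    simp only [Matrix.mul_diagonal, Matrix.transpose_apply]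
  rw [Matrix.trace, quadraticMean]
  simp only [Matrix.diag_apply, h, Matrix.mul_apply (M := Mᵀ), Matrix.transpose_apply,
    Finset.mul_sum]
  rw [Finset.sum_comm]
  exact Finset.sum_congr rfl fun i _ => Finset.sum_congr rfl fun c _ => by ring

theorem quadraticMean_add (σ : ι → ℝ) (Y Z : Matrix ι ι ℝ) :
    quadraticMean σ (Y + Z) = quadraticMean σ Y + quadraticMean σ Z := by
  simp [quadraticMean, mul_add, Finset.sum_add_distrib]

theorem quadraticMean_smul (σ : ι → ℝ) (c : ℝ) (Y : Matrix ι ι ℝ) :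
    quadraticMean σ (c • Y) = c * quadraticMean σ Y := by
  simp only [quadraticMean, Matrix.smul_apply, smul_eq_mul, Finset.mul_sum]
  exact Finset.sum_congr rfl fun i _ => by ring

/-- Duality between the two Lyapunov equations: `tr (X N D Nᵀ) = tr (E P Eᵀ)` when
`P = F P Fᵀ + N D Nᵀ` and `X = Fᵀ X F + Eᵀ E`. -/
theorem IsLyapunov.quadraticMean_eq {ν : Type*} [Fintype ν] [DecidableEq ν] {F : Matrix ι ι ℝ}
    {E : Matrix κ ι ℝ} {X : Matrix ι ι ℝ} (h : IsLyapunov F E X) {σ : ν → ℝ} {N : Matrix ι ν ℝ}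
    {P : Matrix ι ι ℝ} (hP : P = F * P * Fᵀ + N * Matrix.diagonal (fun i => σ i ^ 2) * Nᵀ) :
    quadraticMean σ (Nᵀ * X * N) = (E * P * Eᵀ).trace := by
  have h1 : quadraticMean σ (Nᵀ * X * N)
      = (N * Matrix.diagonal (fun i => σ i ^ 2) * Nᵀ * X).trace := by
    rw [Matrix.mul_assoc, ← trace_mul_diagonal_mul_transpose, Matrix.transpose_mul,
      ← Matrix.trace_transpose]
    simp only [Matrix.transpose_mul, Matrix.diagonal_transpose, Matrix.transpose_transpose]
    rw [Matrix.trace_mul_comm (N * _ * Nᵀ) X]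
    simp only [Matrix.mul_assoc]
  have h2 : N * Matrix.diagonal (fun i => σ i ^ 2) * Nᵀ = P - F * P * Fᵀ :=
    eq_sub_of_add_eq' hP.symm
  have h3 : (F * P * Fᵀ * X).trace = (P * (Fᵀ * X * F)).trace := by
    rw [Matrix.mul_assoc, Matrix.mul_assoc, Matrix.trace_mul_comm]
    simp only [Matrix.mul_assoc]
  have h4 : Fᵀ * X * F = X - Eᵀ * E := eq_sub_of_add_eq h.eq.symm
  rw [h1, h2, Matrix.sub_mul, Matrix.trace_sub, h3, h4, Matrix.mul_sub, Matrix.trace_sub,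
    sub_sub_cancel, ← Matrix.mul_assoc, Matrix.trace_mul_comm, Matrix.mul_assoc]

/-- Along a recursion `e_{j+1} = F e_j + G z_j` the form `eᵀ X e` decreases by `|E e|²`, up to
noise terms. -/
theorem IsLyapunov.sum_add {ν : Type*} [Fintype ν] {F : Matrix ι ι ℝ} {E : Matrix κ ι ℝ}
    {X : Matrix ι ι ℝ} (h : IsLyapunov F E X) {G : Matrix ι ν ℝ} {e : ℕ → ι → ℝ} {z : ℕ → ν → ℝ}
    (hrec : ∀ j, e (j + 1) = F *ᵥ e j + G *ᵥ z j) (V : Matrix κ ν ℝ) (m : ℕ) :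
    ∑ j ∈ Finset.range m, (E *ᵥ e j + V *ᵥ z j) ⬝ᵥ (E *ᵥ e j + V *ᵥ z j) + e m ⬝ᵥ (X *ᵥ e m)
      = e 0 ⬝ᵥ (X *ᵥ e 0)
        + ∑ j ∈ Finset.range m, e j ⬝ᵥ ((Fᵀ * (X + Xᵀ) * G + (2 : ℝ) • (Eᵀ * V)) *ᵥ z j)
        + ∑ j ∈ Finset.range m, z j ⬝ᵥ ((Gᵀ * X * G + Vᵀ * V) *ᵥ z j) := by
  induction m with
  | zero => simp
  | succ m ih =>
    have i0 : e (m + 1) ⬝ᵥ (X *ᵥ e (m + 1))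
        = (F *ᵥ e m) ⬝ᵥ (X *ᵥ (F *ᵥ e m)) + e m ⬝ᵥ ((Fᵀ * (X + Xᵀ) * G) *ᵥ z m)
          + z m ⬝ᵥ ((Gᵀ * X * G) *ᵥ z m) := by
      rw [hrec, ← dotProduct_mulVec_conj, ← dotProduct_mulVec_conj, Matrix.add_mulVec,
        dotProduct_add, dotProduct_transpose_mulVec, Matrix.mulVec_add]
      simp only [add_dotProduct, dotProduct_add]
      ring
    have i1 := h.apply (e m)
    have i2 : e m ⬝ᵥ ((Fᵀ * (X + Xᵀ) * G + (2 : ℝ) • (Eᵀ * V)) *ᵥ z m)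
        = e m ⬝ᵥ ((Fᵀ * (X + Xᵀ) * G) *ᵥ z m) + 2 * ((E *ᵥ e m) ⬝ᵥ (V *ᵥ z m)) := by
      rw [Matrix.add_mulVec, dotProduct_add, Matrix.smul_mulVec, dotProduct_smul,
        ← mulVec_dotProduct_mulVec, smul_eq_mul]
    have i3 : z m ⬝ᵥ ((Gᵀ * X * G + Vᵀ * V) *ᵥ z m)
        = z m ⬝ᵥ ((Gᵀ * X * G) *ᵥ z m) + (V *ᵥ z m) ⬝ᵥ (V *ᵥ z m) := by
      rw [Matrix.add_mulVec, dotProduct_add, ← mulVec_dotProduct_mulVec]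
    have i4 : (E *ᵥ e m + V *ᵥ z m) ⬝ᵥ (E *ᵥ e m + V *ᵥ z m) = (E *ᵥ e m) ⬝ᵥ (E *ᵥ e m)
        + 2 * ((E *ᵥ e m) ⬝ᵥ (V *ᵥ z m)) + (V *ᵥ z m) ⬝ᵥ (V *ᵥ z m) := by
      simp only [add_dotProduct, dotProduct_add]
      rw [dotProduct_comm (V *ᵥ z m) (E *ᵥ e m)]
      ring
    rw [Finset.sum_range_succ, Finset.sum_range_succ, Finset.sum_range_succ, i0, i2, i3, i4]
    linarith

end Lyapunov

/-! ### Residue sums for arbitrary and for honest estimates -/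

section Core

theorem tendsto_fluct_div : Tendsto (fun N : ℕ => fluct N / N) atTop (𝓝 0) := by
  have h1 : Tendsto (fun x : ℝ => Real.log x / x ^ (1 / 2 : ℝ)) atTop (𝓝 0) :=
    (isLittleO_log_rpow_atTop (by norm_num)).tendsto_div_nhds_zero
  have h2 : Tendsto (fun x : ℝ => 1 / x ^ (1 / 2 : ℝ)) atTop (𝓝 0) :=
    tendsto_const_nhds.div_atTop (tendsto_rpow_atTop (by norm_num))
  have h3 := (((h1.const_mul 2).add h2).comp (tendsto_natCast_atTop_atTop (R := ℝ)))
  simp only [mul_zero, add_zero] at h3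
  refine h3.congr' ?_
  filter_upwards [eventually_ge_atTop 1] with N hN
  have hN0 : (0 : ℝ) < N := by exact_mod_cast hN
  have hq : (0 : ℝ) < √N := Real.sqrt_pos.2 hN0
  simp only [Function.comp_apply, ← Real.sqrt_eq_rpow, fluct]
  have hq2 : √(N : ℝ) * √N = N := Real.mul_self_sqrt hN0.le
  rw [eq_div_iff hN0.ne', ← hq2]
  have : (2 * (Real.log N / √N) + 1 / √N) * (√N * √N) = √N * (2 * Real.log N + 1) := by
    field_simp
  simpa only [hq2] using this

theorem eventually_mul_fluct_le (c : ℝ) {r : ℝ} (hr : 0 < r) :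
    ∀ᶠ N : ℕ in atTop, c * fluct N ≤ r * N := by
  have h := tendsto_fluct_div.const_mul c
  rw [mul_zero] at h
  filter_upwards [h.eventually_le_const hr, eventually_ge_atTop 1] with N hN hN1
  have hN0 : (0 : ℝ) < N := by exact_mod_cast hN1
  rwa [mul_div_assoc', div_le_iff₀ hN0] at hN

variable {Ω ι κ : Type*} [MeasurableSpace Ω] [Fintype ι] [Fintype κ] {P : Measure Ω}

theorem measure_union_le_add_div {N : ℕ} {s t : Set Ω} {a b : ℝ} (ha : 0 ≤ a) (hb : 0 ≤ b)
    (hs : P s ≤ ENNReal.ofReal (a / (N : ℝ) ^ 2)) (ht : P t ≤ ENNReal.ofReal (b / (N : ℝ) ^ 2)) :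
    P (s ∪ t) ≤ ENNReal.ofReal ((a + b) / (N : ℝ) ^ 2) := by
  refine (measure_union_le s t).trans ((add_le_add hs ht).trans_eq ?_)
  rw [← ENNReal.ofReal_add (by positivity) (by positivity), add_div]

variable [IsProbabilityMeasure P]

/-- Whatever the predictable part `b` of the errors `e_j = b_j + B ζ_j` is, residues
`e_j + U ζ_j` that are small in mean square force the errors to be small in mean square. -/
theorem exists_residue_sound (σ : ι → ℝ) (B U : Matrix κ ι ℝ) (opt H : ℝ) :
    ∃ C : ℝ, 0 ≤ C ∧ ∃ N₁ : ℕ, ∀ {ℱ : ℕ → MeasurableSpace Ω} {ζ : ℕ → Ω → ι → ℝ},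
      IsInnovation P ℱ ζ σ → ∀ e : ℕ → Ω → κ → ℝ,
      (∀ j, Measurable[ℱ j] fun ω => e j ω - B *ᵥ ζ j ω) → ∀ N : ℕ, N₁ ≤ N → ∀ m ≤ N,
      P {ω | ∃ η ≤ H, ∑ j ∈ Finset.range m, (e j ω + U *ᵥ ζ j ω) ⬝ᵥ (e j ω + U *ᵥ ζ j ω)
            ≤ m * (opt + quadraticMean σ (Uᵀ * U + (2 : ℝ) • (Bᵀ * U)) + η) ∧
          m * (opt + η) + C * fluct N < ∑ j ∈ Finset.range m, e j ω ⬝ᵥ e j ω}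
        ≤ ENNReal.ofReal (6 / (N : ℝ) ^ 2) := by
  obtain ⟨c₁, hc₁, hlin⟩ := exists_linear_bound (P := P) σ U
  obtain ⟨c₂, hc₂, n₂, hquad⟩ := exists_quadratic_bound (P := P) σ (Uᵀ * U + (2 : ℝ) • (Bᵀ * U))
  obtain ⟨c₃, hc₃, n₃, hquadB⟩ := exists_quadratic_bound (P := P) σ (Bᵀ * B)
  set τ := quadraticMean σ (Uᵀ * U + (2 : ℝ) • (Bᵀ * U))
  set τB := quadraticMean σ (Bᵀ * B)
  set a := |opt| + |H|
  set K := c₂ + 2 * c₁ * (1 + 2 * (|τB| + 1))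
  have hK : 0 ≤ K := by positivity
  have ha : 0 ≤ a := by positivity
  obtain ⟨n₄, hn₄⟩ := eventually_atTop.1 (((eventually_mul_fluct_le (4 * c₁)
    (by norm_num : (0 : ℝ) < 1 / 2)).and (eventually_mul_fluct_le c₃ one_pos)).and
    (eventually_ge_atTop 1))
  refine ⟨2 * K + 8 * c₁ * a, by positivity, max n₂ (max n₃ n₄), ?_⟩
  intro ℱ ζ h e he N hN m hm
  have hN2 : n₂ ≤ N := (le_max_left _ _).trans hN
  have hN3 : n₃ ≤ N := ((le_max_left _ _).trans (le_max_right _ _)).trans hN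
  obtain ⟨⟨hx, hxB⟩, hN1⟩ := hn₄ N (((le_max_right _ _).trans (le_max_right _ _)).trans hN)
  have hN0 : (0 : ℝ) < N := by exact_mod_cast hN1
  have hρ := one_le_fluct hN1
  have hall := measure_union_le_add_div (by norm_num) (by norm_num)
    (measure_union_le_add_div (by norm_num) (by norm_num)
      (hlin h (fun j ω => e j ω - B *ᵥ ζ j ω) he N hN1 m) (hquad h N hN2 m hm))
    (hquadB h N hN3 m hm)
  norm_num only at hall
  refine (measure_mono fun ω hω => ?_).trans hall
  obtain ⟨η, hη, htest, hbig⟩ := hω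
  by_contra hcon
  simp only [Set.mem_union, Set.mem_ofPred_eq, not_or, not_lt] at hcon
  obtain ⟨⟨h1, h2⟩, h3⟩ := hcon
  set E2 := ∑ j ∈ Finset.range m, e j ω ⬝ᵥ e j ω
  set D := ∑ j ∈ Finset.range m, (e j ω - B *ᵥ ζ j ω) ⬝ᵥ (e j ω - B *ᵥ ζ j ω)
  set L := ∑ j ∈ Finset.range m, (e j ω - B *ᵥ ζ j ω) ⬝ᵥ (U *ᵥ ζ j ω)
  set Q := ∑ j ∈ Finset.range m, ζ j ω ⬝ᵥ ((Uᵀ * U + (2 : ℝ) • (Bᵀ * U)) *ᵥ ζ j ω)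
  set QB := ∑ j ∈ Finset.range m, ζ j ω ⬝ᵥ ((Bᵀ * B) *ᵥ ζ j ω)
  -- With `b = e - B ζ` predictable: `|e + U ζ|² = |e|² + 2 bᵀ U ζ + ζᵀ (Uᵀ U + 2 Bᵀ U) ζ`, where
  -- the middle term is a martingale difference and the last one is close to its mean `τ`.
  have hT : ∑ j ∈ Finset.range m, (e j ω + U *ᵥ ζ j ω) ⬝ᵥ (e j ω + U *ᵥ ζ j ω)
      = E2 + 2 * L + Q := by
    simp only [E2, L, Q, Finset.mul_sum, ← Finset.sum_add_distrib]
    refine Finset.sum_congr rfl fun j _ => ?_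
    have i1 : ζ j ω ⬝ᵥ ((Uᵀ * U + (2 : ℝ) • (Bᵀ * U)) *ᵥ ζ j ω)
        = (U *ᵥ ζ j ω) ⬝ᵥ (U *ᵥ ζ j ω) + 2 * ((B *ᵥ ζ j ω) ⬝ᵥ (U *ᵥ ζ j ω)) := by
      rw [Matrix.add_mulVec, dotProduct_add, Matrix.smul_mulVec, dotProduct_smul,
        ← mulVec_dotProduct_mulVec, ← mulVec_dotProduct_mulVec, smul_eq_mul]
    rw [i1]
    simp only [add_dotProduct, dotProduct_add, sub_dotProduct]
    rw [dotProduct_comm (U *ᵥ ζ j ω) (e j ω)]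
    ring
  have hD : D ≤ 2 * E2 + 2 * QB := by
    simp only [E2, D, QB, Finset.mul_sum, ← Finset.sum_add_distrib]
    refine Finset.sum_le_sum fun j _ => ?_
    rw [← mulVec_dotProduct_mulVec]
    have := dotProduct_self_nonneg_real (e j ω + B *ᵥ ζ j ω)
    simp only [add_dotProduct, dotProduct_add, sub_dotProduct, dotProduct_sub] at this ⊢
    linarith
  have hE2 : 0 ≤ E2 := Finset.sum_nonneg fun j _ => dotProduct_self_nonneg_real _
  have hmN : (m : ℝ) ≤ N := by exact_mod_cast hm
  have hm0 : (0 : ℝ) ≤ m := Nat.cast_nonneg m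
  have hQB : QB ≤ N * (|τB| + 1) := by
    have i1 := (abs_le.1 h3).2
    have i2 : m * τB ≤ N * |τB| :=
      (mul_le_mul_of_nonneg_left (le_abs_self _) hm0).trans
        (mul_le_mul_of_nonneg_right hmN (abs_nonneg _))
    linarith
  have hDN : D / N ≤ 2 * (E2 / N) + 2 * (|τB| + 1) := by
    rw [div_le_iff₀ hN0]
    have : (2 * (E2 / N) + 2 * (|τB| + 1)) * N = 2 * E2 + 2 * (N * (|τB| + 1)) := by
      field_simp
    linarith
  -- the error sum is bounded in terms of itself, with a small coefficient `x`
  set x := 4 * c₁ * fluct N / N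
  have hx0 : 0 ≤ x := by positivity
  have hx1 : x ≤ 1 / 2 := by rw [div_le_iff₀ hN0]; exact hx
  have hA : m * (opt + η) ≤ N * a := by
    have : opt + η ≤ a := add_le_add (le_abs_self _) (hη.trans (le_abs_self _))
    exact (mul_le_mul_of_nonneg_left this hm0).trans (mul_le_mul_of_nonneg_right hmN ha)
  have hmain : E2 ≤ m * (opt + η) + K * fluct N + x * E2 := by
    have i1 := neg_le_of_abs_le h1
    have i2 := neg_le_of_abs_le h2
    have i3 : c₁ * fluct N * (1 + D / N)
        ≤ c₁ * fluct N * (1 + (2 * (E2 / N) + 2 * (|τB| + 1))) := by gcongr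
    have i4 : 2 * (c₁ * fluct N * (1 + (2 * (E2 / N) + 2 * (|τB| + 1))))
        = 2 * c₁ * (1 + 2 * (|τB| + 1)) * fluct N + x * E2 := by
      simp only [x]
      field_simp
      ring
    rw [hT] at htest
    have i5 : K * fluct N = c₂ * fluct N + 2 * c₁ * (1 + 2 * (|τB| + 1)) * fluct N := by
      simp only [K]; ring
    have i6 : m * (opt + τ + η) = m * (opt + η) + m * τ := by ring
    linarith
  have hE2' : E2 ≤ 2 * (N * a + K * fluct N) := by nlinarith
  have hlast : x * E2 ≤ K * fluct N + 8 * c₁ * a * fluct N := by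
    have j1 : x * E2 ≤ x * (2 * (N * a + K * fluct N)) := by gcongr
    have j2 : x * (2 * (N * a)) = 8 * c₁ * a * fluct N := by
      simp only [x]
      field_simp
      ring
    have j3 : x * (2 * (K * fluct N)) ≤ 1 / 2 * (2 * (K * fluct N)) := by gcongr
    linarith
  linarith

/-- For a stable linear recursion `e_{j+1} = F e_j + G ζ_j` with stationary covariance `Q`, the mean
squares of `E e_j + V ζ_j` do not exceed their stationary expectation by much. -/
theorem exists_residue_complete [DecidableEq ι] [DecidableEq κ] {ν : Type*} [Fintype ν]
    (σ : ι → ℝ) {F Q : Matrix κ κ ℝ} {G : Matrix κ ι ℝ}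
    (hF : Tendsto (fun t => F ^ t) atTop (𝓝 0))
    (hQ : Q = F * Q * Fᵀ + G * Matrix.diagonal (fun i => σ i ^ 2) * Gᵀ)
    (E : Matrix ν κ ℝ) (V : Matrix ν ι ℝ) :
    ∃ C : ℝ, 0 ≤ C ∧ ∃ N₁ : ℕ, ∀ {ℱ : ℕ → MeasurableSpace Ω} {ζ : ℕ → Ω → ι → ℝ},
      IsInnovation P ℱ ζ σ → ∀ e : ℕ → Ω → κ → ℝ, (∀ j, Measurable[ℱ j] (e j)) →
      (∀ j ω, e (j + 1) ω = F *ᵥ e j ω + G *ᵥ ζ j ω) → ∀ N : ℕ, N₁ ≤ N → ∀ m ≤ N,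
      P {ω | m * ((E * Q * Eᵀ).trace + quadraticMean σ (Vᵀ * V))
            + C * fluct N * (1 + e 0 ω ⬝ᵥ e 0 ω)
          < ∑ j ∈ Finset.range m, (E *ᵥ e j ω + V *ᵥ ζ j ω) ⬝ᵥ (E *ᵥ e j ω + V *ᵥ ζ j ω)}
        ≤ ENNReal.ofReal (8 / (N : ℝ) ^ 2) := by
  -- `X` yields the crude bound `∑ |e_j|² = O(N (1 + |e_0|²))` that controls the martingale terms;
  -- `X'` yields the sharp constant, by the duality of the two Lyapunov equations.
  obtain ⟨X, hX⟩ := exists_isLyapunov hF (1 : Matrix κ κ ℝ)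
  obtain ⟨X', hX'⟩ := exists_isLyapunov hF E
  obtain ⟨k, hk, hXk⟩ := dotProduct_mulVec_le X
  obtain ⟨k', hk', hXk'⟩ := dotProduct_mulVec_le X'
  obtain ⟨c₁, hc₁, hlin⟩ := exists_linear_bound (P := P) σ (Fᵀ * (X + Xᵀ) * G)
  obtain ⟨c₂, hc₂, n₂, hquad⟩ := exists_quadratic_bound (P := P) σ (Gᵀ * X * G)
  obtain ⟨c₃, hc₃, hlin'⟩ := exists_linear_bound (P := P) σ
    (Fᵀ * (X' + X'ᵀ) * G + (2 : ℝ) • (Eᵀ * V))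
  obtain ⟨c₄, hc₄, n₄, hquad'⟩ := exists_quadratic_bound (P := P) σ (Gᵀ * X' * G + Vᵀ * V)
  have hmean : quadraticMean σ (Gᵀ * X' * G + Vᵀ * V)
      = (E * Q * Eᵀ).trace + quadraticMean σ (Vᵀ * V) := by
    rw [quadraticMean_add, hX'.quadraticMean_eq hQ]
  rw [← hmean]
  set τ := quadraticMean σ (Gᵀ * X * G)
  set τ' := quadraticMean σ (Gᵀ * X' * G + Vᵀ * V)
  set K := 2 * k + 2 * (|τ| + 2)
  have hK : 0 ≤ K := by positivity
  obtain ⟨n₅, hn₅⟩ := eventually_atTop.1 (((eventually_mul_fluct_le c₁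
    (by norm_num : (0 : ℝ) < 1 / 2)).and (eventually_mul_fluct_le c₂ one_pos)).and
    (eventually_ge_atTop 1))
  refine ⟨k' + c₃ * (1 + K) + c₄, by positivity, max n₂ (max n₄ n₅), ?_⟩
  intro ℱ ζ h e he hrec N hN m hm
  have hN2 : n₂ ≤ N := (le_max_left _ _).trans hN
  have hN4 : n₄ ≤ N := ((le_max_left _ _).trans (le_max_right _ _)).trans hN
  obtain ⟨⟨hx, hx2⟩, hN1⟩ := hn₅ N (((le_max_right _ _).trans (le_max_right _ _)).trans hN)
  have hN0 : (0 : ℝ) < N := by exact_mod_cast hN1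
  have hρ := one_le_fluct hN1
  have hall := measure_union_le_add_div (by norm_num) (by norm_num)
    (measure_union_le_add_div (by norm_num) (by norm_num)
      (measure_union_le_add_div (by norm_num) (by norm_num)
        (hlin h e he N hN1 m) (hquad h N hN2 m hm)) (hlin' h e he N hN1 m)) (hquad' h N hN4 m hm)
  norm_num only at hall
  refine (measure_mono fun ω hω => ?_).trans hall
  by_contra hcon
  simp only [Set.mem_union, Set.mem_ofPred_eq, not_or, not_lt] at hcon hω
  obtain ⟨⟨⟨h1, h2⟩, h3⟩, h4⟩ := hcon
  set D := ∑ j ∈ Finset.range m, e j ω ⬝ᵥ e j ω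
  set L := ∑ j ∈ Finset.range m, e j ω ⬝ᵥ ((Fᵀ * (X + Xᵀ) * G) *ᵥ ζ j ω)
  set L' := ∑ j ∈ Finset.range m,
    e j ω ⬝ᵥ ((Fᵀ * (X' + X'ᵀ) * G + (2 : ℝ) • (Eᵀ * V)) *ᵥ ζ j ω)
  set R := ∑ j ∈ Finset.range m, ζ j ω ⬝ᵥ ((Gᵀ * X * G) *ᵥ ζ j ω)
  set R' := ∑ j ∈ Finset.range m, ζ j ω ⬝ᵥ ((Gᵀ * X' * G + Vᵀ * V) *ᵥ ζ j ω)
  set Z := e 0 ω ⬝ᵥ e 0 ω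
  have hZ : 0 ≤ Z := dotProduct_self_nonneg_real _
  have hDsum : D + e m ω ⬝ᵥ (X *ᵥ e m ω) = e 0 ω ⬝ᵥ (X *ᵥ e 0 ω) + L + R := by
    have := hX.sum_add (e := fun j => e j ω) (z := fun j => ζ j ω) (fun j => hrec j ω)
      (0 : Matrix κ ι ℝ) m
    simpa using this
  have hTsum := hX'.sum_add (e := fun j => e j ω) (z := fun j => ζ j ω) (fun j => hrec j ω) V m
  have hD0 : 0 ≤ D := Finset.sum_nonneg fun j _ => dotProduct_self_nonneg_real _
  have hmN : (m : ℝ) ≤ N := by exact_mod_cast hm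
  have hm0 : (0 : ℝ) ≤ m := Nat.cast_nonneg m
  have hN1' : (1 : ℝ) ≤ N := by exact_mod_cast hN1
  have hDN : D / N ≤ K * (1 + Z) := by
    have i1 := le_of_abs_le h1
    have i2 := le_of_abs_le h2
    have i3 := hX.nonneg (e m ω)
    have i4 := hXk (e 0 ω)
    have i5 : m * τ ≤ N * |τ| :=
      (mul_le_mul_of_nonneg_left (le_abs_self _) hm0).trans
        (mul_le_mul_of_nonneg_right hmN (abs_nonneg _))
    have i6 : c₁ * fluct N * (1 + D / N) ≤ 1 / 2 * N * (1 + D / N) := by gcongr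
    have i7 : 1 / 2 * N * (1 + D / N) = N / 2 + D / 2 := by field_simp
    have i8 : k * Z ≤ N * (k * Z) := le_mul_of_one_le_left (by positivity) hN1'
    rw [div_le_iff₀ hN0]
    have i9 : D ≤ 2 * (N * (k * Z)) + N * (2 * (|τ| + 2)) := by linarith
    have i10 : K * (1 + Z) * N
        = 2 * (N * (k * Z)) + N * (2 * (|τ| + 2)) + (2 * k * N + 2 * (|τ| + 2) * Z * N) := by
      simp only [K]; ring
    have : 0 ≤ 2 * k * N + 2 * (|τ| + 2) * Z * N := by positivity
    linarith
  have i1 := le_of_abs_le h3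
  have i2 := le_of_abs_le h4
  have i3 := hX'.nonneg (e m ω)
  have i4 := hXk' (e 0 ω)
  have i5 : c₃ * fluct N * (1 + D / N) ≤ c₃ * fluct N * (1 + K * (1 + Z)) := by gcongr
  have i6 : c₃ * fluct N * (1 + K * (1 + Z)) ≤ c₃ * (1 + K) * fluct N * (1 + Z) := by
    have : 0 ≤ c₃ * fluct N * Z := by positivity
    linarith
  have i7 : k' * Z ≤ k' * fluct N * (1 + Z) := by
    have : k' * 1 * (0 + Z) ≤ k' * fluct N * (1 + Z) := by gcongr; norm_num
    linarith
  have i8 : c₄ * fluct N ≤ c₄ * fluct N * (1 + Z) := by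
    have : 0 ≤ c₄ * fluct N * Z := by positivity
    linarith
  have i9 : (k' + c₃ * (1 + K) + c₄) * fluct N * (1 + Z) = k' * fluct N * (1 + Z)
      + c₃ * (1 + K) * fluct N * (1 + Z) + c₄ * fluct N * (1 + Z) := by ring
  linarith

end Core

/-! ### Residues and errors as linear functions of the block noise -/

section BlockMatrices

variable {n p : ℕ} {S : LinearSystem n p} {Ω : Type*}
  {w : ℕ → Ω → Fin n → ℝ} {v : ℕ → Ω → Fin p → ℝ} {κ : Finset (Fin p)} {μ : ℕ}

/-- The matrix that maps block noise to `∑ r, (M r w(t+r) + N r v(t+r))`, where only the sensors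
outside `κ` enter. -/
def blockMat {ν : Type*} (M : Fin μ → Matrix ν (Fin n) ℝ)
    (N : Fin μ → Matrix ν {d : Fin p // d ∉ κ} ℝ) : Matrix ν (BlockIndex n κ μ) ℝ :=
  Matrix.of fun c q => Sum.elim (M q.1 c) (N q.1 c) q.2

/-- The part of an output vector that comes from the sensors outside `κ`. -/
def goodPart (κ : Finset (Fin p)) (y : Fin p → ℝ) : {d : Fin p // d ∉ κ} → ℝ := fun d => y d

theorem blockMat_mulVec_blockNoise {ν : Type*} (M : Fin μ → Matrix ν (Fin n) ℝ)
    (N : Fin μ → Matrix ν {d : Fin p // d ∉ κ} ℝ) (t : ℕ) (ω : Ω) :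
    blockMat M N *ᵥ blockNoise w v κ μ t ω
      = ∑ r : Fin μ, (M r *ᵥ w (t + r) ω + N r *ᵥ goodPart κ (v (t + r) ω)) := by
  ext c
  simp only [Matrix.mulVec, dotProduct, Finset.sum_apply, Pi.add_apply]
  rw [Fintype.sum_prod_type]
  refine Finset.sum_congr rfl fun r _ => ?_
  rw [Fintype.sum_sum_type]
  rfl

theorem blockMat_mul_diagonal_mul_transpose {ν ν' : Type*} (M : Fin μ → Matrix ν (Fin n) ℝ)
    (N : Fin μ → Matrix ν {d : Fin p // d ∉ κ} ℝ) (M' : Fin μ → Matrix ν' (Fin n) ℝ)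
    (N' : Fin μ → Matrix ν' {d : Fin p // d ∉ κ} ℝ) :
    blockMat M N * Matrix.diagonal (fun q => blockStd S κ μ q ^ 2) * (blockMat M' N')ᵀ
      = ∑ r : Fin μ, (S.σw ^ 2 • (M r * (M' r)ᵀ) + S.σv ^ 2 • (N r * (N' r)ᵀ)) := by
  ext c c'
  rw [Matrix.mul_apply]
  simp only [Matrix.mul_diagonal, Matrix.transpose_apply, Matrix.sum_apply, Matrix.add_apply,
    Matrix.smul_apply, smul_eq_mul]
  simp only [Matrix.mul_apply, Matrix.transpose_apply]
  rw [Fintype.sum_prod_type]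
  refine Finset.sum_congr rfl fun r _ => ?_
  rw [Fintype.sum_sum_type, Finset.mul_sum, Finset.mul_sum]
  congr 1
  · exact Finset.sum_congr rfl fun a _ => by
      simp only [blockMat, blockStd, scalarStd, Matrix.of_apply, Sum.elim_inl]
      ring
  · exact Finset.sum_congr rfl fun a _ => by
      simp only [blockMat, blockStd, scalarStd, Matrix.of_apply, Sum.elim_inr]
      ring

theorem mul_blockMat {ν ν' : Type*} [Fintype ν] (O : Matrix ν' ν ℝ)
    (M : Fin μ → Matrix ν (Fin n) ℝ) (N : Fin μ → Matrix ν {d : Fin p // d ∉ κ} ℝ) :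
    O * blockMat M N = blockMat (fun r => O * M r) (fun r => O * N r) := by
  ext c ⟨r, a | d⟩ <;> rfl

/-- A matrix with columns indexed by `s`, as a matrix with columns indexed by the sensors outside
`κ`: columns in `κ` are dropped, and columns outside `s` are zero. -/
noncomputable def goodCols {ν : Type*} {s : Finset (Fin p)} (κ : Finset (Fin p))
    (K : Matrix ν s ℝ) : Matrix ν {d : Fin p // d ∉ κ} ℝ :=
  Matrix.of fun c d => if h : (d : Fin p) ∈ s then K c ⟨d, h⟩ else 0

theorem sum_coe_eq_sum_ite (s : Finset (Fin p)) (f : s → ℝ) :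
    ∑ d, f d = ∑ d : Fin p, if h : d ∈ s then f ⟨d, h⟩ else 0 := by
  have h1 := Finset.sum_coe_sort s (fun d => if h : d ∈ s then f ⟨d, h⟩ else 0)
  have h2 : ∑ d : s, (if h : (d : Fin p) ∈ s then f ⟨d, h⟩ else 0) = ∑ d, f d :=
    Finset.sum_congr rfl fun d _ => by simp
  rw [← h2, h1]
  refine Finset.sum_subset (Finset.subset_univ s) fun d _ hd => ?_
  simp [hd]

theorem sum_good_eq_sum_ite (κ : Finset (Fin p)) (f : Fin p → ℝ) :
    ∑ d : {d : Fin p // d ∉ κ}, f d = ∑ d : Fin p, if d ∉ κ then f d else 0 := by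
  rw [← Finset.sum_filter]
  exact (Finset.sum_subtype _ (by simp) f).symm

/-- Splits `K y_s` into the contributions of the sensors outside and inside `κ`. -/
theorem mulVec_restrict_eq {ν : Type*} {s : Finset (Fin p)} (K : Matrix ν s ℝ) (z : Fin p → ℝ) :
    K *ᵥ restrict s z
      = goodCols κ K *ᵥ goodPart κ z + K *ᵥ restrict s (fun d => if d ∈ κ then z d else 0) := by
  ext c
  simp only [Matrix.mulVec, dotProduct, Pi.add_apply]
  rw [sum_coe_eq_sum_ite, sum_coe_eq_sum_ite]
  have h := sum_good_eq_sum_ite κ fun d => (if h : d ∈ s then K c ⟨d, h⟩ else 0) * z d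
  refine Eq.trans ?_ (congrArg (· + _) h.symm)
  rw [← Finset.sum_add_distrib]
  refine Finset.sum_congr rfl fun d _ => ?_
  by_cases h1 : d ∈ s <;> by_cases h2 : d ∈ κ <;> simp [h1, h2, restrict]

theorem goodCols_mulVec_goodPart {ν : Type*} {s : Finset (Fin p)} (hs : Disjoint s κ)
    (K : Matrix ν s ℝ) (z : Fin p → ℝ) :
    goodCols κ K *ᵥ goodPart κ z = K *ᵥ restrict s z := by
  rw [mulVec_restrict_eq (κ := κ) K z]
  have : restrict s (fun d => if d ∈ κ then z d else 0) = 0 := by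
    ext d
    simp [restrict, Finset.disjoint_left.1 hs d.2]
  rw [this, Matrix.mulVec_zero, add_zero]

theorem goodCols_mul_transpose {ν ν' : Type*} {s : Finset (Fin p)} (hs : Disjoint s κ)
    (K : Matrix ν s ℝ) (K' : Matrix ν' s ℝ) :
    goodCols κ K * (goodCols κ K')ᵀ = K * K'ᵀ := by
  ext c c'
  simp only [Matrix.mul_apply, Matrix.transpose_apply]
  rw [sum_coe_eq_sum_ite]
  refine (sum_good_eq_sum_ite κ fun d => (if h : d ∈ s then K c ⟨d, h⟩ else 0)
    * (if h : d ∈ s then K' c' ⟨d, h⟩ else 0)).trans (Finset.sum_congr rfl fun d _ => ?_)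
  by_cases h1 : d ∈ s
  · simp [h1, Finset.disjoint_left.1 hs h1]
  · simp [h1]

/-! ### The stacked outputs -/

theorem state_add (x₀ : Fin n → ℝ) (w : ℕ → Fin n → ℝ) (t a : ℕ) :
    state S x₀ w (t + a) = S.A ^ a *ᵥ state S x₀ w t
      + ∑ b ∈ Finset.range a, S.A ^ (a - 1 - b) *ᵥ w (t + b) := by
  induction a with
  | zero => simp
  | succ a ih =>
    rw [← add_assoc, state, ih, Matrix.mulVec_add, Matrix.mulVec_mulVec, ← pow_succ',
      Finset.sum_range_succ, add_assoc]
    congr 2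
    · rw [Matrix.mulVec_sum]
      refine Finset.sum_congr rfl fun b hb => ?_
      have hb := Finset.mem_range.1 hb
      rw [Matrix.mulVec_mulVec, ← pow_succ']
      congr 2
      omega
    · simp

variable (S)

/-- The matrix that maps the block noise to its contribution to the stacked outputs of `i`. -/
noncomputable def blockOut (i κ : Finset (Fin p)) :
    Matrix (Fin (obsIndex S i) × i) (BlockIndex n κ (obsIndex S i)) ℝ :=
  blockMat
    (fun r => Matrix.of fun a c =>
      if (r : ℕ) < (a.1 : ℕ) then (subC S i * S.A ^ ((a.1 : ℕ) - 1 - (r : ℕ))) a.2 c else 0)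
    (fun r => Matrix.of fun a d => if r = a.1 ∧ (d : Fin p) = a.2 then 1 else 0)

variable {S}

theorem sum_fin_ite_lt {M : Type*} [AddCommMonoid M] {μ a : ℕ} (ha : a ≤ μ) (f : ℕ → M) :
    ∑ r : Fin μ, (if (r : ℕ) < a then f r else 0) = ∑ b ∈ Finset.range a, f b := by
  rw [Fin.sum_univ_eq_sum_range (fun r => if r < a then f r else 0), ← Finset.sum_filter]
  congr 1
  ext r
  simp only [Finset.mem_filter, Finset.mem_range]
  omega

theorem blockResidue_eq {x₀ : Ω → Fin n → ℝ} {φ : ℕ → Ω → Fin p → ℝ} {i : Finset (Fin p)}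
    (hi : Disjoint i κ) (hφ : ∀ t ω, ∀ d ∉ κ, φ t ω d = 0) (xhat : ℕ → Fin n → ℝ) (t : ℕ) (ω : Ω) :
    blockResidue S i (outputPath S x₀ w v φ ω) xhat t
      = obsMat S i *ᵥ (statePath S x₀ w ω t - xhat t)
        + blockOut S i κ *ᵥ blockNoise w v κ (obsIndex S i) t ω := by
  rw [blockOut, blockMat_mulVec_blockNoise, Matrix.mulVec_sub]
  ext ⟨a, d⟩
  have hd : (d : Fin p) ∉ κ := Finset.disjoint_left.1 hi d.2
  have h1 : ∀ x, (obsMat S i *ᵥ x) (a, d) = (subC S i *ᵥ (S.A ^ (a : ℕ) *ᵥ x)) d :=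
    fun x => obsMatrix_mulVec i _ x (a, d)
  have h2 : outputPath S x₀ w v φ ω (t + a) d
      = (subC S i *ᵥ statePath S x₀ w ω (t + a)) d + v (t + a) ω d := by
    simp only [outputPath, output, Pi.add_apply, hφ _ _ _ hd, add_zero]
    rfl
  have h3 : statePath S x₀ w ω (t + a) = S.A ^ (a : ℕ) *ᵥ statePath S x₀ w ω t
      + ∑ b ∈ Finset.range a, S.A ^ ((a : ℕ) - 1 - b) *ᵥ w (t + b) ω := state_add _ _ _ _
  have h4 : ∑ r : Fin (obsIndex S i), ((Matrix.of fun (q : Fin (obsIndex S i) × i) c =>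
      if (r : ℕ) < (q.1 : ℕ) then (subC S i * S.A ^ ((q.1 : ℕ) - 1 - (r : ℕ))) q.2 c else 0)
        *ᵥ w (t + r) ω) (a, d)
      = ∑ b ∈ Finset.range a, (subC S i *ᵥ (S.A ^ ((a : ℕ) - 1 - b) *ᵥ w (t + b) ω)) d := by
    rw [← sum_fin_ite_lt a.2.le]
    refine Finset.sum_congr rfl fun r _ => ?_
    split_ifs with h
    · rw [Matrix.mulVec_mulVec]
      simp only [Matrix.mulVec, dotProduct, Matrix.of_apply, h, if_true]
    · simp only [Matrix.mulVec, dotProduct, Matrix.of_apply, h, if_false, zero_mul,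
        Finset.sum_const_zero]
  have h5 : ∑ r : Fin (obsIndex S i), ((Matrix.of fun (q : Fin (obsIndex S i) × i)
      (d : {d : Fin p // d ∉ κ}) => if r = q.1 ∧ (d : Fin p) = q.2 then (1 : ℝ) else 0)
        *ᵥ goodPart κ (v (t + r) ω)) (a, d) = v (t + a) ω d := by
    rw [Finset.sum_eq_single a]
    · simp only [Matrix.mulVec, dotProduct, Matrix.of_apply, true_and]
      rw [Finset.sum_eq_single (⟨d, hd⟩ : {d : Fin p // d ∉ κ})]
      · simp [goodPart]
      · intro g _ hg
        rw [if_neg (fun h => hg (Subtype.ext h)), zero_mul]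
      · simp
    · intro r _ hr
      simp [Matrix.mulVec, dotProduct, hr]
    · simp
  simp only [blockResidue, Pi.add_apply, Pi.sub_apply, Finset.sum_apply, Finset.sum_add_distrib]
  rw [h4, h5, h2, h3, h1, h1, Matrix.mulVec_add, Matrix.mulVec_sum, Pi.add_apply,
    Finset.sum_apply]
  ring

theorem obsIndex_spec {i : Finset (Fin p)} (h : IsObservable S i) :
    0 < obsIndex S i ∧ (obsMatrix S i (obsIndex S i)).rank = n :=
  Nat.sInf_mem (s := {μ : ℕ | 0 < μ ∧ (obsMatrix S i μ).rank = n}) h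

theorem obsPinv_mul_obsMat {i : Finset (Fin p)} (h : IsObservable S i) :
    obsPinv S i * obsMat S i = 1 := by
  rw [obsPinv, Matrix.mul_assoc]
  refine Matrix.nonsing_inv_mul _ ?_
  rw [← Matrix.isUnit_iff_isUnit_det, ← Matrix.mulVec_injective_iff_isUnit]
  intro x y hxy
  rw [← sub_eq_zero] at hxy ⊢
  rw [← Matrix.mulVec_sub] at hxy
  refine eq_zero_of_rank_eq (obsIndex_spec h).2 ?_
  have h1 : (obsMat S i *ᵥ (x - y)) ⬝ᵥ (obsMat S i *ᵥ (x - y)) = 0 := by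
    rw [mulVec_dotProduct_mulVec, hxy, dotProduct_zero]
  exact dotProduct_self_eq_zero.1 h1

/-- The normalized residue is the estimation error plus a linear function of the block noise. -/
theorem trace_residue_eq {x₀ : Ω → Fin n → ℝ} {φ : ℕ → Ω → Fin p → ℝ} {i : Finset (Fin p)}
    (hobs : IsObservable S i) (hi : Disjoint i κ) (hφ : ∀ t ω, ∀ d ∉ κ, φ t ω d = 0)
    (xhat : ℕ → Fin n → ℝ) (t : ℕ) (ω : Ω) :
    (obsPinv S i * vecMulVec (blockResidue S i (outputPath S x₀ w v φ ω) xhat t)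
        (blockResidue S i (outputPath S x₀ w v φ ω) xhat t) * (obsPinv S i)ᵀ).trace
      = (statePath S x₀ w ω t - xhat t
          + (obsPinv S i * blockOut S i κ) *ᵥ blockNoise w v κ (obsIndex S i) t ω)
        ⬝ᵥ (statePath S x₀ w ω t - xhat t
          + (obsPinv S i * blockOut S i κ) *ᵥ blockNoise w v κ (obsIndex S i) t ω) := by
  rw [Matrix.mul_vecMulVec, Matrix.vecMulVec_mul, Matrix.vecMul_transpose, Matrix.trace_vecMulVec,
    blockResidue_eq hi hφ, Matrix.mulVec_add, Matrix.mulVec_mulVec, Matrix.mulVec_mulVec,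
    obsPinv_mul_obsMat hobs, Matrix.one_mulVec]

theorem blockOut_cov {i : Finset (Fin p)} (hi : Disjoint i κ) :
    blockOut S i κ * Matrix.diagonal (fun q => blockStd S κ (obsIndex S i) q ^ 2)
      * (blockOut S i κ)ᵀ = blockNoiseCov S i := by
  rw [blockOut, blockMat_mul_diagonal_mul_transpose, Finset.sum_add_distrib, ← Finset.smul_sum,
    ← Finset.smul_sum, blockNoiseCov]
  congr 2
  · ext ⟨a, d⟩ ⟨a', d'⟩
    rw [Matrix.sum_apply, Finset.sum_congr rfl fun r _ => Matrix.mul_apply, Matrix.mul_apply,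
      Fintype.sum_prod_type]
    simp only [Matrix.transpose_apply, Matrix.of_apply, noiseToOutput]
    rw [Fin.sum_univ_eq_sum_range (fun r => ∑ c,
        (if r < (a : ℕ) then (subC S i * S.A ^ ((a : ℕ) - 1 - r)) d c else 0)
        * (if r < (a' : ℕ) then (subC S i * S.A ^ ((a' : ℕ) - 1 - r)) d' c else 0)),
      Fin.sum_univ_eq_sum_range (fun r => ∑ c,
        (if r < (a : ℕ) then (subC S i * S.A ^ ((a : ℕ) - 1 - r)) d c else 0)
        * (if r < (a' : ℕ) then (subC S i * S.A ^ ((a' : ℕ) - 1 - r)) d' c else 0))]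
    refine (Finset.sum_subset (Finset.range_subset_range.2 (Nat.sub_le _ _))
      fun r hr hr' => ?_).symm
    have h1 : ¬ r < (a : ℕ) := by
      have := a.2
      simp only [Finset.mem_range] at hr hr'
      omega
    simp [h1]
  · ext ⟨a, d⟩ ⟨a', d'⟩
    have hd : (d : Fin p) ∉ κ := Finset.disjoint_left.1 hi d.2
    simp only [Matrix.sum_apply, Matrix.mul_apply, Matrix.transpose_apply, Matrix.of_apply]
    rw [Finset.sum_eq_single a]
    · rw [Finset.sum_eq_single (⟨d, hd⟩ : {d : Fin p // d ∉ κ})]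
      · simp only [and_self, if_true, one_mul, Matrix.one_apply, Prod.mk.injEq, Subtype.ext_iff]
      · intro g _ hg
        rw [if_neg (fun h => hg (Subtype.ext h.2)), zero_mul]
      · simp
    · intro r _ hr
      simp [hr]
    · simp

variable (S) in
/-- The matrix that maps the block noise to `-K v_s` at the first time step of the block, without
the sensors in `κ`: the contribution of the current measurement noise to the filtering error. -/
noncomputable def gainOut {s : Finset (Fin p)} (κ : Finset (Fin p)) (μ : ℕ)
    (K : Matrix (Fin n) s ℝ) : Matrix (Fin n) (BlockIndex n κ μ) ℝ :=
  blockMat (fun _ => 0) (fun r => if (r : ℕ) = 0 then -goodCols κ K else 0)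

theorem sum_fin_ite_zero {M : Type*} [AddCommMonoid M] {μ : ℕ} (hμ : 0 < μ) (f : Fin μ → M) :
    ∑ r : Fin μ, (if (r : ℕ) = 0 then f r else 0) = f ⟨0, hμ⟩ := by
  rw [Finset.sum_eq_single ⟨0, hμ⟩]
  · simp
  · intro r _ hr
    rw [if_neg fun h => hr (Fin.ext h)]
  · simp

theorem gainOut_mulVec {s : Finset (Fin p)} (hμ : 0 < μ) (K : Matrix (Fin n) s ℝ) (t : ℕ)
    (ω : Ω) : gainOut κ μ K *ᵥ blockNoise w v κ μ t ω
      = -(goodCols κ K *ᵥ goodPart κ (v t ω)) := by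
  rw [gainOut, blockMat_mulVec_blockNoise]
  have : ∀ r : Fin μ, (0 : Matrix (Fin n) (Fin n) ℝ) *ᵥ w (t + r) ω
      + (if (r : ℕ) = 0 then -goodCols κ K else 0) *ᵥ goodPart κ (v (t + r) ω)
      = if (r : ℕ) = 0 then -(goodCols κ K *ᵥ goodPart κ (v (t + r) ω)) else 0 := by
    intro r
    split_ifs <;> simp [Matrix.neg_mulVec]
  rw [Finset.sum_congr rfl fun r _ => this r, sum_fin_ite_zero hμ]
  rfl

theorem quadraticMean_gainOut_self {s : Finset (Fin p)} (hμ : 0 < μ) (hs : Disjoint s κ)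
    (K : Matrix (Fin n) s ℝ) :
    quadraticMean (blockStd S κ μ) ((gainOut κ μ K)ᵀ * gainOut κ μ K)
      = (S.σv ^ 2 • (K * Kᵀ)).trace := by
  rw [← trace_mul_diagonal_mul_transpose, gainOut, blockMat_mul_diagonal_mul_transpose]
  have : ∀ r : Fin μ, S.σw ^ 2 • ((0 : Matrix (Fin n) (Fin n) ℝ) * (0 : Matrix (Fin n) (Fin n) ℝ)ᵀ)
      + S.σv ^ 2 • ((if (r : ℕ) = 0 then -goodCols κ K else 0)
        * (if (r : ℕ) = 0 then -goodCols κ K else 0)ᵀ)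
      = if (r : ℕ) = 0 then S.σv ^ 2 • (K * Kᵀ) else 0 := by
    intro r
    split_ifs
    · simp [goodCols_mul_transpose hs]
    · simp
  rw [Finset.sum_congr rfl fun r _ => this r, sum_fin_ite_zero hμ]

theorem quadraticMean_blockOut {i : Finset (Fin p)} (hi : Disjoint i κ) :
    quadraticMean (blockStd S κ (obsIndex S i))
        ((obsPinv S i * blockOut S i κ)ᵀ * (obsPinv S i * blockOut S i κ))
      = (obsPinv S i * blockNoiseCov S i * (obsPinv S i)ᵀ).trace := by
  rw [← trace_mul_diagonal_mul_transpose, ← blockOut_cov hi, Matrix.transpose_mul]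
  simp only [Matrix.mul_assoc]

/-- The correlation of the filtering error with the residue noise is the correction term of the
filtering test. -/
theorem quadraticMean_gainOut_blockOut {s i : Finset (Fin p)} (hobs : IsObservable S i)
    (his : i ⊆ s) (hi : Disjoint i κ) :
    quadraticMean (blockStd S κ (obsIndex S i))
        ((gainOut κ (obsIndex S i) (filterGain S s))ᵀ * (obsPinv S i * blockOut S i κ))
      = -gainCorrection S s i his := by
  have hμ := (obsIndex_spec hobs).1
  set μ := obsIndex S i with hμdef
  let R : Matrix i (Fin μ × i) ℝ := Matrix.of fun d a => if (a.1 : ℕ) = 0 ∧ d = a.2 then 1 else 0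
  let L : Matrix (Fin n) i ℝ := (filterGain S s).submatrix id (fun d : i => (⟨d, his d.2⟩ : s))
  have hR : ∀ u : Fin μ × i → ℝ,
      R *ᵥ u = fun d : i => ∑ a : Fin μ, if (a : ℕ) = 0 then u (a, d) else 0 := by
    intro u
    ext d
    simp only [Matrix.mulVec, dotProduct, R, Matrix.of_apply]
    rw [Fintype.sum_prod_type]
    refine Finset.sum_congr rfl fun a _ => ?_
    split_ifs with ha
    · simp [ha]
    · simp [ha]
  have h1 : gainCorrection S s i his = quadraticMean (fun _ => S.σv) ((L * R)ᵀ * obsPinv S i) := by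
    rw [← integral_quadratic]
    refine integral_congr_ae (ae_of_all _ fun u => ?_)
    simp only
    rw [← mulVec_dotProduct_mulVec, ← Matrix.mulVec_mulVec, hR]
  have h2 : goodCols κ (filterGain S s) * (Matrix.of fun (q : Fin μ × i)
      (d : {d : Fin p // d ∉ κ}) => if (⟨0, hμ⟩ : Fin μ) = q.1 ∧ (d : Fin p) = q.2
        then (1 : ℝ) else 0)ᵀ = L * R := by
    ext c ⟨a, d⟩
    have hd : (d : Fin p) ∉ κ := Finset.disjoint_left.1 hi d.2
    simp only [Matrix.mul_apply, Matrix.transpose_apply, Matrix.of_apply, R, L,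
      Matrix.submatrix_apply, id]
    rw [Finset.sum_eq_single (⟨d, hd⟩ : {d : Fin p // d ∉ κ}), Finset.sum_eq_single d]
    · have : (⟨0, hμ⟩ : Fin μ) = a ↔ (a : ℕ) = 0 := by
        rw [Fin.ext_iff]
        exact eq_comm
      simp [goodCols, his d.2, this]
    · intro d' _ hd'
      rw [if_neg (fun h => hd' h.2), mul_zero]
    · simp
    · intro g _ hg
      rw [if_neg (fun h => hg (Subtype.ext h.2)), mul_zero]
    · simp
  have h3 : ∀ r : Fin μ, S.σw ^ 2 • ((0 : Matrix (Fin n) (Fin n) ℝ) *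
        (obsPinv S i * (Matrix.of fun (q : Fin μ × i) c =>
          if (r : ℕ) < (q.1 : ℕ) then (subC S i * S.A ^ ((q.1 : ℕ) - 1 - (r : ℕ))) q.2 c else 0))ᵀ)
      + S.σv ^ 2 • ((if (r : ℕ) = 0 then -goodCols κ (filterGain S s) else 0)
        * (obsPinv S i * (Matrix.of fun (q : Fin μ × i) (d : {d : Fin p // d ∉ κ}) =>
          if r = q.1 ∧ (d : Fin p) = q.2 then (1 : ℝ) else 0))ᵀ)
      = if (r : ℕ) = 0 then -(S.σv ^ 2 • (goodCols κ (filterGain S s)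
        * (Matrix.of fun (q : Fin μ × i) (d : {d : Fin p // d ∉ κ}) =>
          if r = q.1 ∧ (d : Fin p) = q.2 then (1 : ℝ) else 0)ᵀ * (obsPinv S i)ᵀ)) else 0 := by
    intro r
    split_ifs
    · rw [Matrix.zero_mul, smul_zero, zero_add, Matrix.neg_mul, smul_neg, Matrix.transpose_mul,
        Matrix.mul_assoc]
    · simp
  rw [← trace_mul_diagonal_mul_transpose, gainOut, blockOut, mul_blockMat,
    blockMat_mul_diagonal_mul_transpose, Finset.sum_congr rfl fun r _ => h3 r, sum_fin_ite_zero hμ,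
    h2, Matrix.trace_neg, h1, ← trace_mul_diagonal_mul_transpose]
  congr 2
  rw [← Matrix.smul_one_eq_diagonal]
  simp

/-! ### The error of a filter that uses no attacked sensor -/

theorem filterPrior_eq (s : Finset (Fin p)) (ξ : Fin n → ℝ) (y : ℕ → Fin p → ℝ) (t : ℕ) :
    filterPrior S s ξ y t = predictor S s ξ y t := by
  induction t with
  | zero => rfl
  | succ t ih =>
    rw [filterPrior, predictor, ih, measUpdate, Matrix.mulVec_add, Matrix.mulVec_mulVec,
      A_mul_filterGain]

theorem restrict_outputPath {x₀ : Ω → Fin n → ℝ} {φ : ℕ → Ω → Fin p → ℝ} (s : Finset (Fin p))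
    (ω : Ω) (t : ℕ) :
    restrict s (outputPath S x₀ w v φ ω t)
      = subC S s *ᵥ statePath S x₀ w ω t + restrict s (v t ω) + restrict s (φ t ω) := rfl

theorem restrict_attack_eq_zero {φ : ℕ → Ω → Fin p → ℝ} {s : Finset (Fin p)} (hs : Disjoint s κ)
    (hφ : ∀ t ω, ∀ d ∉ κ, φ t ω d = 0) (t : ℕ) (ω : Ω) : restrict s (φ t ω) = 0 := by
  ext d
  exact hφ t ω d (Finset.disjoint_left.1 hs d.2)

/-- The prediction error `x - x̂`. -/
noncomputable def predError (S : LinearSystem n p) (x₀ : Ω → Fin n → ℝ) (w : ℕ → Ω → Fin n → ℝ)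
    (v φ : ℕ → Ω → Fin p → ℝ) (s : Finset (Fin p)) (ξ : Fin n → ℝ) (t : ℕ) (ω : Ω) : Fin n → ℝ :=
  statePath S x₀ w ω t - predictor S s ξ (outputPath S x₀ w v φ ω) t

variable {x₀ : Ω → Fin n → ℝ} {φ : ℕ → Ω → Fin p → ℝ} {s : Finset (Fin p)} {ξ : Fin n → ℝ}

theorem predError_succ (hs : Disjoint s κ) (hφ : ∀ t ω, ∀ d ∉ κ, φ t ω d = 0) (t : ℕ) (ω : Ω) :
    predError S x₀ w v φ s ξ (t + 1) ω
      = closedLoop S s (predictorGain S s) *ᵥ predError S x₀ w v φ s ξ t ω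
        + (w t ω - predictorGain S s *ᵥ restrict s (v t ω)) := by
  have h1 : statePath S x₀ w ω (t + 1) = S.A *ᵥ statePath S x₀ w ω t + w t ω := rfl
  rw [predError, predError, h1, predictor, restrict_outputPath, restrict_attack_eq_zero hs hφ,
    closedLoop]
  simp only [Matrix.mulVec_add, Matrix.mulVec_sub, Matrix.sub_mulVec, Matrix.mulVec_mulVec,
    add_zero]
  abel

theorem predError_add (hs : Disjoint s κ) (hφ : ∀ t ω, ∀ d ∉ κ, φ t ω d = 0) (t a : ℕ) (ω : Ω) :
    predError S x₀ w v φ s ξ (t + a) ω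
      = closedLoop S s (predictorGain S s) ^ a *ᵥ predError S x₀ w v φ s ξ t ω
        + ∑ b ∈ Finset.range a, closedLoop S s (predictorGain S s) ^ (a - 1 - b) *ᵥ
          (w (t + b) ω - predictorGain S s *ᵥ restrict s (v (t + b) ω)) := by
  induction a with
  | zero => simp
  | succ a ih =>
    rw [← add_assoc, predError_succ hs hφ, ih, Matrix.mulVec_add, Matrix.mulVec_mulVec, ← pow_succ',
      Finset.sum_range_succ, add_assoc]
    congr 2
    · rw [Matrix.mulVec_sum]
      refine Finset.sum_congr rfl fun b hb => ?_
      have hb := Finset.mem_range.1 hb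
      rw [Matrix.mulVec_mulVec, ← pow_succ']
      congr 2
      omega
    · simp

variable (S s) in
/-- The matrix that maps the noise of `μ` time steps to its contribution to the prediction error
after these steps. -/
noncomputable def errorBlock (κ : Finset (Fin p)) (μ : ℕ) : Matrix (Fin n) (BlockIndex n κ μ) ℝ :=
  blockMat (fun r => closedLoop S s (predictorGain S s) ^ (μ - 1 - (r : ℕ)))
    (fun r => -(closedLoop S s (predictorGain S s) ^ (μ - 1 - (r : ℕ))
      * goodCols κ (predictorGain S s)))

theorem predError_add_block (hs : Disjoint s κ) (hφ : ∀ t ω, ∀ d ∉ κ, φ t ω d = 0) (t μ : ℕ)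
    (ω : Ω) : predError S x₀ w v φ s ξ (t + μ) ω
      = closedLoop S s (predictorGain S s) ^ μ *ᵥ predError S x₀ w v φ s ξ t ω
        + errorBlock S s κ μ *ᵥ blockNoise w v κ μ t ω := by
  rw [predError_add hs hφ, errorBlock, blockMat_mulVec_blockNoise]
  congr 1
  rw [← Fin.sum_univ_eq_sum_range (fun b => closedLoop S s (predictorGain S s) ^ (μ - 1 - b) *ᵥ
          (w (t + b) ω - predictorGain S s *ᵥ restrict s (v (t + b) ω)))]
  refine Finset.sum_congr rfl fun r _ => ?_
  rw [Matrix.neg_mulVec, ← Matrix.mulVec_mulVec, goodCols_mulVec_goodPart hs, Matrix.mulVec_sub,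
    sub_eq_add_neg]

theorem steadyCov_eq_block (h : IsSteady S s (steadyCov S s)) (hs : Disjoint s κ) (μ : ℕ) :
    steadyCov S s = closedLoop S s (predictorGain S s) ^ μ * steadyCov S s
        * (closedLoop S s (predictorGain S s) ^ μ)ᵀ
      + errorBlock S s κ μ * Matrix.diagonal (fun q => blockStd S κ μ q ^ 2)
        * (errorBlock S s κ μ)ᵀ := by
  rw [errorBlock, blockMat_mul_diagonal_mul_transpose]
  set F := closedLoop S s (predictorGain S s) with hF
  have h1 : steadyCov S s = F * steadyCov S s * Fᵀ + gainNoiseCov S s (predictorGain S s) :=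
    h.lyapunov
  have h2 : ∀ r : Fin μ, S.σw ^ 2 • (F ^ (μ - 1 - (r : ℕ)) * (F ^ (μ - 1 - (r : ℕ)))ᵀ)
      + S.σv ^ 2 • (-(F ^ (μ - 1 - (r : ℕ)) * goodCols κ (predictorGain S s))
        * (-(F ^ (μ - 1 - (r : ℕ)) * goodCols κ (predictorGain S s)))ᵀ)
      = F ^ (μ - 1 - (r : ℕ)) * gainNoiseCov S s (predictorGain S s)
        * (F ^ (μ - 1 - (r : ℕ)))ᵀ := by
    intro r
    rw [gainNoiseCov, ← goodCols_mul_transpose hs]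
    simp only [Matrix.transpose_neg, Matrix.transpose_mul, Matrix.neg_mul, Matrix.mul_neg, neg_neg,
      Matrix.mul_add, Matrix.add_mul, Matrix.mul_smul, Matrix.smul_mul, Matrix.mul_one,
      Matrix.mul_assoc]
  rw [Finset.sum_congr rfl fun r _ => h2 r, Fin.sum_univ_eq_sum_range (fun r => F ^ (μ - 1 - r)
    * gainNoiseCov S s (predictorGain S s) * (F ^ (μ - 1 - r))ᵀ),
    Finset.sum_range_reflect (fun r => F ^ r * gainNoiseCov S s (predictorGain S s) * (F ^ r)ᵀ)]
  clear h2
  induction μ with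
  | zero => simp
  | succ μ ih =>
    rw [Finset.sum_range_succ]
    nth_rw 1 [ih]
    nth_rw 1 [h1]
    rw [pow_succ]
    simp only [Matrix.transpose_mul, Matrix.mul_add, Matrix.add_mul, Matrix.mul_assoc]
    abel

/-- The filtering error of a filter without attacked sensors. -/
theorem filterError_eq (hs : Disjoint s κ) (hφ : ∀ t ω, ∀ d ∉ κ, φ t ω d = 0) (hμ : 0 < μ)
    (t : ℕ) (ω : Ω) :
    statePath S x₀ w ω t - filterEst S s ξ (outputPath S x₀ w v φ ω) t
      = (1 - filterGain S s * subC S s) *ᵥ predError S x₀ w v φ s ξ t ω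
        + gainOut κ μ (filterGain S s) *ᵥ blockNoise w v κ μ t ω := by
  rw [gainOut_mulVec hμ, goodCols_mulVec_goodPart hs, filterEst, measUpdate, filterPrior_eq,
    predError, restrict_outputPath, restrict_attack_eq_zero hs hφ]
  simp only [Matrix.mulVec_add, Matrix.mulVec_sub, Matrix.sub_mulVec, Matrix.mulVec_mulVec,
    add_zero, Matrix.one_mulVec]
  abel

/-- The filtering error minus the contribution of the current noise in the good sensors. -/
theorem filterError_sub_gainOut (hμ : 0 < μ) (t : ℕ) (ω : Ω) :
    statePath S x₀ w ω t - filterEst S s ξ (outputPath S x₀ w v φ ω) t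
        - gainOut κ μ (filterGain S s) *ᵥ blockNoise w v κ μ t ω
      = (1 - filterGain S s * subC S s) *ᵥ predError S x₀ w v φ s ξ t ω
        - filterGain S s *ᵥ restrict s (fun d => if d ∈ κ then v t ω d else 0)
        - filterGain S s *ᵥ restrict s (φ t ω) := by
  have h := mulVec_restrict_eq (κ := κ) (filterGain S s) (v t ω)
  rw [gainOut_mulVec hμ, filterEst, measUpdate, filterPrior_eq, predError, restrict_outputPath]
  simp only [Matrix.mulVec_add, Matrix.mulVec_sub, Matrix.sub_mulVec, Matrix.mulVec_mulVec,
    Matrix.one_mulVec]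
  rw [h]
  abel

end BlockMatrices

/-! ### The groups of a window -/

section Groups

variable {t₁ N μ l : ℕ}

/-- The members of `G_l` are `t₁ + l + j μ` with `l + j μ < N`; there are `⌈(N - l) / μ⌉` of them,
which is also correct for `N ≤ l`, where the truncated difference vanishes. -/
theorem group_eq_image (hl : l < μ) : group t₁ N μ l
    = (Finset.range ((N - l + μ - 1) / μ)).image fun j => t₁ + l + j * μ := by
  have hμ : 0 < μ := by omega
  ext t
  simp only [group, Finset.mem_filter, Finset.mem_Ico, Finset.mem_image, Finset.mem_range]
  have key : ∀ j, j < (N - l + μ - 1) / μ ↔ l + j * μ < N := by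
    intro j
    rw [Nat.lt_iff_add_one_le, Nat.le_div_iff_mul_le hμ, add_mul]
    omega
  constructor
  · rintro ⟨⟨h1, h2⟩, h3⟩
    have h4 := Nat.mod_add_div (t - t₁) μ
    rw [h3, mul_comm] at h4
    exact ⟨(t - t₁) / μ, (key _).2 (by omega), by omega⟩
  · rintro ⟨j, hj, rfl⟩
    have := (key j).1 hj
    refine ⟨⟨by omega, by omega⟩, ?_⟩
    rw [show t₁ + l + j * μ - t₁ = l + j * μ by omega, Nat.add_mul_mod_self_right,
      Nat.mod_eq_of_lt hl]

theorem injective_group_index (hl : l < μ) : Function.Injective fun j => t₁ + l + j * μ := by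
  intro j j' h
  have h1 : j * μ = j' * μ := Nat.add_left_cancel h
  exact Nat.eq_of_mul_eq_mul_right (by omega) h1

theorem card_group (hl : l < μ) : (group t₁ N μ l).card = (N - l + μ - 1) / μ := by
  rw [group_eq_image hl, Finset.card_image_of_injective _ (injective_group_index hl),
    Finset.card_range]

theorem sum_group (hl : l < μ) (f : ℕ → ℝ) : ∑ t ∈ group t₁ N μ l, f t
    = ∑ j ∈ Finset.range (group t₁ N μ l).card, f (t₁ + l + j * μ) := by
  rw [card_group hl, group_eq_image hl,
    Finset.sum_image fun _ _ _ _ h => injective_group_index hl h]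

theorem card_group_le : (group t₁ N μ l).card ≤ N :=
  (Finset.card_filter_le _ _).trans (by simp)

theorem le_card_group (hl : l < μ) (hN : 2 * μ ≤ N) :
    N ≤ 2 * μ * (group t₁ N μ l).card := by
  rw [card_group hl]
  have h := Nat.div_add_mod (N - l + μ - 1) μ
  have h' := Nat.mod_lt (N - l + μ - 1) (show 0 < μ by omega)
  rw [mul_assoc]
  omega

theorem sum_window {M : Type*} [AddCommMonoid M] (hμ : 0 < μ) (f : ℕ → M) :
    ∑ t ∈ Finset.Ico t₁ (t₁ + N), f t = ∑ l ∈ Finset.range μ, ∑ t ∈ group t₁ N μ l, f t :=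
  (Finset.sum_fiberwise_of_maps_to
    (fun t _ => Finset.mem_range.2 (Nat.mod_lt (t - t₁) hμ)) f).symm

theorem sum_card_group (hμ : 0 < μ) :
    ∑ l ∈ Finset.range μ, ((group t₁ N μ l).card : ℝ) = N := by
  have h := sum_window (t₁ := t₁) (N := N) hμ fun _ => (1 : ℝ)
  simpa using h.symm

end Groups

/-! ### The residue test on a window -/

section Window

variable {n p : ℕ} {S : LinearSystem n p} {Ω : Type*}
  {x₀ : Ω → Fin n → ℝ} {w : ℕ → Ω → Fin n → ℝ} {v : ℕ → Ω → Fin p → ℝ} {κ : Finset (Fin p)}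

theorem residueAvg_eq {φ : ℕ → Ω → Fin p → ℝ} {i : Finset (Fin p)}
    (hobs : IsObservable S i) (hi : Disjoint i κ) (hφ : ∀ t ω, ∀ d ∉ κ, φ t ω d = 0)
    (xhat : ℕ → Fin n → ℝ) {t₁ N l : ℕ} (hl : l < obsIndex S i) (ω : Ω) :
    residueAvg S i (outputPath S x₀ w v φ ω) xhat t₁ N l
      = (∑ j ∈ Finset.range (group t₁ N (obsIndex S i) l).card,
          (statePath S x₀ w ω (t₁ + l + j * obsIndex S i) - xhat (t₁ + l + j * obsIndex S i)
            + (obsPinv S i * blockOut S i κ) *ᵥ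
              blockNoise w v κ (obsIndex S i) (t₁ + l + j * obsIndex S i) ω)
          ⬝ᵥ (statePath S x₀ w ω (t₁ + l + j * obsIndex S i) - xhat (t₁ + l + j * obsIndex S i)
            + (obsPinv S i * blockOut S i κ) *ᵥ
              blockNoise w v κ (obsIndex S i) (t₁ + l + j * obsIndex S i) ω))
        / (group t₁ N (obsIndex S i) l).card := by
  rw [residueAvg, one_div_mul_eq_div, sum_group hl]
  congr 1
  exact Finset.sum_congr rfl fun j _ => trace_residue_eq hobs hi hφ xhat _ ω

variable [MeasurableSpace Ω] {P : Measure Ω}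

theorem measure_biUnion_range_le {A : ℕ → Set Ω} {μ N : ℕ} {c : ℝ}
    (h : ∀ l < μ, P (A l) ≤ ENNReal.ofReal (c / (N : ℝ) ^ 2)) :
    P (⋃ l ∈ Finset.range μ, A l) ≤ ENNReal.ofReal (μ * c / (N : ℝ) ^ 2) := by
  refine (measure_biUnion_finset_le _ _).trans ((Finset.sum_le_sum fun l hl =>
    h l (Finset.mem_range.1 hl)).trans_eq ?_)
  rw [Finset.sum_const, Finset.card_range, ← ENNReal.ofReal_nsmul, nsmul_eq_mul, mul_div_assoc]

/-- If the residues of `i` pass the test, the estimate is good: no attack that sees only the past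
and the noise `B ζ` can make the estimation error large without being noticed. -/
theorem exists_window_sound [IsProbabilityMeasure P] (hn : IsNoise S P x₀ w v)
    {i : Finset (Fin p)} (hobs : IsObservable S i) (hi : Disjoint i κ)
    (B : Matrix (Fin n) (BlockIndex n κ (obsIndex S i)) ℝ) (opt H : ℝ) :
    ∃ C : ℝ, 0 ≤ C ∧ ∃ N₁ : ℕ, ∀ (φ : ℕ → Ω → Fin p → ℝ) (ℱ : ℕ → MeasurableSpace Ω),
      (∀ t ω, ∀ d ∉ κ, φ t ω d = 0) → IsPast P x₀ w v φ κ ℱ → ∀ xhat : Ω → ℕ → Fin n → ℝ,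
      (∀ t, Measurable[ℱ t] fun ω => statePath S x₀ w ω t - xhat ω t
        - B *ᵥ blockNoise w v κ (obsIndex S i) t ω) → ∀ N ≥ N₁, ∀ t₁ : ℕ,
      P {ω | ∃ η ≤ H, (∀ l < obsIndex S i,
            residueAvg S i (outputPath S x₀ w v φ ω) (xhat ω) t₁ N l
              ≤ opt + quadraticMean (blockStd S κ (obsIndex S i))
                ((obsPinv S i * blockOut S i κ)ᵀ * (obsPinv S i * blockOut S i κ)
                  + (2 : ℝ) • (Bᵀ * (obsPinv S i * blockOut S i κ))) + η) ∧
          opt + η + C * (fluct N / N) < avgSqError (statePath S x₀ w ω) (xhat ω) t₁ N}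
        ≤ ENNReal.ofReal (C / (N : ℝ) ^ 2) := by
  have hμ := (obsIndex_spec hobs).1
  set U := obsPinv S i * blockOut S i κ with hU
  obtain ⟨C₀, hC₀, N₀, hN₀⟩ := exists_residue_sound (P := P) (blockStd S κ (obsIndex S i)) B U opt H
  refine ⟨obsIndex S i * C₀ + obsIndex S i * 6, by positivity, max N₀ (2 * obsIndex S i),
    fun φ ℱ hφ hF xhat hx N hN t₁ => ?_⟩
  have hN1 : N₀ ≤ N := (le_max_left _ _).trans hN
  have hN2 : 2 * obsIndex S i ≤ N := (le_max_right _ _).trans hN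
  have hNpos : (0 : ℝ) < N := by exact_mod_cast (show 0 < N by omega)
  have hfl : 0 ≤ fluct N := zero_le_one.trans (one_le_fluct (by omega))
  have key := fun l (hl : l < obsIndex S i) => hN₀ (hF.isInnovation hn (obsIndex S i) (t₁ + l))
    (fun j ω => statePath S x₀ w ω (t₁ + l + j * obsIndex S i)
      - xhat ω (t₁ + l + j * obsIndex S i))
    (fun j => hx _) N hN1 (group t₁ N (obsIndex S i) l).card card_group_le
  refine ((measure_mono fun ω hω => ?_).trans
    (measure_biUnion_range_le key)).trans (ENNReal.ofReal_le_ofReal ?_)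
  · obtain ⟨η, hη, h1, h2⟩ := hω
    by_contra hcon
    simp only [Set.mem_iUnion, Finset.mem_range, not_exists] at hcon
    have h3 : ∀ l ∈ Finset.range (obsIndex S i), ∑ t ∈ group t₁ N (obsIndex S i) l,
        (statePath S x₀ w ω t - xhat ω t) ⬝ᵥ (statePath S x₀ w ω t - xhat ω t)
        ≤ (group t₁ N (obsIndex S i) l).card * (opt + η) + C₀ * fluct N := by
      intro l hl
      have hl' := Finset.mem_range.1 hl
      rw [sum_group hl']
      by_contra hlt
      refine hcon l hl' ⟨η, hη, ?_, not_le.1 hlt⟩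
      have h4 := h1 l hl'
      have hm : 0 < (group t₁ N (obsIndex S i) l).card := by
        have := le_card_group (t₁ := t₁) hl' hN2
        by_contra h0
        rw [Nat.eq_zero_of_not_pos h0] at this
        omega
      rw [residueAvg_eq hobs hi hφ _ hl', div_le_iff₀ (by exact_mod_cast hm)] at h4
      exact h4.trans_eq (mul_comm _ _)
    have h5 := Finset.sum_le_sum h3
    rw [← sum_window hμ, Finset.sum_add_distrib, ← Finset.sum_mul, sum_card_group hμ,
      Finset.sum_const, Finset.card_range, nsmul_eq_mul] at h5
    rw [avgSqError, one_div_mul_eq_div, lt_div_iff₀ hNpos] at h2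
    have h6 : (opt + η + (obsIndex S i * C₀ + obsIndex S i * 6) * (fluct N / N)) * N
        = N * (opt + η) + obsIndex S i * (C₀ * fluct N) + obsIndex S i * 6 * fluct N := by
      field_simp
      ring
    have h7 : 0 ≤ (obsIndex S i : ℝ) * 6 * fluct N := by positivity
    linarith
  · gcongr
    have : 0 ≤ (obsIndex S i : ℝ) * C₀ := by positivity
    linarith

theorem measurable_predError {φ : ℕ → Ω → Fin p → ℝ} {ℱ : ℕ → MeasurableSpace Ω}
    (hF : IsPast P x₀ w v φ κ ℱ) (s : Finset (Fin p)) (ξ : Fin n → ℝ) (t : ℕ) :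
    Measurable[ℱ t] (predError S x₀ w v φ s ξ t) := by
  have h1 : Measurable[ℱ t] fun ω => statePath S x₀ w ω t :=
    @measurable_statePath _ _ S Ω (ℱ t) _ _ _ (hF.measurable_init t)
      fun s hs => hF.measurable_w s t hs
  have h2 : Measurable[ℱ t] fun ω => predictor S s ξ (outputPath S x₀ w v φ ω) t :=
    @measurable_predictor _ _ S Ω (ℱ t) s ξ _ _ fun r hr =>
      @measurable_outputPath _ _ S Ω (ℱ t) _ _ _ _ _ (hF.measurable_init t)
        (fun s hs => hF.measurable_w s t (hs.trans hr)) (hF.measurable_v r t hr)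
        (hF.measurable_attack r t hr)
  exact Measurable.sub (m := ℱ t) h1 h2

/-- A filter that uses no attacked sensor passes the test, up to the fluctuations of the noise and
the initial errors of the groups. -/
theorem exists_window_complete [IsProbabilityMeasure P] (hn : IsNoise S P x₀ w v)
    {s i : Finset (Fin p)} (hP : IsSteady S s (steadyCov S s)) (hobs : IsObservable S i)
    (hs : Disjoint s κ) (hi : Disjoint i κ) (E : Matrix (Fin n) (Fin n) ℝ)
    (B : Matrix (Fin n) (BlockIndex n κ (obsIndex S i)) ℝ) {L : ℕ} (hL : obsIndex S i ≤ L)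
    (ξ : Fin n → ℝ) :
    ∃ C : ℝ, 0 ≤ C ∧ ∃ N₁ : ℕ, ∀ (φ : ℕ → Ω → Fin p → ℝ) (ℱ : ℕ → MeasurableSpace Ω),
      (∀ t ω, ∀ d ∉ κ, φ t ω d = 0) → IsPast P x₀ w v φ κ ℱ → ∀ xhat : Ω → ℕ → Fin n → ℝ,
      (∀ t ω, statePath S x₀ w ω t - xhat ω t = E *ᵥ predError S x₀ w v φ s ξ t ω
        + B *ᵥ blockNoise w v κ (obsIndex S i) t ω) → ∀ N ≥ N₁, ∀ t₁ : ℕ,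
      P {ω | ∃ l < obsIndex S i,
          (E * steadyCov S s * Eᵀ).trace + quadraticMean (blockStd S κ (obsIndex S i))
              ((B + obsPinv S i * blockOut S i κ)ᵀ * (B + obsPinv S i * blockOut S i κ))
            + C * (fluct N / N) * (1 + ∑ r ∈ Finset.range L,
              predError S x₀ w v φ s ξ (t₁ + r) ω ⬝ᵥ predError S x₀ w v φ s ξ (t₁ + r) ω)
            < residueAvg S i (outputPath S x₀ w v φ ω) (xhat ω) t₁ N l}
        ≤ ENNReal.ofReal (C / (N : ℝ) ^ 2) := by
  have hμ := (obsIndex_spec hobs).1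
  set U := obsPinv S i * blockOut S i κ with hU
  have hFst : Tendsto (fun t => (closedLoop S s (predictorGain S s) ^ obsIndex S i) ^ t) atTop
      (𝓝 0) := by
    simp only [← pow_mul]
    refine hP.stable.comp (tendsto_atTop_mono (fun t => ?_) tendsto_id)
    exact Nat.le_mul_of_pos_left t hμ
  obtain ⟨C₀, hC₀, N₀, hN₀⟩ := exists_residue_complete (P := P) (blockStd S κ (obsIndex S i)) hFst
    (steadyCov_eq_block hP hs (obsIndex S i)) E (B + U)
  refine ⟨2 * obsIndex S i * C₀ + obsIndex S i * 8, by positivity, max N₀ (2 * obsIndex S i),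
    fun φ ℱ hφ hF xhat hx N hN t₁ => ?_⟩
  have hN1 : N₀ ≤ N := (le_max_left _ _).trans hN
  have hN2 : 2 * obsIndex S i ≤ N := (le_max_right _ _).trans hN
  have hNpos : (0 : ℝ) < N := by exact_mod_cast (show 0 < N by omega)
  have hfl : 0 ≤ fluct N := zero_le_one.trans (one_le_fluct (by omega))
  have key := fun l (hl : l < obsIndex S i) => hN₀ (hF.isInnovation hn (obsIndex S i) (t₁ + l))
    (fun j => predError S x₀ w v φ s ξ (t₁ + l + j * obsIndex S i))
    (fun j => measurable_predError hF s ξ _) (fun j ω => by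
      rw [show t₁ + l + (j + 1) * obsIndex S i
        = t₁ + l + j * obsIndex S i + obsIndex S i by ring]
      exact predError_add_block hs hφ _ (obsIndex S i) ω) N hN1
    (group t₁ N (obsIndex S i) l).card card_group_le
  refine ((measure_mono fun ω hω => ?_).trans
    (measure_biUnion_range_le key)).trans (ENNReal.ofReal_le_ofReal ?_)
  · obtain ⟨l, hl, h1⟩ := hω
    refine Set.mem_biUnion (Finset.mem_coe.2 (Finset.mem_range.2 hl)) ?_
    have hm := le_card_group (t₁ := t₁) hl hN2
    set m := (group t₁ N (obsIndex S i) l).card with hmdef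
    have hmpos : (0 : ℝ) < m := by
      rcases Nat.eq_zero_or_pos m with h0 | h0
      · rw [h0] at hm
        omega
      · exact_mod_cast h0
    have hm' : (N : ℝ) ≤ 2 * obsIndex S i * m := by exact_mod_cast hm
    rw [residueAvg_eq hobs hi hφ _ hl, lt_div_iff₀ hmpos] at h1
    rw [Set.mem_ofPred_eq]
    refine lt_of_le_of_lt ?_ (h1.trans_eq (Finset.sum_congr rfl fun j _ => ?_))
    · set Z := ∑ r ∈ Finset.range L,
        predError S x₀ w v φ s ξ (t₁ + r) ω ⬝ᵥ predError S x₀ w v φ s ξ (t₁ + r) ω with hZ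
      have hz : predError S x₀ w v φ s ξ (t₁ + l + 0 * obsIndex S i) ω
          ⬝ᵥ predError S x₀ w v φ s ξ (t₁ + l + 0 * obsIndex S i) ω ≤ Z := by
        rw [zero_mul, add_zero]
        exact Finset.single_le_sum (f := fun r => predError S x₀ w v φ s ξ (t₁ + r) ω
          ⬝ᵥ predError S x₀ w v φ s ξ (t₁ + r) ω) (fun r _ => dotProduct_self_nonneg_real _)
          (Finset.mem_range.2 (hl.trans_le hL))
      have hZ0 : 0 ≤ Z := Finset.sum_nonneg fun r _ => dotProduct_self_nonneg_real _
      have h2 : C₀ * fluct N * (1 + predError S x₀ w v φ s ξ (t₁ + l + 0 * obsIndex S i) ω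
          ⬝ᵥ predError S x₀ w v φ s ξ (t₁ + l + 0 * obsIndex S i) ω) ≤ C₀ * fluct N * (1 + Z) := by
        gcongr
      have h3 : C₀ * fluct N * (1 + Z)
          ≤ (2 * obsIndex S i * C₀ + obsIndex S i * 8) * (fluct N / N) * (1 + Z) * m := by
        have h4 : C₀ * fluct N * (1 + Z) = C₀ * (fluct N / N) * (1 + Z) * N := by field_simp
        rw [h4]
        calc C₀ * (fluct N / N) * (1 + Z) * N
            ≤ C₀ * (fluct N / N) * (1 + Z) * (2 * obsIndex S i * m) := by gcongr
          _ = 2 * obsIndex S i * C₀ * (fluct N / N) * (1 + Z) * m := by ring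
          _ ≤ _ := by
            gcongr
            have : (0 : ℝ) ≤ obsIndex S i * 8 := by positivity
            linarith
      linarith
    · rw [hx]
      simp only [Matrix.add_mulVec, add_assoc]
      rfl
  · gcongr
    have : 0 ≤ 2 * (obsIndex S i : ℝ) * C₀ := by positivity
    linarith

end Window

/-! ### Tightness of the estimation error -/

section Tightness

variable {n p : ℕ} {S : LinearSystem n p} {Ω : Type*} [MeasurableSpace Ω] {P : Measure Ω}
  {x₀ : Ω → Fin n → ℝ} {w : ℕ → Ω → Fin n → ℝ} {v : ℕ → Ω → Fin p → ℝ} {κ : Finset (Fin p)}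

/-- A single random variable is tight. -/
theorem exists_measure_gt_le [IsFiniteMeasure P] {Y : Ω → ℝ} (hY : Measurable Y) {δ : ℝ}
    (hδ : 0 < δ) : ∃ b : ℝ, P {ω | b < Y ω} ≤ ENNReal.ofReal δ := by
  have h := tendsto_measure_iInter_atTop (μ := P) (s := fun k : ℕ => {ω | (k : ℝ) < Y ω})
    (fun k => (measurableSet_lt measurable_const hY).nullMeasurableSet)
    (fun k k' hk ω (hω : (k' : ℝ) < Y ω) => show (k : ℝ) < Y ω from
      (Nat.cast_le.2 hk).trans_lt hω) ⟨0, measure_ne_top _ _⟩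
  have h0 : ⋂ k : ℕ, {ω | (k : ℝ) < Y ω} = ∅ := by
    ext ω
    simp only [Set.mem_iInter, Set.mem_ofPred_eq, Set.mem_empty_iff_false, iff_false, not_forall,
      not_lt]
    exact exists_nat_ge (Y ω)
  rw [h0, measure_empty] at h
  obtain ⟨k, hk⟩ := (h.eventually_le_const (ENNReal.ofReal_pos.2 hδ)).exists
  exact ⟨k, hk⟩

/-- A quadratic form that solves the Lyapunov equation for a stable `F` contracts along
`x ↦ F x + y`, up to a multiple of `|y|²`. -/
theorem exists_contraction {F : Matrix (Fin n) (Fin n) ℝ}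
    (hF : Tendsto (fun t => F ^ t) atTop (𝓝 0)) :
    ∃ X : Matrix (Fin n) (Fin n) ℝ, ∃ q c : ℝ, 0 ≤ q ∧ q < 1 ∧ 0 ≤ c ∧
      (∀ x, x ⬝ᵥ x ≤ x ⬝ᵥ (X *ᵥ x)) ∧
      ∀ x y, (F *ᵥ x + y) ⬝ᵥ (X *ᵥ (F *ᵥ x + y)) ≤ q * (x ⬝ᵥ (X *ᵥ x)) + c * (y ⬝ᵥ y) := by
  obtain ⟨X, hX⟩ := exists_isLyapunov hF (1 : Matrix (Fin n) (Fin n) ℝ)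
  obtain ⟨K₀, hK₀, hK₀'⟩ := dotProduct_mulVec_le X
  have hK1 : (1 : ℝ) ≤ K₀ + 1 := by linarith
  set K := K₀ + 1 with hK
  have hKpos : 0 < K := by linarith
  have hK' : ∀ x, x ⬝ᵥ (X *ᵥ x) ≤ K * (x ⬝ᵥ x) := fun x => by
    have := hK₀' x
    have := dotProduct_self_nonneg_real x
    rw [hK]
    linarith
  have hinv : K⁻¹ ≤ 1 := inv_le_one_of_one_le₀ hK1
  have hinv0 : 0 < K⁻¹ := by positivity
  refine ⟨X, 1 - K⁻¹ ^ 2, (1 + K) * K, ?_, ?_, by positivity, fun x => ?_, fun x y => ?_⟩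
  · nlinarith
  · nlinarith
  · have h := hX.apply x
    rw [Matrix.one_mulVec] at h
    have := hX.nonneg (F *ᵥ x)
    linarith
  · have h1 := hX.apply x
    rw [Matrix.one_mulVec] at h1
    have h2 := hX.nonneg (K⁻¹ • (F *ᵥ x) - y)
    have h3 := hK' x
    have h4 := hK' y
    simp only [Matrix.mulVec_sub, Matrix.mulVec_smul, sub_dotProduct, dotProduct_sub,
      smul_dotProduct, dotProduct_smul, smul_eq_mul] at h2
    simp only [Matrix.mulVec_add, add_dotProduct, dotProduct_add]
    set a := (F *ᵥ x) ⬝ᵥ (X *ᵥ (F *ᵥ x))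
    set b := (F *ᵥ x) ⬝ᵥ (X *ᵥ y)
    set b' := y ⬝ᵥ (X *ᵥ (F *ᵥ x))
    set d := y ⬝ᵥ (X *ᵥ y)
    set u := x ⬝ᵥ (X *ᵥ x)
    -- Young's inequality with weight `1 / K`: then `(1 + 1 / K) (1 - 1 / K) < 1`.
    have h5 : b + b' ≤ K⁻¹ * a + K * d := by
      have h6 : K * (K⁻¹ * (K⁻¹ * a) - K⁻¹ * b - (K⁻¹ * b' - d))
          = K⁻¹ * a - (b + b') + K * d := by
        field_simp
        ring
      have := mul_nonneg hKpos.le h2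
      have h7 : K⁻¹ * (K⁻¹ * a) - K⁻¹ * b' - (K⁻¹ * b - d)
        = K⁻¹ * (K⁻¹ * a) - K⁻¹ * b - (K⁻¹ * b' - d) := by ring
      nlinarith
    have h8 : a ≤ (1 - K⁻¹) * u := by
      have : K⁻¹ * u ≤ x ⬝ᵥ x := by
        rw [inv_mul_le_iff₀ hKpos]
        exact h3
      linarith
    have h9 : (1 + K⁻¹) * a ≤ (1 + K⁻¹) * ((1 - K⁻¹) * u) := by gcongr
    have h10 : (1 + K) * d ≤ (1 + K) * (K * (y ⬝ᵥ y)) := by gcongr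
    nlinarith

/-- The solution of `W (t + 1) = q W t + c Y t`, `W 0 = 0`: the part of the bound on the estimation
error that comes from the noise. -/
def noiseEnergy (q c : ℝ) (Y : ℕ → Ω → ℝ) : ℕ → Ω → ℝ
  | 0 => fun _ => 0
  | t + 1 => fun ω => q * noiseEnergy q c Y t ω + c * Y t ω

theorem noiseEnergy_bound [IsProbabilityMeasure P] {q c V : ℝ} (hq : 0 ≤ q) (hq1 : q < 1)
    (hc : 0 ≤ c) {Y : ℕ → Ω → ℝ} (hY0 : ∀ t ω, 0 ≤ Y t ω) (hY : ∀ t, Integrable (Y t) P)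
    (hV : ∀ t, ∫ ω, Y t ω ∂P ≤ V) (hV0 : 0 ≤ V) (t : ℕ) :
    (∀ ω, 0 ≤ noiseEnergy q c Y t ω) ∧ Integrable (noiseEnergy q c Y t) P
      ∧ ∫ ω, noiseEnergy q c Y t ω ∂P ≤ c * V / (1 - q) := by
  have h1q : 0 < 1 - q := by linarith
  induction t with
  | zero => exact ⟨fun _ => le_rfl, integrable_zero _ _ _, by
      simp only [noiseEnergy, integral_zero]
      positivity⟩
  | succ t ih =>
    obtain ⟨h1, h2, h3⟩ := ih
    refine ⟨fun ω => ?_, (h2.const_mul q).add ((hY t).const_mul c), ?_⟩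
    · have := h1 ω
      have := hY0 t ω
      simp only [noiseEnergy]
      positivity
    · have h4 : ∫ ω, noiseEnergy q c Y (t + 1) ω ∂P
          = q * ∫ ω, noiseEnergy q c Y t ω ∂P + c * ∫ ω, Y t ω ∂P := by
        rw [← integral_const_mul, ← integral_const_mul]
        exact integral_add (h2.const_mul q) ((hY t).const_mul c)
      have h5 : q * ∫ ω, noiseEnergy q c Y t ω ∂P ≤ q * (c * V / (1 - q)) := by gcongr
      have h6 : c * ∫ ω, Y t ω ∂P ≤ c * V := by
        gcongr
        exact hV t
      have h7 : q * (c * V / (1 - q)) + c * V = c * V / (1 - q) := by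
        field_simp
        ring
      linarith

/-- The error of a filter without attacked sensors is tight, uniformly in time and in the
attack. -/
theorem exists_predError_tight [IsProbabilityMeasure P] (hn : IsNoise S P x₀ w v)
    {s : Finset (Fin p)} (hP : IsSteady S s (steadyCov S s)) (hs : Disjoint s κ)
    (ξ : Fin n → ℝ) {δ : ℝ} (hδ : 0 < δ) :
    ∃ b : ℝ, ∀ φ : ℕ → Ω → Fin p → ℝ, (∀ t ω, ∀ d ∉ κ, φ t ω d = 0) → ∀ t : ℕ,
      P {ω | b < predError S x₀ w v φ s ξ t ω ⬝ᵥ predError S x₀ w v φ s ξ t ω}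
        ≤ ENNReal.ofReal δ := by
  obtain ⟨X, q, c, hq, hq1, hc, hX1, hX2⟩ := exists_contraction hP.stable
  set G := errorBlock S s κ 1 with hG
  let Y : ℕ → Ω → ℝ := fun t ω =>
    (G *ᵥ blockNoise w v κ 1 t ω) ⬝ᵥ (G *ᵥ blockNoise w v κ 1 t ω)
  have hYeq : ∀ t ω, Y t ω = blockNoise w v κ 1 t ω ⬝ᵥ ((Gᵀ * G) *ᵥ blockNoise w v κ 1 t ω) :=
    fun t ω => mulVec_dotProduct_mulVec _ _ _ _
  have hmeas : ∀ t, AEMeasurable (blockNoise w v κ 1 t) P := fun t => by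
    refine Measurable.aemeasurable (measurable_pi_of fun a => ?_)
    rcases a with ⟨r, a | d⟩
    · exact (measurable_pi_apply a).comp (hn.measurable_w _)
    · exact (measurable_pi_apply (d : Fin p)).comp (hn.measurable_v _)
  have hYint : ∀ t, Integrable (Y t) P ∧
      ∫ ω, Y t ω ∂P = quadraticMean (blockStd S κ 1) (Gᵀ * G) := by
    intro t
    have h1 := integrable_quadratic (blockStd S κ 1) (Gᵀ * G)
    have h2 := integral_quadratic (blockStd S κ 1) (Gᵀ * G)
    rw [← map_blockNoise hn κ 1 t] at h1 h2
    have h3 := h1.comp_aemeasurable (hmeas t)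
    rw [integral_map (hmeas t) h1.aestronglyMeasurable] at h2
    exact ⟨h3.congr (ae_of_all _ fun ω => (hYeq t ω).symm),
      (integral_congr_ae (ae_of_all _ fun ω => hYeq t ω)).trans h2⟩
  have hY0 : ∀ t ω, 0 ≤ Y t ω := fun t ω => dotProduct_self_nonneg_real _
  have hV0 : 0 ≤ quadraticMean (blockStd S κ 1) (Gᵀ * G) := by
    rw [← (hYint 0).2]
    exact integral_nonneg fun ω => hY0 0 ω
  set D := c * quadraticMean (blockStd S κ 1) (Gᵀ * G) / (1 - q) with hD
  have hW := noiseEnergy_bound hq hq1 hc hY0 (fun t => (hYint t).1) (fun t => (hYint t).2.le) hV0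
  have hD0 : 0 ≤ D := by
    have : 0 < 1 - q := by linarith
    positivity
  obtain ⟨b₀, hb₀⟩ := exists_measure_gt_le (P := P)
    (Y := fun ω => (x₀ ω - ξ) ⬝ᵥ (X *ᵥ (x₀ ω - ξ)))
    (((by fun_prop : Continuous fun x : Fin n → ℝ =>
      (x - ξ) ⬝ᵥ (X *ᵥ (x - ξ))).measurable.comp hn.measurable_init)) (half_pos hδ)
  set b₁ := (2 * (D + 1)) / δ with hb₁
  have hb₁0 : 0 < b₁ := by positivity
  refine ⟨b₀ + b₁, fun φ hφ t => ?_⟩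
  -- Only the initial error, which is one random variable without moments, and the noise, whose
  -- contribution has bounded mean, enter.
  have h1 : ∀ ω, predError S x₀ w v φ s ξ t ω ⬝ᵥ (X *ᵥ predError S x₀ w v φ s ξ t ω)
      ≤ (x₀ ω - ξ) ⬝ᵥ (X *ᵥ (x₀ ω - ξ)) + noiseEnergy q c Y t ω := by
    intro ω
    have h0 : 0 ≤ (x₀ ω - ξ) ⬝ᵥ (X *ᵥ (x₀ ω - ξ)) :=
      (dotProduct_self_nonneg_real _).trans (hX1 _)
    induction t with
    | zero => exact (add_zero _).ge
    | succ t ih =>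
      have h2 := predError_add_block (S := S) (x₀ := x₀) (w := w) (v := v) (ξ := ξ) hs hφ t 1 ω
      rw [pow_one] at h2
      rw [h2]
      refine (hX2 _ _).trans ?_
      have h3 : q * (predError S x₀ w v φ s ξ t ω ⬝ᵥ (X *ᵥ predError S x₀ w v φ s ξ t ω))
          ≤ q * ((x₀ ω - ξ) ⬝ᵥ (X *ᵥ (x₀ ω - ξ)) + noiseEnergy q c Y t ω) := by gcongr
      have h4 : q * ((x₀ ω - ξ) ⬝ᵥ (X *ᵥ (x₀ ω - ξ))) ≤ (x₀ ω - ξ) ⬝ᵥ (X *ᵥ (x₀ ω - ξ)) :=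
        mul_le_of_le_one_left h0 hq1.le
      simp only [noiseEnergy]
      have h5 : c * Y t ω = c * ((G *ᵥ blockNoise w v κ 1 t ω) ⬝ᵥ (G *ᵥ blockNoise w v κ 1 t ω)) :=
        rfl
      linarith
  have h2 : P {ω | b₁ ≤ noiseEnergy q c Y t ω} ≤ ENNReal.ofReal (δ / 2) := by
    obtain ⟨hw0, hwi, hwD⟩ := hW t
    have h3 := mul_meas_ge_le_integral_of_nonneg (ae_of_all P hw0) hwi b₁
    have h4 : P.real {ω | b₁ ≤ noiseEnergy q c Y t ω} ≤ δ / 2 := by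
      have h5 : b₁ * P.real {ω | b₁ ≤ noiseEnergy q c Y t ω} ≤ D := h3.trans hwD
      have h6 : P.real {ω | b₁ ≤ noiseEnergy q c Y t ω} ≤ D / b₁ := by
        rw [le_div_iff₀ hb₁0]
        linarith
      refine h6.trans ?_
      rw [div_le_iff₀ hb₁0, hb₁]
      field_simp
      linarith
    rw [← ENNReal.ofReal_toReal (measure_ne_top P _)]
    exact ENNReal.ofReal_le_ofReal h4
  refine (measure_mono (t := {ω | b₀ < (x₀ ω - ξ) ⬝ᵥ (X *ᵥ (x₀ ω - ξ))}
    ∪ {ω | b₁ ≤ noiseEnergy q c Y t ω}) fun ω hω => ?_).trans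
    ((measure_union_le _ _).trans ((add_le_add hb₀ h2).trans_eq ?_))
  · by_contra hcon
    simp only [Set.mem_union, Set.mem_ofPred_eq, not_or, not_lt, not_le] at hcon
    have h3 := h1 ω
    have h4 := hX1 (predError S x₀ w v φ s ξ t ω)
    have h5 : b₀ + b₁ < _ := hω
    linarith [hcon.1, hcon.2]
  · rw [← ENNReal.ofReal_add (by positivity) (by positivity), add_halves]

theorem exists_sum_predError_tight [IsProbabilityMeasure P] (hn : IsNoise S P x₀ w v)
    {s : Finset (Fin p)} (hP : IsSteady S s (steadyCov S s)) (hs : Disjoint s κ)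
    (ξ : Fin n → ℝ) (L : ℕ) {δ : ℝ} (hδ : 0 < δ) :
    ∃ b : ℝ, ∀ φ : ℕ → Ω → Fin p → ℝ, (∀ t ω, ∀ d ∉ κ, φ t ω d = 0) → ∀ t₁ : ℕ,
      P {ω | b < ∑ r ∈ Finset.range L,
          predError S x₀ w v φ s ξ (t₁ + r) ω ⬝ᵥ predError S x₀ w v φ s ξ (t₁ + r) ω}
        ≤ ENNReal.ofReal δ := by
  obtain ⟨b, hb⟩ := exists_predError_tight hn hP hs ξ (δ := δ / (L + 1)) (by positivity)
  refine ⟨L * b, fun φ hφ t₁ => ?_⟩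
  refine (measure_mono (t := ⋃ r ∈ Finset.range L, {ω | b < predError S x₀ w v φ s ξ (t₁ + r) ω
    ⬝ᵥ predError S x₀ w v φ s ξ (t₁ + r) ω}) fun ω hω => ?_).trans
    ((measure_biUnion_finset_le _ _).trans
      ((Finset.sum_le_sum fun r _ => hb φ hφ (t₁ + r)).trans ?_))
  · by_contra hcon
    simp only [Set.mem_iUnion, not_exists, Set.mem_ofPred_eq, not_lt] at hcon
    have h1 := Finset.sum_le_sum hcon
    rw [Finset.sum_const, Finset.card_range, nsmul_eq_mul] at h1
    exact absurd hω (not_lt.2 h1)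
  · rw [Finset.sum_const, Finset.card_range, ← ENNReal.ofReal_nsmul, nsmul_eq_mul]
    refine ENNReal.ofReal_le_ofReal ?_
    rw [mul_div_assoc', div_le_iff₀ (by positivity)]
    nlinarith

end Tightness

/-! ### From window bounds to guarantees -/

section Guarantees

variable {Ω : Type*} [MeasurableSpace Ω] {P : Measure Ω} {J ι : Type*}
  {Test : J → ℕ → ℝ → Ω → ι → Prop} {Err : J → ℕ → Ω → ι → ℝ} {M : ℝ} {Z : J → Ω → ℝ}

theorem fluct_nonneg (N : ℕ) : 0 ≤ fluct N := by
  rw [fluct]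
  have := Real.log_natCast_nonneg N
  positivity

theorem tendsto_const_div_sq (C : ℝ) : Tendsto (fun N : ℕ => C / (N : ℝ) ^ 2) atTop (𝓝 0) :=
  (tendsto_const_div_pow C 2 two_ne_zero)

/-- Borel–Cantelli. -/
theorem ae_eventually_notMem_of_le_div_sq {A : ℕ → Set Ω} {C : ℝ} {N₁ : ℕ}
    (hA : ∀ N ≥ N₁, P (A N) ≤ ENNReal.ofReal (C / (N : ℝ) ^ 2)) :
    ∀ᵐ ω ∂P, ∀ᶠ N in atTop, ω ∉ A N := by
  have hsum : Summable fun N : ℕ => C / (N : ℝ) ^ 2 := by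
    simp only [div_eq_mul_inv]
    exact (Real.summable_nat_pow_inv.2 one_lt_two).mul_left C
  have h1 : ∑' N, P (A (N + N₁)) ≠ ⊤ := by
    refine ne_top_of_le_ne_top ?_ (ENNReal.tsum_le_tsum fun N => hA (N + N₁) (Nat.le_add_left _ _))
    exact ((summable_nat_add_iff N₁).2 hsum).tsum_ofReal_ne_top
  filter_upwards [ae_eventually_notMem h1] with ω hω
  obtain ⟨M, hM⟩ := eventually_atTop.1 hω
  filter_upwards [eventually_ge_atTop (M + N₁)] with N hN
  have h2 := hM (N - N₁) (by omega)
  rwa [Nat.sub_add_cancel (by omega)] at h2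

/-- If passing the test forces a small error, up to an exceptional probability, and some set
passes up to a tight random error, then both hold with large probability on a long window. -/
theorem exists_window_guarantee [IsProbabilityMeasure P]
    (hS : ∀ H, ∃ C : ℝ, 0 ≤ C ∧ ∃ N₁ : ℕ, ∀ N ≥ N₁, ∀ j,
      P {ω | ∃ s, ∃ η ≤ H, Test j N η ω s ∧ M + η + C * (fluct N / N) < Err j N ω s}
        ≤ ENNReal.ofReal (C / (N : ℝ) ^ 2))
    (hC : ∃ C : ℝ, 0 ≤ C ∧ ∃ N₁ : ℕ, ∀ N ≥ N₁, ∀ j,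
      P {ω | ∃ η, C * (fluct N / N) * (1 + Z j ω) ≤ η ∧ ∀ s, ¬ Test j N η ω s}
        ≤ ENNReal.ofReal (C / (N : ℝ) ^ 2))
    (hZ : ∀ δ, 0 < δ → ∃ b : ℝ, ∀ j, P {ω | b < Z j ω} ≤ ENNReal.ofReal δ)
    {ε δ η : ℝ} (hδ : 0 < δ) (hη : 0 < η) (hηε : η < ε) :
    ∃ N₀ : ℕ, ∀ N ≥ N₀, ∀ j, ENNReal.ofReal (1 - δ) ≤
      P {ω | (∃ s, Test j N η ω s) ∧ ∀ s, Test j N η ω s → Err j N ω s ≤ M + ε} := by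
  obtain ⟨C₁, hC₁, N₁, h₁⟩ := hS η
  obtain ⟨C₂, hC₂, N₂, h₂⟩ := hC
  obtain ⟨b, hb⟩ := hZ (δ / 3) (by positivity)
  have e1 : ∀ᶠ N : ℕ in atTop, C₁ * (fluct N / N) ≤ ε - η := by
    have h := tendsto_fluct_div.const_mul C₁
    rw [mul_zero] at h
    exact h.eventually_le_const (by linarith)
  have e2 : ∀ᶠ N : ℕ in atTop, C₂ * (fluct N / N) * (1 + b) ≤ η := by
    have h := (tendsto_fluct_div.const_mul C₂).mul_const (1 + b)
    rw [mul_zero, zero_mul] at h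
    exact h.eventually_le_const hη
  have hδ3 : 0 < δ / 3 := by positivity
  obtain ⟨N₀, hN₀⟩ := eventually_atTop.1 ((e1.and e2).and
    (((tendsto_const_div_sq C₁).eventually_le_const hδ3).and
      ((tendsto_const_div_sq C₂).eventually_le_const hδ3)))
  refine ⟨max N₀ (max N₁ N₂), fun N hN j => ?_⟩
  obtain ⟨⟨f1, f2⟩, f3, f4⟩ := hN₀ N ((le_max_left _ _).trans hN)
  have g1 := (h₁ N ((le_max_left _ _).trans ((le_max_right _ _).trans hN)) j).trans
    (ENNReal.ofReal_le_ofReal f3)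
  have g2 := (h₂ N ((le_max_right _ _).trans ((le_max_right _ _).trans hN)) j).trans
    (ENNReal.ofReal_le_ofReal f4)
  have hfl : 0 ≤ C₂ * (fluct N / N) := by
    have := fluct_nonneg N
    positivity
  -- Subadditivity gives the lower bound without any measurability of `A`.
  set A := {ω | (∃ s, Test j N η ω s) ∧ ∀ s, Test j N η ω s → Err j N ω s ≤ M + ε} with hA
  have hcov : (Set.univ : Set Ω) ⊆ A ∪ ({ω | ∃ s, ∃ η' ≤ η, Test j N η' ω s ∧
      M + η' + C₁ * (fluct N / N) < Err j N ω s}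
      ∪ ({ω | ∃ η, C₂ * (fluct N / N) * (1 + Z j ω) ≤ η ∧ ∀ s, ¬ Test j N η ω s}
      ∪ {ω | b < Z j ω})) := by
    intro ω _
    by_contra hcon
    simp only [hA, Set.mem_union, Set.mem_ofPred_eq, not_or, not_and, not_lt, not_exists,
      not_forall, not_not, not_le] at hcon
    obtain ⟨k1, k2, k3, k4⟩ := hcon
    obtain ⟨s, hs⟩ := k3 η (by
      refine le_trans ?_ f2
      gcongr)
    obtain ⟨s', hs', hlt⟩ := k1 ⟨s, hs⟩
    have := k2 s' η le_rfl hs'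
    linarith
  have h1 : 1 ≤ P A + ENNReal.ofReal δ := by
    calc (1 : ENNReal) = P Set.univ := measure_univ.symm
      _ ≤ _ := measure_mono hcov
      _ ≤ P A + (ENNReal.ofReal (δ / 3) + (ENNReal.ofReal (δ / 3) + ENNReal.ofReal (δ / 3))) :=
        (measure_union_le _ _).trans (by
          gcongr
          refine (measure_union_le _ _).trans (add_le_add g1 ?_)
          exact (measure_union_le _ _).trans (add_le_add g2 (hb j)))
      _ = P A + ENNReal.ofReal δ := by
        rw [← ENNReal.ofReal_add hδ3.le hδ3.le, ← ENNReal.ofReal_add hδ3.le (by positivity)]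
        ring_nf
  rw [ENNReal.ofReal_sub _ hδ.le, ENNReal.ofReal_one]
  exact tsub_le_iff_right.2 h1

/-- The design parameters `√(fluct N / N) + 1 / (N + 1)`: they tend to `0`, but more slowly than
the fluctuations. -/
noncomputable def designParam (N : ℕ) : ℝ := √(fluct N / N) + 1 / ((N : ℝ) + 1)

theorem designParam_pos (N : ℕ) : 0 < designParam N := by
  rw [designParam]
  positivity

theorem tendsto_designParam : Tendsto designParam atTop (𝓝 0) := by
  have h1 := (Real.continuous_sqrt.tendsto 0).comp tendsto_fluct_div
  rw [Real.sqrt_zero] at h1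
  have h2 := h1.add (tendsto_one_div_add_atTop_nhds_zero_nat (𝕜 := ℝ))
  rw [add_zero] at h2
  exact h2

theorem eventually_fluct_le_designParam (c : ℝ) :
    ∀ᶠ N : ℕ in atTop, c * (fluct N / N) ≤ designParam N := by
  have h1 := ((Real.continuous_sqrt.tendsto 0).comp tendsto_fluct_div).const_mul c
  rw [Real.sqrt_zero, mul_zero] at h1
  filter_upwards [h1.eventually_le_const zero_lt_one] with N hN
  have h0 : 0 ≤ fluct N / N := div_nonneg (fluct_nonneg N) (Nat.cast_nonneg N)
  have h2 : c * (fluct N / N) = c * √(fluct N / N) * √(fluct N / N) := by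
    rw [mul_assoc, Real.mul_self_sqrt h0]
  have h3 : c * √(fluct N / N) * √(fluct N / N) ≤ 1 * √(fluct N / N) := by
    gcongr
    exact hN
  have h4 : (0 : ℝ) < 1 / ((N : ℝ) + 1) := by positivity
  rw [designParam]
  linarith

/-- Almost surely the exceptional events happen for finitely many `N` only, and the design
parameters absorb the fluctuations and the random error `Z`. -/
theorem ae_asymptotic_guarantee
    (hS : ∃ C : ℝ, 0 ≤ C ∧ ∃ N₁ : ℕ, ∀ N ≥ N₁, ∀ j,
      P {ω | ∃ s, ∃ η ≤ (1 : ℝ), Test j N η ω s ∧ M + η + C * (fluct N / N) < Err j N ω s}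
        ≤ ENNReal.ofReal (C / (N : ℝ) ^ 2))
    (hC : ∃ C : ℝ, 0 ≤ C ∧ ∃ N₁ : ℕ, ∀ N ≥ N₁, ∀ j,
      P {ω | ∃ η, C * (fluct N / N) * (1 + Z j ω) ≤ η ∧ ∀ s, ¬ Test j N η ω s}
        ≤ ENNReal.ofReal (C / (N : ℝ) ^ 2)) (j : J) :
    ∀ᵐ ω ∂P, (∀ᶠ N in atTop, ∃ s, Test j N (designParam N) ω s) ∧
      ∀ s : ℕ → ι, (∀ᶠ N in atTop, Test j N (designParam N) ω (s N)) →
        limsup (fun N : ℕ => ((Err j N ω (s N) : ℝ) : EReal)) atTop ≤ (M : EReal) := by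
  obtain ⟨C₁, -, N₁, h₁⟩ := hS
  obtain ⟨C₂, -, N₂, h₂⟩ := hC
  filter_upwards [ae_eventually_notMem_of_le_div_sq fun N hN => h₁ N hN j,
    ae_eventually_notMem_of_le_div_sq fun N hN => h₂ N hN j] with ω hω1 hω2
  refine ⟨?_, fun s hs => ?_⟩
  · filter_upwards [hω2, eventually_fluct_le_designParam (C₂ * (1 + Z j ω))] with N hN hN'
    by_contra hcon
    exact hN ⟨designParam N, by linarith, not_exists.1 hcon⟩
  · have h1 : ∀ᶠ N in atTop, ((Err j N ω (s N) : ℝ) : EReal)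
        ≤ ((M + designParam N + C₁ * (fluct N / N) : ℝ) : EReal) := by
      filter_upwards [hω1, hs, tendsto_designParam.eventually_le_const zero_lt_one]
        with N hN hN' hN1
      by_contra hcon
      exact hN ⟨s N, designParam N, hN1, hN', EReal.coe_lt_coe_iff.1 (not_le.1 hcon)⟩
    have h2 : Tendsto (fun N : ℕ => M + designParam N + C₁ * (fluct N / N)) atTop (𝓝 M) := by
      simpa using (tendsto_designParam.const_add M).add (tendsto_fluct_div.const_mul C₁)
    have h3 := (continuous_coe_real_ereal.tendsto M).comp h2
    exact (limsup_le_limsup h1).trans h3.limsup_eq.le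

end Guarantees

/-! ### Secure estimators -/

section Estimators

variable {n p : ℕ} {S : LinearSystem n p}

theorem IsObservable.mono {i j : Finset (Fin p)} (h : IsObservable S i) (hij : i ⊆ j) :
    IsObservable S j := by
  obtain ⟨μ, hμ, hr⟩ := h
  refine ⟨μ, hμ, ?_⟩
  have hker : LinearMap.ker (obsMatrix S j μ).mulVecLin = ⊥ := by
    rw [LinearMap.ker_eq_bot']
    intro x hx
    refine eq_zero_of_rank_eq hr (funext fun a => ?_)
    rw [obsMatrix_mulVec]
    have h1 := congrFun hx (a.1, ⟨a.2, hij a.2.2⟩)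
    rw [Matrix.mulVecLin_apply, obsMatrix_mulVec] at h1
    exact h1
  have h2 := LinearMap.finrank_range_add_finrank_ker (obsMatrix S j μ).mulVecLin
  rw [hker, finrank_bot, add_zero, Module.finrank_fin_fun] at h2
  exact h2

theorem isObservable_of_card {k θ : ℕ} (hθ : IsSparseObservable S θ) (hk : θ + 2 * k ≤ p)
    {s : Finset (Fin p)} (hs : s.card = p - k) : IsObservable S s := by
  obtain ⟨i, his, hi⟩ := Finset.exists_subset_card_eq (s := s) (n := θ) (by omega)
  exact (hθ.1.2 i hi).mono his

theorem le_maxOverSets {k : ℕ} (f : Finset (Fin p) → ℝ) {s : Finset (Fin p)}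
    (hs : s.card = p - k) : f s ≤ maxOverSets k f :=
  Finset.le_sup' f (Finset.mem_powersetCard.2 ⟨Finset.subset_univ s, hs⟩)

/-- The set `s` passes the residue test with thresholds `thr s i + η` for the estimates `est s`. -/
def Passes (S : LinearSystem n p) (k θ : ℕ)
    (est : Finset (Fin p) → (ℕ → Fin p → ℝ) → ℕ → Fin n → ℝ)
    (thr : ∀ s i : Finset (Fin p), i ⊆ s → ℝ) (t₁ N : ℕ) (η : ℝ) (y : ℕ → Fin p → ℝ)
    (s : Finset (Fin p)) : Prop :=
  s.card = p - k ∧ ∀ (i : Finset (Fin p)) (hi : i ⊆ s), i.card = θ → ∀ l < obsIndex S i,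
    residueAvg S i y (est s y) t₁ N l ≤ thr s i hi + η

variable {Ω : Type*} [MeasurableSpace Ω] {P : Measure Ω}
  {x₀ : Ω → Fin n → ℝ} {w : ℕ → Ω → Fin n → ℝ} {v : ℕ → Ω → Fin p → ℝ}

/-- What secure prediction and secure filtering have in common. The error of any estimate is, up
to a linear function `B ζ` of the current noise `ζ` of the good sensors, determined by the past;
for a filter without attacked sensors, it is a linear function of the prediction error and the
noise. The threshold of the test is the mean square of the residue of such a filter, which is
`opt` plus the mean square of the residue noise and twice its correlation with the error. -/
structure IsEstimator (S : LinearSystem n p) (P : Measure Ω) (x₀ : Ω → Fin n → ℝ)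
    (w : ℕ → Ω → Fin n → ℝ) (v : ℕ → Ω → Fin p → ℝ)
    (causal : Finset (Fin p) → (ℕ → Ω → Fin p → ℝ) → Prop) (ξ : Fin n → ℝ)
    (est : Finset (Fin p) → (ℕ → Fin p → ℝ) → ℕ → Fin n → ℝ) (opt : Finset (Fin p) → ℝ)
    (thr : ∀ s i : Finset (Fin p), i ⊆ s → ℝ) : Prop where
  sound : ∀ (κ s i : Finset (Fin p)) (his : i ⊆ s), IsObservable S i → Disjoint i κ →
    ∃ B : Matrix (Fin n) (BlockIndex n κ (obsIndex S i)) ℝ,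
      thr s i his = opt s + quadraticMean (blockStd S κ (obsIndex S i))
        ((obsPinv S i * blockOut S i κ)ᵀ * (obsPinv S i * blockOut S i κ)
          + (2 : ℝ) • (Bᵀ * (obsPinv S i * blockOut S i κ))) ∧
      ∀ φ : ℕ → Ω → Fin p → ℝ, (∀ t, Measurable (φ t)) → causal κ φ →
        ∃ ℱ, IsPast P x₀ w v φ κ ℱ ∧ ∀ t, Measurable[ℱ t] fun ω =>
          statePath S x₀ w ω t - est s (outputPath S x₀ w v φ ω) t
            - B *ᵥ blockNoise w v κ (obsIndex S i) t ω
  complete : ∀ (κ s i : Finset (Fin p)) (his : i ⊆ s), IsObservable S i → Disjoint s κ →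
    IsSteady S s (steadyCov S s) →
    ∃ (E : Matrix (Fin n) (Fin n) ℝ) (B : Matrix (Fin n) (BlockIndex n κ (obsIndex S i)) ℝ),
      thr s i his = (E * steadyCov S s * Eᵀ).trace
        + quadraticMean (blockStd S κ (obsIndex S i))
          ((B + obsPinv S i * blockOut S i κ)ᵀ * (B + obsPinv S i * blockOut S i κ)) ∧
      ∀ φ : ℕ → Ω → Fin p → ℝ, (∀ t ω, ∀ d ∉ κ, φ t ω d = 0) → ∀ t ω,
        statePath S x₀ w ω t - est s (outputPath S x₀ w v φ ω) t
          = E *ᵥ predError S x₀ w v φ s ξ t ω + B *ᵥ blockNoise w v κ (obsIndex S i) t ω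

/-- Uniform constants over a finite index set. -/
theorem exists_uniform {ι : Type*} [Finite ι] {Q : ι → ℝ → ℕ → Prop}
    (hQ : ∀ a C C' N, C ≤ C' → Q a C N → Q a C' N)
    (h : ∀ a, ∃ C : ℝ, 0 ≤ C ∧ ∃ N₁ : ℕ, ∀ N ≥ N₁, Q a C N) :
    ∃ C : ℝ, 0 ≤ C ∧ ∃ N₁ : ℕ, ∀ N ≥ N₁, ∀ a, Q a C N := by
  cases nonempty_fintype ι
  choose C hC N₁ hN using h
  refine ⟨∑ a, C a, Finset.sum_nonneg fun a _ => hC a, ∑ a, N₁ a, fun N hN' a => ?_⟩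
  refine hQ a _ _ N (Finset.single_le_sum (fun a _ => hC a) (Finset.mem_univ a)) (hN a N ?_)
  exact (Finset.single_le_sum (fun a _ => Nat.zero_le (N₁ a)) (Finset.mem_univ a)).trans hN'

theorem measure_iUnion_le_of_forall {ι : Type*} [Fintype ι] {A : ι → Set Ω} {N : ℕ} {C : ℝ}
    (h : ∀ a, P (A a) ≤ ENNReal.ofReal (C / (N : ℝ) ^ 2)) :
    P (⋃ a, A a) ≤ ENNReal.ofReal (Fintype.card ι * C / (N : ℝ) ^ 2) := by
  refine (measure_iUnion_fintype_le _ _).trans ((Finset.sum_le_sum fun a _ => h a).trans_eq ?_)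
  rw [Finset.sum_const, Finset.card_univ, ← ENNReal.ofReal_nsmul, nsmul_eq_mul, mul_div_assoc]

variable {causal : Finset (Fin p) → (ℕ → Ω → Fin p → ℝ) → Prop} {ξ : Fin n → ℝ}
  {est : Finset (Fin p) → (ℕ → Fin p → ℝ) → ℕ → Fin n → ℝ} {opt : Finset (Fin p) → ℝ}
  {thr : ∀ s i : Finset (Fin p), i ⊆ s → ℝ}

theorem mul_fluct_le_mul {C C' : ℝ} (h : C ≤ C') (N : ℕ) :
    C * (fluct N / N) ≤ C' * (fluct N / N) :=
  mul_le_mul_of_nonneg_right h (div_nonneg (fluct_nonneg N) (Nat.cast_nonneg N))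

/-- A set that passes the test has a small error: among its sensors there are `θ` good ones, whose
residues cannot be falsified. -/
theorem IsEstimator.exists_sound [IsProbabilityMeasure P] (hn : IsNoise S P x₀ w v)
    (h : IsEstimator S P x₀ w v causal ξ est opt thr) {k θ : ℕ} (hθ : IsSparseObservable S θ)
    (hk : θ + 2 * k ≤ p) (H : ℝ) :
    ∃ C : ℝ, 0 ≤ C ∧ ∃ N₁ : ℕ, ∀ N ≥ N₁, ∀ (κ : Finset (Fin p)) (φ : ℕ → Ω → Fin p → ℝ),
      IsAttack k κ φ → causal κ φ → ∀ t₁ : ℕ,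
      P {ω | ∃ s, ∃ η ≤ H, Passes S k θ est thr t₁ N η (outputPath S x₀ w v φ ω) s ∧
          maxOverSets k opt + η + C * (fluct N / N) < avgSqError (statePath S x₀ w ω)
            (est s (outputPath S x₀ w v φ ω)) t₁ N}
        ≤ ENNReal.ofReal (C / (N : ℝ) ^ 2) := by
  obtain ⟨C, hC, N₁, hN₁⟩ := exists_uniform (ι := Finset (Fin p) × Finset (Fin p))
    (Q := fun q C N => q.1.card = k → q.2.card = p - k → ∀ φ : ℕ → Ω → Fin p → ℝ,
      IsAttack k q.1 φ → causal q.1 φ → ∀ t₁ : ℕ,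
      P {ω | ∃ η ≤ H, Passes S k θ est thr t₁ N η (outputPath S x₀ w v φ ω) q.2 ∧
          opt q.2 + η + C * (fluct N / N) < avgSqError (statePath S x₀ w ω)
            (est q.2 (outputPath S x₀ w v φ ω)) t₁ N}
        ≤ ENNReal.ofReal (C / (N : ℝ) ^ 2))
    (fun q C C' N hCC hq h1 h2 φ h3 h4 t₁ => by
      refine (measure_mono fun ω hω => ?_).trans ((hq h1 h2 φ h3 h4 t₁).trans
        (ENNReal.ofReal_le_ofReal (by gcongr)))
      obtain ⟨η, hη, h5, h6⟩ := hω
      have := mul_fluct_le_mul hCC N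
      exact ⟨η, hη, h5, by linarith⟩)
    (fun ⟨κ, s⟩ => by
      by_cases hcard : κ.card = k ∧ s.card = p - k
      swap
      · exact ⟨0, le_rfl, 0, fun N _ h1 h2 => absurd ⟨h1, h2⟩ hcard⟩
      obtain ⟨hκ, hs⟩ := hcard
      obtain ⟨i, hi, hic⟩ := Finset.exists_subset_card_eq (s := s \ κ) (n := θ) (by
        have := Finset.le_card_sdiff κ s
        omega)
      have his : i ⊆ s := hi.trans Finset.sdiff_subset
      have hiκ : Disjoint i κ := Finset.disjoint_of_subset_left hi Finset.sdiff_disjoint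
      have hobs := hθ.1.2 i hic
      obtain ⟨B, hthr, hB⟩ := h.sound κ s i his hobs hiκ
      obtain ⟨C, hC, N₁, hN₁⟩ := exists_window_sound hn hobs hiκ B (opt s) H
      refine ⟨C, hC, N₁, fun N hN _ _ φ hφ hcφ t₁ => ?_⟩
      obtain ⟨ℱ, hF, hm⟩ := hB φ hφ.measurable hcφ
      refine (measure_mono fun ω hω => ?_).trans (hN₁ φ ℱ hφ.eq_zero hF
        (fun ω => est s (outputPath S x₀ w v φ ω)) hm N hN t₁)
      obtain ⟨η, hη, h5, h6⟩ := hω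
      exact ⟨η, hη, fun l hl => (h5.2 i his hic l hl).trans_eq (by rw [hthr]), h6⟩)
  set c : ℝ := (Fintype.card (Finset (Fin p)) : ℝ) with hc
  have hc0 : 0 ≤ c := Nat.cast_nonneg _
  refine ⟨C + c * C, by positivity, N₁, fun N hN κ φ hφ hcφ t₁ => ?_⟩
  have hle : C ≤ C + c * C := le_add_of_nonneg_right (by positivity)
  refine (measure_mono (t := ⋃ s, {ω | s.card = p - k ∧
    ∃ η ≤ H, Passes S k θ est thr t₁ N η (outputPath S x₀ w v φ ω) s ∧
          opt s + η + C * (fluct N / N) < avgSqError (statePath S x₀ w ω)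
            (est s (outputPath S x₀ w v φ ω)) t₁ N}) fun ω hω => ?_).trans
    ((measure_iUnion_le_of_forall fun s => ?_).trans
      (ENNReal.ofReal_le_ofReal (p := c * C / N ^ 2) ?_))
  · obtain ⟨s, η, hη, h5, h6⟩ := hω
    have h7 := le_maxOverSets opt h5.1
    have h8 := mul_fluct_le_mul hle N
    exact Set.mem_iUnion.2 ⟨s, h5.1, η, hη, h5, by linarith⟩
  · by_cases hs : s.card = p - k
    · exact (measure_mono fun ω hω => hω.2).trans (hN₁ N hN (κ, s) hφ.card_eq hs φ hφ hcφ t₁)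
    · simp [hs]
  · gcongr
    exact le_add_of_nonneg_left hC

/-- The set of all good sensors passes the test, up to a tight error. -/
theorem IsEstimator.exists_complete [IsProbabilityMeasure P] (hσw : 0 < S.σw) (hσv : 0 < S.σv)
    (hn : IsNoise S P x₀ w v)
    (h : IsEstimator S P x₀ w v causal ξ est opt thr) {k θ : ℕ} (hθ : IsSparseObservable S θ)
    (hk : θ + 2 * k ≤ p) :
    ∃ Z : Finset (Fin p) → (ℕ → Ω → Fin p → ℝ) → ℕ → Ω → ℝ,
      (∀ δ, 0 < δ → ∃ b : ℝ, ∀ κ φ, IsAttack k κ φ → ∀ t₁,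
        P {ω | b < Z κ φ t₁ ω} ≤ ENNReal.ofReal δ) ∧
      ∃ C : ℝ, 0 ≤ C ∧ ∃ N₁ : ℕ, ∀ N ≥ N₁, ∀ (κ : Finset (Fin p)) (φ : ℕ → Ω → Fin p → ℝ),
      IsAttack k κ φ → causal κ φ → ∀ t₁ : ℕ,
      P {ω | ∃ η, C * (fluct N / N) * (1 + Z κ φ t₁ ω) ≤ η ∧
          ∀ s, ¬ Passes S k θ est thr t₁ N η (outputPath S x₀ w v φ ω) s}
        ≤ ENNReal.ofReal (C / (N : ℝ) ^ 2) := by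
  set L := ∑ i, obsIndex S i with hL
  let Z : Finset (Fin p) → (ℕ → Ω → Fin p → ℝ) → ℕ → Ω → ℝ := fun κ φ t₁ ω =>
    ∑ r ∈ Finset.range L, predError S x₀ w v φ κᶜ ξ (t₁ + r) ω
      ⬝ᵥ predError S x₀ w v φ κᶜ ξ (t₁ + r) ω
  have hZ0 : ∀ κ φ t₁ ω, 0 ≤ Z κ φ t₁ ω := fun κ φ t₁ ω =>
    Finset.sum_nonneg fun r _ => dotProduct_self_nonneg_real _
  have hcompl : ∀ {κ : Finset (Fin p)}, κ.card = k → κᶜ.card = p - k := fun hκ => by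
    rw [Finset.card_compl, Fintype.card_fin, hκ]
  have hsteady : ∀ {κ : Finset (Fin p)}, κ.card = k → IsSteady S κᶜ (steadyCov S κᶜ) := fun hκ =>
    isSteady_steadyCov _ hσw hσv (isObservable_of_card hθ hk (hcompl hκ))
  have hdisj : ∀ κ : Finset (Fin p), Disjoint κᶜ κ := fun κ => disjoint_compl_left
  refine ⟨Z, fun δ hδ => ?_, ?_⟩
  · have h1 : ∀ κ : Finset (Fin p), ∃ b : ℝ, κ.card = k → ∀ φ : ℕ → Ω → Fin p → ℝ,
        (∀ t ω, ∀ d ∉ κ, φ t ω d = 0) → ∀ t₁, P {ω | b < Z κ φ t₁ ω} ≤ ENNReal.ofReal δ := by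
      intro κ
      by_cases hκ : κ.card = k
      · obtain ⟨b, hb⟩ := exists_sum_predError_tight hn (hsteady hκ) (hdisj κ) ξ L hδ
        exact ⟨b, fun _ => hb⟩
      · exact ⟨0, fun h => absurd h hκ⟩
    choose b hb using h1
    refine ⟨∑ κ, |b κ|, fun κ φ hφ t₁ => ?_⟩
    refine (measure_mono fun ω hω => ?_).trans (hb κ hφ.card_eq φ hφ.eq_zero t₁)
    have h2 : b κ ≤ ∑ κ, |b κ| := (le_abs_self _).trans
      (Finset.single_le_sum (fun κ _ => abs_nonneg (b κ)) (Finset.mem_univ κ))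
    exact h2.trans_lt hω
  · obtain ⟨C, hC, N₁, hN₁⟩ := exists_uniform (ι := Finset (Fin p) × Finset (Fin p))
      (Q := fun q C N => q.1.card = k → q.2.card = θ → ∀ (hi : q.2 ⊆ q.1ᶜ)
        (φ : ℕ → Ω → Fin p → ℝ), IsAttack k q.1 φ → causal q.1 φ → ∀ t₁ : ℕ,
        P {ω | ∃ l < obsIndex S q.2, thr q.1ᶜ q.2 hi
              + C * (fluct N / N) * (1 + Z q.1 φ t₁ ω)
            < residueAvg S q.2 (outputPath S x₀ w v φ ω)
              (est q.1ᶜ (outputPath S x₀ w v φ ω)) t₁ N l}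
          ≤ ENNReal.ofReal (C / (N : ℝ) ^ 2))
      (fun q C C' N hCC hq h1 h2 h3 φ h4 h5 t₁ => by
        refine (measure_mono fun ω hω => ?_).trans ((hq h1 h2 h3 φ h4 h5 t₁).trans
          (ENNReal.ofReal_le_ofReal (by gcongr)))
        obtain ⟨l, hl, h6⟩ := hω
        have h7 : C * (fluct N / N) * (1 + Z q.1 φ t₁ ω)
            ≤ C' * (fluct N / N) * (1 + Z q.1 φ t₁ ω) :=
          mul_le_mul_of_nonneg_right (mul_fluct_le_mul hCC N) (by linarith [hZ0 q.1 φ t₁ ω])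
        exact ⟨l, hl, by linarith⟩)
      (fun ⟨κ, i⟩ => by
        by_cases hcard : κ.card = k ∧ i.card = θ ∧ i ⊆ κᶜ
        swap
        · exact ⟨0, le_rfl, 0, fun N _ h1 h2 h3 => absurd ⟨h1, h2, h3⟩ hcard⟩
        obtain ⟨hκ, hic, hi⟩ := hcard
        have hobs := hθ.1.2 i hic
        obtain ⟨E, B, hthr, hB⟩ := h.complete κ κᶜ i hi hobs (hdisj κ) (hsteady hκ)
        obtain ⟨C, hC, N₁, hN₁⟩ := exists_window_complete hn (hsteady hκ) hobs (hdisj κ)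
          (Finset.disjoint_of_subset_left hi (hdisj κ)) E B
          (Finset.single_le_sum (f := obsIndex S) (fun i _ => Nat.zero_le _) (Finset.mem_univ i)) ξ
        refine ⟨C, hC, N₁, fun N hN _ _ _ φ hφ hcφ t₁ => ?_⟩
        obtain ⟨_, -, hpast⟩ := h.sound κ κᶜ i hi hobs (Finset.disjoint_of_subset_left hi (hdisj κ))
        obtain ⟨ℱ, hF, -⟩ := hpast φ hφ.measurable hcφ
        refine (measure_mono fun ω hω => ?_).trans (hN₁ φ ℱ hφ.eq_zero hF
          (fun ω => est κᶜ (outputPath S x₀ w v φ ω)) (hB φ hφ.eq_zero) N hN t₁)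
        obtain ⟨l, hl, h6⟩ := hω
        refine ⟨l, hl, lt_of_eq_of_lt ?_ h6⟩
        rw [hthr])
    set c : ℝ := (Fintype.card (Finset (Fin p)) : ℝ) with hc
    have hc0 : 0 ≤ c := Nat.cast_nonneg _
    refine ⟨C + c * C, by positivity, N₁, fun N hN κ φ hφ hcφ t₁ => ?_⟩
    have hle : C ≤ C + c * C := le_add_of_nonneg_right (by positivity)
    refine (measure_mono (t := ⋃ i, {ω | ∃ hi : i ⊆ κᶜ, i.card = θ ∧ ∃ l < obsIndex S i,
        thr κᶜ i hi + C * (fluct N / N) * (1 + Z κ φ t₁ ω)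
            < residueAvg S i (outputPath S x₀ w v φ ω)
              (est κᶜ (outputPath S x₀ w v φ ω)) t₁ N l}) fun ω hω => ?_).trans
      ((measure_iUnion_le_of_forall fun i => ?_).trans
        (ENNReal.ofReal_le_ofReal (p := c * C / N ^ 2) ?_))
    · obtain ⟨η, hη, h5⟩ := hω
      have h6 := h5 κᶜ
      rw [Passes] at h6
      push Not at h6
      obtain ⟨i, hi, hic, l, hl, hlt⟩ := h6 (hcompl hφ.card_eq)
      have h7 : C * (fluct N / N) * (1 + Z κ φ t₁ ω)
          ≤ (C + c * C) * (fluct N / N) * (1 + Z κ φ t₁ ω) :=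
        mul_le_mul_of_nonneg_right (mul_fluct_le_mul hle N) (by linarith [hZ0 κ φ t₁ ω])
      exact Set.mem_iUnion.2 ⟨i, hi, hic, l, hl, by linarith⟩
    · by_cases hi : i ⊆ κᶜ ∧ i.card = θ
      · refine (measure_mono fun ω hω => ?_).trans
          (hN₁ N hN (κ, i) hφ.card_eq hi.2 hi.1 φ hφ hcφ t₁)
        obtain ⟨_, _, hω⟩ := hω
        exact hω
      · have h0 : {ω | ∃ hi : i ⊆ κᶜ, i.card = θ ∧ ∃ l < obsIndex S i,
            thr κᶜ i hi + C * (fluct N / N) * (1 + Z κ φ t₁ ω)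
            < residueAvg S i (outputPath S x₀ w v φ ω)
              (est κᶜ (outputPath S x₀ w v φ ω)) t₁ N l} = ∅ := by
          refine Set.eq_empty_iff_forall_notMem.2 fun ω hω => ?_
          obtain ⟨h1, h2, _⟩ := hω
          exact hi ⟨h1, h2⟩
        rw [h0, measure_empty]
        exact zero_le
    · gcongr
      exact le_add_of_nonneg_left hC

/-- The guarantees of the theorem, for prediction and filtering at once. -/
theorem IsEstimator.guarantees [IsProbabilityMeasure P] (hσw : 0 < S.σw) (hσv : 0 < S.σv)
    (hn : IsNoise S P x₀ w v)
    (h : IsEstimator S P x₀ w v causal ξ est opt thr) {k θ : ℕ} (hθ : IsSparseObservable S θ)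
    (hk : θ + 2 * k ≤ p) :
    (∀ ε δ : ℝ, 0 < ε → 0 < δ → ∀ η : ℝ, 0 < η → η < ε →
      ∃ N₀ : ℕ, ∀ N ≥ N₀, ∀ (κ : Finset (Fin p)) (φ : ℕ → Ω → Fin p → ℝ),
        IsAttack k κ φ → causal κ φ → ∀ t₁ : ℕ,
          ENNReal.ofReal (1 - δ) ≤
            P {ω | (∃ s, Passes S k θ est thr t₁ N η (outputPath S x₀ w v φ ω) s) ∧
              ∀ s, Passes S k θ est thr t₁ N η (outputPath S x₀ w v φ ω) s →
                avgSqError (statePath S x₀ w ω) (est s (outputPath S x₀ w v φ ω)) t₁ N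
                    ≤ maxOverSets k opt + ε}) ∧
    (∃ η : ℕ → ℝ, (∀ N, 0 < η N) ∧ Tendsto η atTop (𝓝 0) ∧
      ∀ (κ : Finset (Fin p)) (φ : ℕ → Ω → Fin p → ℝ),
        IsAttack k κ φ → causal κ φ → ∀ t₁ : ℕ, ∀ᵐ ω ∂P,
          (∀ᶠ N in atTop,
            ∃ s, Passes S k θ est thr t₁ N (η N) (outputPath S x₀ w v φ ω) s) ∧
          ∀ s : ℕ → Finset (Fin p),
            (∀ᶠ N in atTop,
              Passes S k θ est thr t₁ N (η N) (outputPath S x₀ w v φ ω) (s N)) →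
            limsup (fun N : ℕ => ((avgSqError (statePath S x₀ w ω)
                (est (s N) (outputPath S x₀ w v φ ω)) t₁ N : ℝ) : EReal)) atTop
              ≤ ((maxOverSets k opt : ℝ) : EReal)) := by
  obtain ⟨Z, hZ, C₂, hC₂, N₂, h₂⟩ := h.exists_complete hσw hσv hn hθ hk
  let J := {q : Finset (Fin p) × (ℕ → Ω → Fin p → ℝ) × ℕ // IsAttack k q.1 q.2.1 ∧ causal q.1 q.2.1}
  let Test : J → ℕ → ℝ → Ω → Finset (Fin p) → Prop := fun q N η ω s =>
    Passes S k θ est thr q.1.2.2 N η (outputPath S x₀ w v q.1.2.1 ω) s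
  let Err : J → ℕ → Ω → Finset (Fin p) → ℝ := fun q N ω s =>
    avgSqError (statePath S x₀ w ω) (est s (outputPath S x₀ w v q.1.2.1 ω)) q.1.2.2 N
  have hS : ∀ H, ∃ C : ℝ, 0 ≤ C ∧ ∃ N₁ : ℕ, ∀ N ≥ N₁, ∀ j : J,
      P {ω | ∃ s, ∃ η ≤ H, Test j N η ω s ∧
        maxOverSets k opt + η + C * (fluct N / N) < Err j N ω s}
        ≤ ENNReal.ofReal (C / (N : ℝ) ^ 2) := by
    intro H
    obtain ⟨C, hC, N₁, hN₁⟩ := h.exists_sound hn hθ hk H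
    exact ⟨C, hC, N₁, fun N hN j => hN₁ N hN j.1.1 j.1.2.1 j.2.1 j.2.2 j.1.2.2⟩
  have hC : ∃ C : ℝ, 0 ≤ C ∧ ∃ N₁ : ℕ, ∀ N ≥ N₁, ∀ j : J,
      P {ω | ∃ η, C * (fluct N / N) * (1 + Z j.1.1 j.1.2.1 j.1.2.2 ω) ≤ η ∧
        ∀ s, ¬ Test j N η ω s} ≤ ENNReal.ofReal (C / (N : ℝ) ^ 2) :=
    ⟨C₂, hC₂, N₂, fun N hN j => h₂ N hN j.1.1 j.1.2.1 j.2.1 j.2.2 j.1.2.2⟩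
  refine ⟨fun ε δ _ hδ η hη hηε => ?_, designParam, designParam_pos, tendsto_designParam,
    fun κ φ hφ hcφ t₁ => ?_⟩
  · obtain ⟨N₀, hN₀⟩ := exists_window_guarantee hS hC (fun δ hδ => by
      obtain ⟨b, hb⟩ := hZ δ hδ
      exact ⟨b, fun j => hb _ _ j.2.1 _⟩) hδ hη hηε
    exact ⟨N₀, fun N hN κ φ hφ hcφ t₁ => hN₀ N hN ⟨(κ, φ, t₁), hφ, hcφ⟩⟩
  · exact ae_asymptotic_guarantee (hS 1) hC ⟨(κ, φ, t₁), hφ, hcφ⟩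

theorem isEstimator_prediction (hn : IsNoise S P x₀ w v) (ξ : Fin n → ℝ) :
    IsEstimator S P x₀ w v (IsCausalPred P x₀ w v) ξ (fun s => predictor S s ξ) (Popt S)
      fun s i _ => Popt S s + (obsPinv S i * blockNoiseCov S i * (obsPinv S i)ᵀ).trace where
  sound κ s i his hobs hi := by
    refine ⟨0, ?_, fun φ hφ hc => ?_⟩
    · rw [Matrix.transpose_zero, Matrix.zero_mul, smul_zero, add_zero, quadraticMean_blockOut hi]
    · obtain ⟨ℱ, hF⟩ := exists_isPast_of_isCausalPred hn hφ hc
      refine ⟨ℱ, hF, fun t => ?_⟩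
      simp only [Matrix.zero_mulVec, sub_zero]
      exact measurable_predError hF s ξ t
  complete κ s i his hobs hs hP := by
    refine ⟨1, 0, ?_, fun φ hφ t ω => ?_⟩
    · rw [Matrix.transpose_one, Matrix.mul_one, Matrix.one_mul, zero_add,
        quadraticMean_blockOut (Finset.disjoint_of_subset_left his hs), Popt]
    · rw [Matrix.one_mulVec, Matrix.zero_mulVec, add_zero, predError]

theorem quadraticMean_transpose_mul_comm {ι κ : Type*} [Fintype ι] [Fintype κ] (σ : ι → ℝ)
    (B U : Matrix κ ι ℝ) : quadraticMean σ (Uᵀ * B) = quadraticMean σ (Bᵀ * U) := by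
  simp only [quadraticMean, Matrix.mul_apply, Matrix.transpose_apply, mul_comm]

theorem isEstimator_filtering (hσv : 0 < S.σv) (hn : IsNoise S P x₀ w v) (ξ : Fin n → ℝ) :
    IsEstimator S P x₀ w v (IsCausalFilt P x₀ w v) ξ (fun s => filterEst S s ξ) (Fopt S)
      fun s i hi => Fopt S s + (obsPinv S i * blockNoiseCov S i * (obsPinv S i)ᵀ).trace
        - 2 * gainCorrection S s i hi where
  sound κ s i his hobs hi := by
    refine ⟨gainOut κ (obsIndex S i) (filterGain S s), ?_, fun φ hφ hc => ?_⟩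
    · rw [quadraticMean_add, quadraticMean_smul, quadraticMean_blockOut hi,
        quadraticMean_gainOut_blockOut hobs his hi]
      ring
    · obtain ⟨ℱ, hF, hFφ, hFv⟩ := exists_isPast_of_isCausalFilt hn hφ hc
      refine ⟨ℱ, hF, fun t => ?_⟩
      simp only [filterError_sub_gainOut (obsIndex_spec hobs).1]
      have h1 := @measurable_mulVec Ω (ℱ t) _ _ _ _ (1 - filterGain S s * subC S s) _
        (measurable_predError (S := S) hF s ξ t)
      have h2 : Measurable[ℱ t] fun ω =>
          filterGain S s *ᵥ restrict s (fun d => if d ∈ κ then v t ω d else 0) := by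
        refine @measurable_mulVec Ω (ℱ t) _ _ _ _ _ _ (measurable_pi_of fun d => ?_)
        by_cases hd : (d : Fin p) ∈ κ
        · simp only [restrict, hd, if_true]
          exact hFv t d hd
        · simp only [restrict, hd, if_false]
          exact measurable_const
      have h3 : Measurable[ℱ t] fun ω => filterGain S s *ᵥ restrict s (φ t ω) :=
        @measurable_mulVec Ω (ℱ t) _ _ _ _ _ _
          (measurable_pi_of fun d => (measurable_pi_apply (d : Fin p)).comp (hFφ t))
      exact Measurable.sub (m := ℱ t) (Measurable.sub (m := ℱ t) h1 h2) h3
  complete κ s i his hobs hs hP := by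
    have hi := Finset.disjoint_of_subset_left his hs
    refine ⟨1 - filterGain S s * subC S s, gainOut κ (obsIndex S i) (filterGain S s), ?_,
      fun φ hφ t ω => filterError_eq hs hφ (obsIndex_spec hobs).1 t ω⟩
    rw [Matrix.transpose_add, Matrix.add_mul, Matrix.mul_add, Matrix.mul_add, quadraticMean_add,
      quadraticMean_add, quadraticMean_add, quadraticMean_transpose_mul_comm _
        (gainOut κ (obsIndex S i) (filterGain S s)) (obsPinv S i * blockOut S i κ),
      quadraticMean_blockOut hi,
      quadraticMean_gainOut_blockOut hobs his hi,
      quadraticMean_gainOut_self (obsIndex_spec hobs).1 hs, Fopt,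
      steadyFilterCov_eq s hσv hP.posSemidef, Matrix.trace_add]
    ring

end Estimators

end SecureEstimation

theorem theorem1 {n p : ℕ} (S : LinearSystem n p) (hσw : 0 < S.σw) (hσv : 0 < S.σv)
    (k θ : ℕ) (hθ : IsSparseObservable S θ) (hk : θ + 2 * k ≤ p)
    {Ω : Type*} [MeasurableSpace Ω] (P : Measure Ω) [IsProbabilityMeasure P]
    (x₀ : Ω → Fin n → ℝ) (w : ℕ → Ω → Fin n → ℝ) (v : ℕ → Ω → Fin p → ℝ)
    (hnoise : IsNoise S P x₀ w v) (ξ : Fin n → ℝ) :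
    -- the steady state error covariances exist
    (∀ s : Finset (Fin p), s.card = p - k →
      ∀ P₀ : Matrix (Fin n) (Fin n) ℝ, P₀.PosSemidef →
        Tendsto (kalmanCov S s P₀) atTop (𝓝 (steadyCov S s))) ∧
    -- prediction, with a finite window
    (∀ ε δ : ℝ, 0 < ε → 0 < δ → ∀ η : ℝ, 0 < η → η < ε →
      ∃ N₀ : ℕ, ∀ N ≥ N₀, ∀ (κ : Finset (Fin p)) (φ : ℕ → Ω → Fin p → ℝ),
        IsAttack k κ φ → IsCausalPred P x₀ w v κ φ → ∀ t₁ : ℕ,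
          ENNReal.ofReal (1 - δ) ≤
            P {ω | (∃ s, PredictionReturns S k θ ξ t₁ N η (outputPath S x₀ w v φ ω) s) ∧
              ∀ s, PredictionReturns S k θ ξ t₁ N η (outputPath S x₀ w v φ ω) s →
                avgSqError (statePath S x₀ w ω)
                  (predictor S s ξ (outputPath S x₀ w v φ ω)) t₁ N
                    ≤ maxOverSets k (Popt S) + ε}) ∧
    -- prediction, as the window grows
    (∃ η : ℕ → ℝ, (∀ N, 0 < η N) ∧ Tendsto η atTop (𝓝 0) ∧
      ∀ (κ : Finset (Fin p)) (φ : ℕ → Ω → Fin p → ℝ),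
        IsAttack k κ φ → IsCausalPred P x₀ w v κ φ → ∀ t₁ : ℕ, ∀ᵐ ω ∂P,
          (∀ᶠ N in atTop,
            ∃ s, PredictionReturns S k θ ξ t₁ N (η N) (outputPath S x₀ w v φ ω) s) ∧
          ∀ s : ℕ → Finset (Fin p),
            (∀ᶠ N in atTop,
              PredictionReturns S k θ ξ t₁ N (η N) (outputPath S x₀ w v φ ω) (s N)) →
            limsup (fun N : ℕ => ((avgSqError (statePath S x₀ w ω)
                (predictor S (s N) ξ (outputPath S x₀ w v φ ω)) t₁ N : ℝ) : EReal)) atTop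
              ≤ ((maxOverSets k (Popt S) : ℝ) : EReal)) ∧
    -- filtering, with a finite window
    (∀ ε δ : ℝ, 0 < ε → 0 < δ → ∀ η : ℝ, 0 < η → η < ε →
      ∃ N₀ : ℕ, ∀ N ≥ N₀, ∀ (κ : Finset (Fin p)) (φ : ℕ → Ω → Fin p → ℝ),
        IsAttack k κ φ → IsCausalFilt P x₀ w v κ φ → ∀ t₁ : ℕ,
          ENNReal.ofReal (1 - δ) ≤
            P {ω | (∃ s, FilteringReturns S k θ ξ t₁ N η (outputPath S x₀ w v φ ω) s) ∧
              ∀ s, FilteringReturns S k θ ξ t₁ N η (outputPath S x₀ w v φ ω) s →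
                avgSqError (statePath S x₀ w ω)
                  (filterEst S s ξ (outputPath S x₀ w v φ ω)) t₁ N
                    ≤ maxOverSets k (Fopt S) + ε}) ∧
    -- filtering, as the window grows
    (∃ η : ℕ → ℝ, (∀ N, 0 < η N) ∧ Tendsto η atTop (𝓝 0) ∧
      ∀ (κ : Finset (Fin p)) (φ : ℕ → Ω → Fin p → ℝ),
        IsAttack k κ φ → IsCausalFilt P x₀ w v κ φ → ∀ t₁ : ℕ, ∀ᵐ ω ∂P,
          (∀ᶠ N in atTop,
            ∃ s, FilteringReturns S k θ ξ t₁ N (η N) (outputPath S x₀ w v φ ω) s) ∧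
          ∀ s : ℕ → Finset (Fin p),
            (∀ᶠ N in atTop,
              FilteringReturns S k θ ξ t₁ N (η N) (outputPath S x₀ w v φ ω) (s N)) →
            limsup (fun N : ℕ => ((avgSqError (statePath S x₀ w ω)
                (filterEst S (s N) ξ (outputPath S x₀ w v φ ω)) t₁ N : ℝ) : EReal)) atTop
              ≤ ((maxOverSets k (Fopt S) : ℝ) : EReal)) := by
  have hP := (isEstimator_prediction hnoise ξ).guarantees hσw hσv hnoise hθ hk
  have hF := (isEstimator_filtering hσv hnoise ξ).guarantees hσw hσv hnoise hθ hk
  exact ⟨fun s hs P₀ hP₀ => tendsto_kalmanCov s hσw hσv (isObservable_of_card hθ hk hs) hP₀,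
    hP.1, hP.2, hF.1, hF.2⟩
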